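/- Conventions. Let $k$ be a field of characteristic $0$. Let $\mathcal A_n$ be the unital $k$-algebra generated by $t_{ij}=t_{ji}$, $1\le i\neq j\le n$, with the relations $[t_{ij},t_{lm}]=0$ for $i,j,l,m$ distinct and $[t_{jl},t_{ij}+t_{il}]=0$ for $i,j,l$ distinct; it is graded by $\deg t_{ij}=1$, with completion $\widehat{\mathcal A}_n$. The symmetric group $\mathfrak S_n$ acts by ${}^\sigma t_{ij}=t_{\sigma(i)\sigma(j)}$, and $\widehat{\mathfrak B}_n=\widehat{\mathcal A}_n\rtimes\mathfrak S_n$ is the crossed product. Products are read from right to left, the right factor being drawn at the bottom. Let $\widehat{\mathfrak B}$ be the strict monoidal category with objects the integers $n\ge 0$, $\mathrm{End}(n)=\widehat{\mathfrak B}_n$, $\mathrm{Hom}(n,m)=\{0\}$ for $n\ne m$, with $n\otimes m=n+m$ and juxtaposition of diagrams as tensor product of morphisms. Let $d_i$ be the operation that doubles the $i$-th strand, counted at the bottom; on chord diagrams a chord incident to the strand is replaced by the sum of its two lifts. Let $s_i:\widehat{\mathcal A}_{n}\to\widehat{\mathcal A}_{n-1}$ remove the $i$-th strand, a diagram with a chord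 incident to it being sent to $0$. More generally, a strand may be replaced by $m\geq 0$ parallel strands (iterated $d_i$'s if $m\ge1$, $s_i$ if $m=0$). An associator is a group-like element $\Phi\in\widehat{\mathcal A}_3$ (nonzero, with $\square\Phi=\Phi\otimes\Phi$ for the coproduct $\square$ making the $t_{ij}$ primitive) such that $$(|\otimes\Phi)\cdot d_2\Phi\cdot(\Phi\otimes|)=d_3\Phi\cdot d_1\Phi,\qquad s_1\Phi=s_2\Phi=s_3\Phi=1,$$ $$d_1\exp(\pm\tfrac12t_{12})={}^{312}\Phi\,\exp(\pm\tfrac12t_{13})\;{}^{132}(\Phi^{-1})\,\exp(\pm\tfrac12t_{23})\,\Phi\quad\text{(for both signs)},$$ where $ijl$ denotes the permutation $(1,2,3)\mapsto(i,j,l)$. Let $\mathbf{PaB}$ be the category whose objects are the parenthesizations $p$ of finitely many points (including the empty one, which is a strict unit for juxtaposition), $|p|$ denoting the number of points, and whose morphisms $p\to q$ are the braids with $|p|=|q|$ strands, with bottom end parenthesized by $p$ and top end by $q$. Juxtaposition makes sense for objects and for morphisms, and $d_i$ sends a morphism $B:p\to q$ to a morphism from $p$ with its $i$-th point replaced by $(\bullet\bullet)$,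 to $q$ with the point at the top end of the $i$-th strand replaced by $(\bullet\bullet)$. Let $a_{p,q,r}:(pq)r\to p(qr)$ be the identity braid and $c_{p,q}:pq\to qp$ the braid in which the strands of $p$, kept parallel, cross those of $q$, kept parallel, so that $c_{\bullet,\bullet}$ is the Artin generator $\sigma_1$. Let $\Phi_{p,q,r}\in\widehat{\mathcal A}_{|p|+|q|+|r|}$ be obtained from $\Phi$ by replacing its three strands by $|p|$, $|q|$, $|r|$ parallel strands, and let $R_{p,q}\in\widehat{\mathfrak B}_{|p|+|q|}$ be obtained in the same way from $R=s\exp(\tfrac12t_{12})\in\widehat{\mathfrak B}_2$, where $s$ is the transposition, its two strands (counted at the bottom) being replaced by $|p|$ and $|q|$ parallel strands. Theorem. Let $\Phi$ be an associator. There exists a unique functor $Z:\mathbf{PaB}\to\widehat{\mathfrak B}$ which is strictly monoidal (that is, strictly compatible with the empty object and with juxtaposition of objects and of morphisms) and such that, for all parenthesizations $p,q,r$, $$Z(p)=|p|,\qquad Z(c_{p,q})=R_{p,q},\qquad Z(a_{p,q,r})=\Phi_{p,q,r}.$$ Moreover $Z$ commutes with cabling: $Z(d_i(B))=d_i(Z(B))$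 for every morphism $B:p\to q$ of $\mathbf{PaB}$ and every $1\le i\le|p|$. -/

import Mathlib

open CategoryTheory
open scoped TensorProduct

universe u

/-! ## Chord diagrams on strands: infinitesimal braids -/

section ChordAlgebra

variable (k : Type u) [Field k]

/-- The infinitesimal braid relations on symbols `t i j`, where `i j` range over a set `I` of
strands.  Only the symbols with `i ≠ j` matter: `t i i` is set to zero. -/
inductive ChordRel (I : Type) : FreeAlgebra k (I × I) → FreeAlgebra k (I × I) → Prop
  | diag (i : I) : ChordRel I (FreeAlgebra.ι k (i, i)) 0
  | symm (i j : I) : ChordRel I (FreeAlgebra.ι k (i, j)) (FreeAlgebra.ι k (j, i))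
  | comm (i j l m : I) (hij : i ≠ j) (hil : i ≠ l) (him : i ≠ m) (hjl : j ≠ l) (hjm : j ≠ m)
      (hlm : l ≠ m) :
      ChordRel I (FreeAlgebra.ι k (i, j) * FreeAlgebra.ι k (l, m))
        (FreeAlgebra.ι k (l, m) * FreeAlgebra.ι k (i, j))
  | three (i j l : I) (hij : i ≠ j) (hil : i ≠ l) (hjl : j ≠ l) :
      ChordRel I
        (FreeAlgebra.ι k (j, l) * (FreeAlgebra.ι k (i, j) + FreeAlgebra.ι k (i, l)))
        ((FreeAlgebra.ι k (i, j) + FreeAlgebra.ι k (i, l)) * FreeAlgebra.ι k (j, l))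

/-- The algebra of chord diagrams for pure braids with set of strands `I`
(the algebra `𝒜_n` for `I = Fin n`). -/
abbrev ChordAlg (I : Type) : Type u := RingQuot (ChordRel k I)

variable {I J : Type}

/-- The generator `t i j`: a chord between the strands `i` and `j`. -/
noncomputable def chord (i j : I) : ChordAlg k I :=
  RingQuot.mkAlgHom k (ChordRel k I) (FreeAlgebra.ι k (i, j))

variable {k}

theorem chord_self (i : I) : chord k i i = 0 := by
  simpa [chord] using RingQuot.mkAlgHom_rel k (ChordRel.diag (k := k) i)

theorem chord_symm (i j : I) : chord k i j = chord k j i :=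
  RingQuot.mkAlgHom_rel k (ChordRel.symm (k := k) i j)

theorem chord_comm (i j l m : I) (hij : i ≠ j) (hil : i ≠ l) (him : i ≠ m) (hjl : j ≠ l)
    (hjm : j ≠ m) (hlm : l ≠ m) : Commute (chord k i j) (chord k l m) := by
  have h := RingQuot.mkAlgHom_rel k (ChordRel.comm (k := k) i j l m hij hil him hjl hjm hlm)
  simpa only [map_mul, Commute, SemiconjBy, chord] using h

theorem chord_three (i j l : I) (hij : i ≠ j) (hil : i ≠ l) (hjl : j ≠ l) :
    Commute (chord k j l) (chord k i j + chord k i l) := by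
  have h := RingQuot.mkAlgHom_rel k (ChordRel.three (k := k) i j l hij hil hjl)
  simpa only [map_mul, map_add, Commute, SemiconjBy, chord] using h

/-- The universal property of the algebra of chord diagrams. -/
noncomputable def ChordAlg.lift {A : Type*} [Ring A] [Algebra k A] (f : I → I → A)
    (hdiag : ∀ i, f i i = 0) (hsymm : ∀ i j, f i j = f j i)
    (hcomm : ∀ i j l m, i ≠ j → i ≠ l → i ≠ m → j ≠ l → j ≠ m → l ≠ m →
      Commute (f i j) (f l m))
    (hthree : ∀ i j l, i ≠ j → i ≠ l → j ≠ l → Commute (f j l) (f i j + f i l)) :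
    ChordAlg k I →ₐ[k] A :=
  RingQuot.liftAlgHom k ⟨FreeAlgebra.lift k (fun p : I × I => f p.1 p.2), by
    intro x y h
    cases h with
    | diag i => simpa using hdiag i
    | symm i j => simpa using hsymm i j
    | comm i j l m h1 h2 h3 h4 h5 h6 =>
      simpa using (hcomm i j l m h1 h2 h3 h4 h5 h6).eq
    | three i j l h1 h2 h3 => simpa using (hthree i j l h1 h2 h3).eq⟩

@[simp] theorem ChordAlg.lift_chord {A : Type*} [Ring A] [Algebra k A] (f : I → I → A)
    (h₁ h₂ h₃ h₄) (i j : I) :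
    ChordAlg.lift (k := k) f h₁ h₂ h₃ h₄ (chord k i j) = f i j := by
  simp [ChordAlg.lift, chord]

theorem ChordAlg.hom_ext {A : Type*} [Ring A] [Algebra k A] {φ ψ : ChordAlg k I →ₐ[k] A}
    (h : ∀ i j, φ (chord k i j) = ψ (chord k i j)) : φ = ψ :=
  RingQuot.ringQuot_ext' k φ ψ (FreeAlgebra.hom_ext (funext fun p => h p.1 p.2))

/-- Relabelling of strands along an injection `g`: `t i j ↦ t (g i) (g j)`.  For a permutation
this is the action `D ↦ ^g D`; for an inclusion it adds strands without chords. -/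
noncomputable def ChordAlg.relabel (g : I ↪ J) : ChordAlg k I →ₐ[k] ChordAlg k J :=
  ChordAlg.lift (fun i j => chord k (g i) (g j)) (fun _ => chord_self _)
    (fun _ _ => chord_symm _ _)
    (fun _ _ _ _ h1 h2 h3 h4 h5 h6 => chord_comm _ _ _ _ (g.injective.ne h1) (g.injective.ne h2)
      (g.injective.ne h3) (g.injective.ne h4) (g.injective.ne h5) (g.injective.ne h6))
    (fun _ _ _ h1 h2 h3 => chord_three _ _ _ (g.injective.ne h1) (g.injective.ne h2)
      (g.injective.ne h3))

section Cable

variable [DecidableEq I] [Fintype J]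

/-- The sum of all chords between the strands over `a` and the strands over `b`. -/
noncomputable def cableChord (f : J → I) (a b : I) : ChordAlg k J :=
  if a = b then 0 else
    ∑ i ∈ Finset.univ.filter (fun i => f i = a), ∑ j ∈ Finset.univ.filter (fun j => f j = b),
      chord k i j

theorem cableChord_three (f : J → I) (a b c : I) (hab : a ≠ b) (hac : a ≠ c) (hbc : b ≠ c) :
    Commute (cableChord (k := k) f b c) (cableChord f a b + cableChord f a c) := by
  classical
  simp only [cableChord, if_neg hab, if_neg hac, if_neg hbc, ← Finset.sum_add_distrib]
  refine Commute.sum_left _ _ _ fun j hj => Commute.sum_left _ _ _ fun l hl =>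
    Commute.sum_right _ _ _ fun i hi => ?_
  rw [← Finset.add_sum_erase _ _ hj, ← Finset.add_sum_erase _ _ hl, add_add_add_comm]
  simp only [Finset.mem_filter, Finset.mem_univ, true_and] at hi hj hl
  have hij : i ≠ j := by rintro rfl; exact hab (hi.symm.trans hj)
  have hil : i ≠ l := by rintro rfl; exact hac (hi.symm.trans hl)
  have hjl : j ≠ l := by rintro rfl; exact hbc (hj.symm.trans hl)
  refine (chord_three i j l hij hil hjl).add_right (Commute.add_right ?_ ?_)
  · refine Commute.sum_right _ _ _ fun j' hj' => ?_
    simp only [Finset.mem_erase, Finset.mem_filter, Finset.mem_univ, true_and] at hj'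
    have h1 : j' ≠ l := by rintro rfl; exact hbc (hj'.2.symm.trans hl)
    have h2 : j' ≠ i := by rintro rfl; exact hab (hi.symm.trans hj'.2)
    exact chord_comm _ _ _ _ hjl hij.symm hj'.1.symm hil.symm h1.symm h2.symm
  · refine Commute.sum_right _ _ _ fun l' hl' => ?_
    simp only [Finset.mem_erase, Finset.mem_filter, Finset.mem_univ, true_and] at hl'
    have h1 : l' ≠ j := by rintro rfl; exact hbc (hj.symm.trans hl'.2)
    have h2 : l' ≠ i := by rintro rfl; exact hac (hi.symm.trans hl'.2)
    exact chord_comm _ _ _ _ hjl hij.symm h1.symm hil.symm hl'.1.symm h2.symm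

/-- Cabling of chord diagrams along a map `f : J → I`: each strand `a` is replaced by the parallel
strands `j` with `f j = a` (removed if there is none), and a chord between `a` and `b` is replaced
by the sum of all chords between a strand over `a` and a strand over `b`. -/
noncomputable def ChordAlg.cable (f : J → I) : ChordAlg k I →ₐ[k] ChordAlg k J :=
  ChordAlg.lift (cableChord f) (fun i => by simp [cableChord])
    (fun a b => by
      by_cases h : a = b
      · subst h; rfl
      · simp only [cableChord, if_neg h, if_neg (Ne.symm h)]
        rw [Finset.sum_comm]
        exact Finset.sum_congr rfl fun _ _ => Finset.sum_congr rfl fun _ _ => chord_symm _ _)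
    (fun a b c d h1 h2 h3 h4 h5 h6 => by
      simp only [cableChord, if_neg h1, if_neg h6]
      refine Commute.sum_left _ _ _ fun i hi => Commute.sum_left _ _ _ fun j hj =>
        Commute.sum_right _ _ _ fun l hl => Commute.sum_right _ _ _ fun m hm => ?_
      simp only [Finset.mem_filter, Finset.mem_univ, true_and] at hi hj hl hm
      subst hi hj hl hm
      exact chord_comm _ _ _ _ (ne_of_apply_ne f h1) (ne_of_apply_ne f h2) (ne_of_apply_ne f h3)
        (ne_of_apply_ne f h4) (ne_of_apply_ne f h5) (ne_of_apply_ne f h6))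
    (fun a b c h1 h2 h3 => cableChord_three f a b c h1 h2 h3)

end Cable

/-- The element `x ⊗ 1 + 1 ⊗ x`. -/
noncomputable def ChordAlg.primitive (x : ChordAlg k I) : ChordAlg k I ⊗[k] ChordAlg k I :=
  x ⊗ₜ[k] (1 : ChordAlg k I) + (1 : ChordAlg k I) ⊗ₜ[k] x

theorem ChordAlg.primitive_add (x y : ChordAlg k I) :
    ChordAlg.primitive (x + y) = ChordAlg.primitive x + ChordAlg.primitive y := by
  simp only [ChordAlg.primitive, TensorProduct.add_tmul, TensorProduct.tmul_add]
  abel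

theorem ChordAlg.primitive_commute {x y : ChordAlg k I} (h : Commute x y) :
    Commute (ChordAlg.primitive x) (ChordAlg.primitive y) := by
  have h' := h.eq
  simp only [ChordAlg.primitive, Commute, SemiconjBy, mul_add, add_mul,
    Algebra.TensorProduct.tmul_mul_tmul, one_mul, mul_one, h']
  abel

/-- The coproduct on chord diagrams, for which every `t i j` is primitive. -/
noncomputable def ChordAlg.comul : ChordAlg k I →ₐ[k] ChordAlg k I ⊗[k] ChordAlg k I :=
  ChordAlg.lift (fun i j => ChordAlg.primitive (chord k i j))
    (fun i => by simp [ChordAlg.primitive, chord_self])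
    (fun i j => by rw [chord_symm])
    (fun i j l m h1 h2 h3 h4 h5 h6 =>
      ChordAlg.primitive_commute (chord_comm i j l m h1 h2 h3 h4 h5 h6))
    (fun i j l h1 h2 h3 => by
      rw [← ChordAlg.primitive_add]
      exact ChordAlg.primitive_commute (chord_three i j l h1 h2 h3))

/-! ### The graded completion -/

variable (k I) in
/-- The span of the chord diagrams with exactly `d` chords. -/
noncomputable def ChordAlg.degree (d : ℕ) : Submodule k (ChordAlg k I) :=
  Submodule.span k (Set.range fun p : I × I => chord k p.1 p.2) ^ d

variable (k I) in
/-- The completion of the algebra of chord diagrams with respect to the number of chords, i.e. the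
product over all `d` of the degree `d` components.  A formal sum `∑ x_d`, with `x_d` of degree `d`,
is recorded as the power series `∑ x_d X^d`. -/
noncomputable def ChordHat : Subalgebra k (PowerSeries (ChordAlg k I)) where
  carrier := {x | ∀ d, PowerSeries.coeff d x ∈ ChordAlg.degree k I d}
  mul_mem' := by
    intro x y hx hy d
    rw [PowerSeries.coeff_mul]
    refine Submodule.sum_mem _ fun p hp => ?_
    rw [Finset.HasAntidiagonal.mem_antidiagonal] at hp
    rw [← hp, ChordAlg.degree, pow_add]
    exact Submodule.mul_mem_mul (hx _) (hy _)
  add_mem' := by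
    intro x y hx hy d
    rw [map_add]
    exact Submodule.add_mem _ (hx d) (hy d)
  algebraMap_mem' := by
    intro r d
    rw [PowerSeries.algebraMap_apply, PowerSeries.coeff_C]
    split_ifs with h
    · subst h
      rw [ChordAlg.degree, pow_zero]
      exact Submodule.algebraMap_mem r
    · exact Submodule.zero_mem _

/-- Extension to the completions of an algebra morphism that sends every chord to a linear
combination of chords. -/
noncomputable def ChordHat.map (φ : ChordAlg k I →ₐ[k] ChordAlg k J)
    (hφ : ∀ i j, φ (chord k i j) ∈ ChordAlg.degree k J 1) : ChordHat k I →ₐ[k] ChordHat k J :=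
  ((PowerSeries.mapAlgHom φ).comp (ChordHat k I).val).codRestrict (ChordHat k J) (by
    intro x d
    have hle : (ChordAlg.degree k I d).map φ.toLinearMap ≤ ChordAlg.degree k J d := by
      rw [ChordAlg.degree, Submodule.map_pow, ChordAlg.degree]
      refine pow_le_pow_left' ?_ d
      rw [Submodule.map_span, Submodule.span_le]
      rintro _ ⟨_, ⟨p, rfl⟩, rfl⟩
      simpa [ChordAlg.degree] using hφ p.1 p.2
    have : PowerSeries.coeff d ((PowerSeries.mapAlgHom φ) (x : PowerSeries (ChordAlg k I))) =
        φ (PowerSeries.coeff d (x : PowerSeries (ChordAlg k I))) := by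
      simp [PowerSeries.mapAlgHom_apply]
    change PowerSeries.coeff d ((PowerSeries.mapAlgHom φ) (x : PowerSeries (ChordAlg k I))) ∈ _
    rw [this]
    exact hle ⟨_, x.2 d, rfl⟩)

theorem chord_mem_degree_one (i j : I) : chord k i j ∈ ChordAlg.degree k I 1 := by
  rw [ChordAlg.degree, pow_one]
  exact Submodule.subset_span ⟨(i, j), rfl⟩

/-- Relabelling of strands in completed chord diagrams. -/
noncomputable def ChordHat.relabel (g : I ↪ J) : ChordHat k I →ₐ[k] ChordHat k J :=
  ChordHat.map (ChordAlg.relabel g) (fun i j => by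
    simpa [ChordAlg.relabel] using chord_mem_degree_one (k := k) (g i) (g j))

theorem ChordHat.relabel_refl (x : ChordHat k I) :
    ChordHat.relabel (Equiv.refl I).toEmbedding x = x := by
  have h : ChordAlg.relabel (k := k) (Equiv.refl I).toEmbedding = AlgHom.id k _ :=
    ChordAlg.hom_ext fun i j => by simp [ChordAlg.relabel]
  refine Subtype.ext (PowerSeries.ext fun d => ?_)
  change PowerSeries.coeff d (PowerSeries.mapAlgHom _ x.1) = _
  rw [h]
  simp [PowerSeries.mapAlgHom_apply]

theorem ChordHat.relabel_trans {K : Type} (g : I ↪ J) (h : J ↪ K) (x : ChordHat k I) :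
    ChordHat.relabel (g.trans h) x = ChordHat.relabel h (ChordHat.relabel g x) := by
  have e : ChordAlg.relabel (k := k) (g.trans h) =
      (ChordAlg.relabel h).comp (ChordAlg.relabel g) :=
    ChordAlg.hom_ext fun i j => by simp [ChordAlg.relabel]
  refine Subtype.ext (PowerSeries.ext fun d => ?_)
  change PowerSeries.coeff d (PowerSeries.mapAlgHom _ x.1) =
    PowerSeries.coeff d (PowerSeries.mapAlgHom _ (PowerSeries.mapAlgHom _ x.1))
  rw [e]
  simp [PowerSeries.mapAlgHom_apply]

/-- Cabling of completed chord diagrams along a map `f : J → I`. -/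
noncomputable def ChordHat.cable [DecidableEq I] [Fintype J] (f : J → I) :
    ChordHat k I →ₐ[k] ChordHat k J :=
  ChordHat.map (ChordAlg.cable f) (fun a b => by
    simp only [ChordAlg.cable, ChordAlg.lift_chord, cableChord]
    split_ifs
    · exact Submodule.zero_mem _
    · exact Submodule.sum_mem _ fun _ _ => Submodule.sum_mem _ fun _ _ =>
        chord_mem_degree_one _ _)

/-- The operation `d_i`: doubling of the strand `i`. -/
noncomputable def ChordHat.double {n : ℕ} (i : Fin n) :
    ChordHat k (Fin n) →ₐ[k] ChordHat k (Fin (n + 1)) :=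
  ChordHat.cable (Fin.predAbove i)

/-- The operation `s_i`: removal of the strand `i`, which sends to zero the diagrams with a chord
incident to this strand. -/
noncomputable def ChordHat.remove {n : ℕ} (i : Fin (n + 1)) :
    ChordHat k (Fin (n + 1)) →ₐ[k] ChordHat k (Fin n) :=
  ChordHat.cable (Fin.succAbove i)

/-- The exponential `exp (c t_{ij}) = ∑ (c t_{ij})^d / d!`. -/
noncomputable def ChordHat.expChord (c : k) (i j : I) : ChordHat k I :=
  ⟨PowerSeries.mk fun d => ((d.factorial : k)⁻¹) • (c • chord k i j) ^ d, by
    intro d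
    rw [PowerSeries.coeff_mk]
    refine Submodule.smul_mem _ _ (Submodule.pow_mem_pow _ (Submodule.smul_mem _ c ?_) d)
    exact Submodule.subset_span ⟨(i, j), rfl⟩⟩

/-- Group-like elements: nonzero `x` with `□ x = x ⊗ x`, in the completion of
`ChordAlg k I ⊗ ChordAlg k I`, whose elements are again recorded as power series (the coefficient
of `X^d` is the component of total degree `d`). -/
def ChordHat.IsGroupLike (x : ChordHat k I) : Prop :=
  x ≠ 0 ∧
    PowerSeries.mapAlgHom ChordAlg.comul (x : PowerSeries (ChordAlg k I)) =
      PowerSeries.mapAlgHom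
        (Algebra.TensorProduct.includeLeft : ChordAlg k I →ₐ[k] ChordAlg k I ⊗[k] ChordAlg k I)
        (x : PowerSeries (ChordAlg k I)) *
      PowerSeries.mapAlgHom
        (Algebra.TensorProduct.includeRight : ChordAlg k I →ₐ[k] ChordAlg k I ⊗[k] ChordAlg k I)
        (x : PowerSeries (ChordAlg k I))

/-- Drinfeld associators.  Strands are numbered from `0`; the product `x * y` is the diagram with
`y` at the bottom and `x` on top. -/
structure IsAssociator (Φ : ChordHat k (Fin 3)) : Prop where
  groupLike : ChordHat.IsGroupLike Φ
  /-- `(| ⊗ Φ) · d₂ Φ · (Φ ⊗ |) = d₃ Φ · d₁ Φ` -/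
  pentagon :
    ChordHat.relabel (Fin.succEmb 3) Φ * ChordHat.double 1 Φ *
        ChordHat.relabel (Fin.castSuccEmb (n := 3)) Φ =
      ChordHat.double 2 Φ * ChordHat.double 0 Φ
  /-- `d₁ exp (± t₁₂ / 2) = ³¹²Φ · exp (± t₁₃ / 2) · ¹³²(Φ⁻¹) · exp (± t₂₃ / 2) · Φ` -/
  hexagon : ∀ c : k, c = 1 / 2 ∨ c = -(1 / 2) →
    ChordHat.double 0 (ChordHat.expChord c (0 : Fin 2) 1) =
      ChordHat.relabel ⟨![2, 0, 1], by decide⟩ Φ * ChordHat.expChord c 0 2 *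
        ChordHat.relabel ⟨![0, 2, 1], by decide⟩ (Ring.inverse Φ) *
        ChordHat.expChord c 1 2 * Φ
  /-- `s₁ Φ = s₂ Φ = s₃ Φ = 1` -/
  nondegenerate : ∀ i : Fin 3, ChordHat.remove i Φ = 1

end ChordAlgebra

/-! ## The category of chord diagrams for braids -/

section ChordCategory

variable (k : Type u) [Field k]

/-- Morphisms `n ⟶ m` of the category of chord diagrams: formal sums `∑_σ D_σ · σ` over the
bijections `σ : Fin n ≃ Fin m`, with `D_σ` a completed chord diagram on `m` strands, placed on top
of `σ`.  For `n = m` this is the free module with basis the symmetric group, underlying the crossed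
product; for `n ≠ m` there is no `σ` and this is `{0}`. -/
def ChordHom (n m : ℕ) : Type u := (Fin n ≃ Fin m) → ChordHat k (Fin m)

noncomputable instance (n m : ℕ) : AddCommGroup (ChordHom k n m) :=
  inferInstanceAs (AddCommGroup ((Fin n ≃ Fin m) → ChordHat k (Fin m)))

namespace ChordHom

variable {k}

theorem subsingleton_of_ne {n m : ℕ} (h : n ≠ m) : Subsingleton (ChordHom k n m) :=
  ⟨fun _ _ => funext fun σ => absurd (by simpa using Fintype.card_congr σ) h⟩

/-- The element `D · σ`. -/
noncomputable def single {n m : ℕ} (D : ChordHat k (Fin m)) (σ : Fin n ≃ Fin m) :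
    ChordHom k n m :=
  fun ρ => if ρ = σ then D else 0

/-- The product `g · f`, with `f` at the bottom and `g` on top, which is the crossed product:
`(D' τ) (D σ) = (D' · ^τ D) (τ ∘ σ)`. -/
noncomputable def mul {n m l : ℕ} (g : ChordHom k m l) (f : ChordHom k n m) : ChordHom k n l :=
  ∑ τ : Fin m ≃ Fin l, ∑ σ : Fin n ≃ Fin m,
    single (g τ * ChordHat.relabel τ.toEmbedding (f σ)) (σ.trans τ)

/-- Juxtaposition of bijections. -/
def sumPerm {n m n' m' : ℕ} (σ : Fin n ≃ Fin m) (τ : Fin n' ≃ Fin m') :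
    Fin (n + n') ≃ Fin (m + m') :=
  finSumFinEquiv.symm.trans ((Equiv.sumCongr σ τ).trans finSumFinEquiv)

/-- Juxtaposition of chord diagrams, `f` to the left of `g`. -/
noncomputable def tensor {n m n' m' : ℕ} (f : ChordHom k n m) (g : ChordHom k n' m') :
    ChordHom k (n + n') (m + m') :=
  ∑ σ : Fin n ≃ Fin m, ∑ τ : Fin n' ≃ Fin m',
    single (ChordHat.relabel (Fin.castAddEmb m') (f σ) *
      ChordHat.relabel (Fin.natAddEmb m) (g τ)) (sumPerm σ τ)

/-- The bijection obtained from `σ` by doubling the strand `i` (counted at the bottom); the two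
copies occupy the positions `i`, `i + 1` at the bottom and `σ i`, `σ i + 1` at the top. -/
def doublePerm {n m : ℕ} (i : Fin n) (σ : Fin n ≃ Fin m) : Fin (n + 1) ≃ Fin (m + 1) :=
  (finSuccEquiv' i.castSucc).trans
    ((Equiv.optionCongr σ).trans (finSuccEquiv' (σ i).castSucc).symm)

/-- The operation `d_i` on chord diagrams for braids: doubling of the strand `i`, counted at the
bottom. -/
noncomputable def double {n m : ℕ} (i : Fin n) (f : ChordHom k n m) :
    ChordHom k (n + 1) (m + 1) :=
  ∑ σ : Fin n ≃ Fin m, single (ChordHat.double (σ i) (f σ)) (doublePerm i σ)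

/-- The identity. -/
noncomputable def one (n : ℕ) : ChordHom k n n := single 1 (Equiv.refl _)

theorem sum_apply {n m : ℕ} {ι : Type*} (s : Finset ι) (F : ι → ChordHom k n m)
    (ρ : Fin n ≃ Fin m) : (∑ i ∈ s, F i) ρ = ∑ i ∈ s, F i ρ :=
  Finset.sum_apply (M := fun _ : Fin n ≃ Fin m => ChordHat k (Fin m)) ρ s F

theorem mul_apply {n m l : ℕ} (g : ChordHom k m l) (f : ChordHom k n m) (ρ : Fin n ≃ Fin l) :
    mul g f ρ = ∑ τ : Fin m ≃ Fin l,
      g τ * ChordHat.relabel τ.toEmbedding (f (ρ.trans τ.symm)) := by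
  have h : ∀ (τ : Fin m ≃ Fin l) (σ : Fin n ≃ Fin m),
      ρ = σ.trans τ ↔ ρ.trans τ.symm = σ := by
    intro τ σ
    constructor
    · rintro rfl; ext; simp
    · rintro rfl; ext; simp
  have e : mul g f ρ = ∑ τ : Fin m ≃ Fin l, ∑ σ : Fin n ≃ Fin m,
      single (g τ * ChordHat.relabel τ.toEmbedding (f σ)) (σ.trans τ) ρ := by
    unfold mul
    rw [sum_apply]
    exact Finset.sum_congr rfl fun τ _ => sum_apply _ _ _
  rw [e]
  refine Finset.sum_congr rfl fun τ _ => ?_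
  simp only [single, h]
  rw [Finset.sum_ite_eq]
  simp

theorem one_mul {n m : ℕ} (f : ChordHom k n m) : mul (one m) f = f := by
  funext ρ
  rw [mul_apply, Finset.sum_eq_single (Equiv.refl _)]
  · have : ρ.trans (Equiv.refl (Fin m)).symm = ρ := by ext; simp
    rw [this]
    simp only [one, single, if_pos]
    rw [_root_.one_mul]
    exact ChordHat.relabel_refl _
  · intro τ _ hτ
    simp [one, single, hτ]
  · simp

theorem mul_one {n m : ℕ} (f : ChordHom k n m) : mul f (one n) = f := by
  funext ρ
  rw [mul_apply, Finset.sum_eq_single ρ]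
  · simp [one, single]
  · intro τ _ hτ
    have : ρ.trans τ.symm ≠ Equiv.refl _ := by
      intro h
      apply hτ
      ext x
      have := Equiv.congr_fun h x
      simp only [Equiv.trans_apply, Equiv.refl_apply] at this
      rw [Equiv.symm_apply_eq] at this
      rw [this]
    simp [one, single, this]
  · simp

theorem mul_assoc {n m l r : ℕ} (h : ChordHom k l r) (g : ChordHom k m l)
    (f : ChordHom k n m) : mul h (mul g f) = mul (mul h g) f := by
  funext ρ
  simp only [mul_apply, map_sum, Finset.mul_sum, Finset.sum_mul]
  rw [Finset.sum_comm (γ := Fin m ≃ Fin r)]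
  refine Finset.sum_congr rfl fun υ _ => ?_
  refine Fintype.sum_equiv ((Equiv.refl (Fin m)).equivCongr υ) _ _ fun τ => ?_
  have e1 : ((Equiv.refl (Fin m)).equivCongr υ τ).trans υ.symm = τ := by ext; simp
  have e2 : ρ.trans ((Equiv.refl (Fin m)).equivCongr υ τ).symm =
      (ρ.trans υ.symm).trans τ.symm := by ext; simp
  have e3 : ((Equiv.refl (Fin m)).equivCongr υ τ).toEmbedding =
      τ.toEmbedding.trans υ.toEmbedding := by ext; simp
  rw [e1, e2, e3, ChordHat.relabel_trans, map_mul, _root_.mul_assoc]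

end ChordHom

/-- The category of completed chord diagrams for braids; its objects are natural numbers. -/
structure ChordCat (k : Type u) where
  /-- the number of strands -/
  strands : ℕ

noncomputable instance : Category (ChordCat k) where
  Hom X Y := ChordHom k X.strands Y.strands
  id X := ChordHom.one X.strands
  comp f g := ChordHom.mul g f
  id_comp := ChordHom.mul_one
  comp_id := ChordHom.one_mul
  assoc f g h := ChordHom.mul_assoc h g f

end ChordCategory

/-! ## Braid groups -/

section Braids

/-- Artin's relations; the generator `i` (with `i + 1 < n`) is the crossing of the strands in
positions `i` and `i + 1`, where positions are numbered from `0`. -/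
def braidRels (n : ℕ) : Set (FreeGroup {i : ℕ // i + 1 < n}) :=
  {r | ∃ i j : {i : ℕ // i + 1 < n}, i.1 + 1 < j.1 ∧
    r = FreeGroup.of i * FreeGroup.of j * (FreeGroup.of j * FreeGroup.of i)⁻¹} ∪
  {r | ∃ i j : {i : ℕ // i + 1 < n}, i.1 + 1 = j.1 ∧
    r = FreeGroup.of i * FreeGroup.of j * FreeGroup.of i *
      (FreeGroup.of j * FreeGroup.of i * FreeGroup.of j)⁻¹}

/-- The braid group on `n` strands.  The product `x * y` is the braid with `y` at the bottom and
`x` on top. -/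
abbrev Braid (n : ℕ) : Type := PresentedGroup (braidRels n)

namespace Braid

/-- The Artin generator `σ i`. -/
def gen {n : ℕ} (i : ℕ) (h : i + 1 < n) : Braid n := PresentedGroup.of ⟨i, h⟩

theorem gen_comm {n : ℕ} {i j : ℕ} (hi : i + 1 < n) (hj : j + 1 < n) (h : i + 1 < j) :
    gen i hi * gen j hj = gen j hj * gen i hi := by
  rw [← mul_inv_eq_one]
  exact PresentedGroup.one_of_mem (Or.inl ⟨⟨i, hi⟩, ⟨j, hj⟩, h, rfl⟩)

theorem gen_braid {n : ℕ} {i : ℕ} (hi : i + 1 < n) (hj : i + 1 + 1 < n) :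
    gen i hi * gen (i + 1) hj * gen i hi = gen (i + 1) hj * gen i hi * gen (i + 1) hj := by
  rw [← mul_inv_eq_one]
  exact PresentedGroup.one_of_mem (Or.inr ⟨⟨i, hi⟩, ⟨i + 1, hj⟩, rfl, rfl⟩)

/-- The universal property of the braid group. -/
def lift {n : ℕ} {G : Type*} [Group G] (s : ∀ i, i + 1 < n → G)
    (hcomm : ∀ i j (hi : i + 1 < n) (hj : j + 1 < n), i + 1 < j →
      s i hi * s j hj = s j hj * s i hi)
    (hbraid : ∀ i (hi : i + 1 < n) (hj : i + 1 + 1 < n),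
      s i hi * s (i + 1) hj * s i hi = s (i + 1) hj * s i hi * s (i + 1) hj) : Braid n →* G :=
  PresentedGroup.toGroup (f := fun i => s i.1 i.2) (by
    rintro r (⟨⟨i, hi⟩, ⟨j, hj⟩, h, rfl⟩ | ⟨⟨i, hi⟩, ⟨j, hj⟩, h, rfl⟩)
    · simpa [mul_inv_eq_one, -mul_inv_rev] using hcomm i j hi hj h
    · obtain rfl : i + 1 = j := h
      simpa [mul_inv_eq_one, -mul_inv_rev] using hbraid i hi hj)

@[simp] theorem lift_gen {n : ℕ} {G : Type*} [Group G] (s : ∀ i, i + 1 < n → G) (h₁ h₂)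
    (i : ℕ) (h : i + 1 < n) : lift s h₁ h₂ (gen i h) = s i h :=
  PresentedGroup.toGroup.of _

/-- Transport along an equality of numbers of strands. -/
def cast {n m : ℕ} (h : n = m) : Braid n ≃* Braid m :=
  match h with
  | rfl => MulEquiv.refl _

@[simp] theorem cast_refl {n : ℕ} (h : n = n) (x : Braid n) : cast h x = x := rfl

@[simp] theorem cast_cast {n m l : ℕ} (h : n = m) (h' : m = l) (x : Braid n) :
    cast h' (cast h x) = cast (h.trans h') x := by
  subst h h'; rfl

theorem swap_braid {α : Type*} [DecidableEq α] {x y z : α} (hxy : x ≠ y) (hyz : y ≠ z)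
    (hxz : x ≠ z) : Equiv.swap x y * Equiv.swap y z * Equiv.swap x y =
      Equiv.swap y z * Equiv.swap x y * Equiv.swap y z := by
  have h1 := Equiv.swap_mul_swap_mul_swap hyz.symm hxz.symm
  have h2 := Equiv.swap_mul_swap_mul_swap hxy hxz
  rw [Equiv.swap_comm y x, Equiv.swap_comm z y] at h1
  rw [h1, h2, Equiv.swap_comm]

theorem swap_comm_of_lt {n : ℕ} {i j : ℕ} (hi : i + 1 < n) (hj : j + 1 < n) (h : i + 1 < j) :
    Equiv.swap (⟨i, by omega⟩ : Fin n) ⟨i + 1, hi⟩ * Equiv.swap ⟨j, by omega⟩ ⟨j + 1, hj⟩ =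
      Equiv.swap ⟨j, by omega⟩ ⟨j + 1, hj⟩ * Equiv.swap ⟨i, by omega⟩ ⟨i + 1, hi⟩ := by
  refine (Equiv.Perm.Disjoint.commute fun x => ?_).eq
  by_cases hx : x.1 < j
  · right
    exact Equiv.swap_apply_of_ne_of_ne (by rintro rfl; simp at hx)
      (by rintro rfl; simp at hx)
  · left
    exact Equiv.swap_apply_of_ne_of_ne (by rintro rfl; simp at hx; omega)
      (by rintro rfl; simp at hx; omega)

theorem swap_val {n : ℕ} {j : ℕ} (h : j + 1 < n) (i : Fin n) :
    ((Equiv.swap (⟨j, by omega⟩ : Fin n) ⟨j + 1, h⟩) i).1 =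
      if i.1 = j then j + 1 else if i.1 = j + 1 then j else i.1 := by
  rw [Equiv.swap_apply_def]
  simp only [Fin.ext_iff]
  split_ifs <;> rfl

/-- The permutation of a braid: the strand with bottom position `i` has top position `perm b i`. -/
def perm {n : ℕ} : Braid n →* Equiv.Perm (Fin n) :=
  lift (fun i h => Equiv.swap ⟨i, by omega⟩ ⟨i + 1, h⟩)
    (fun _ _ hi hj h => swap_comm_of_lt hi hj h)
    (fun i hi hj => by
      exact swap_braid (by simp) (by simp) (by simp [Nat.add_assoc]))

/-- Adding `m` strands on the right. -/
def inl {n : ℕ} (m : ℕ) : Braid n →* Braid (n + m) :=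
  lift (fun i h => gen i (by omega)) (fun _ _ _ _ h => gen_comm _ _ h)
    (fun _ _ _ => gen_braid _ _)

/-- Adding `n` strands on the left. -/
def inr (n : ℕ) {m : ℕ} : Braid m →* Braid (n + m) :=
  lift (fun i h => gen (n + i) (by omega)) (fun _ _ _ _ h => gen_comm _ _ (by omega))
    (fun _ _ _ => gen_braid _ _)

/-- Juxtaposition of braids, `x` to the left of `y`. -/
def tensor {n m : ℕ} (x : Braid n) (y : Braid m) : Braid (n + m) := inl m x * inr n y

/-- The braid in which a block of `n` strands crosses a block of `m` strands:
`(σ_{m-1} ⋯ σ_0) (σ_m ⋯ σ_1) ⋯ (σ_{n+m-2} ⋯ σ_{n-1})`. -/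
def blockCrossing (n m : ℕ) : Braid (n + m) :=
  ((List.finRange n).map fun i =>
    ((List.finRange m).reverse.map fun j => gen (n := n + m) (i.1 + j.1) (by omega)).prod).prod

/-- The generator `σ j` with the strand of top position `i` doubled. -/
def doubleGen {n : ℕ} (j : ℕ) (h : j + 1 < n) (i : ℕ) : Braid (n + 1) :=
  if i < j then gen (j + 1) (by omega)
  else if i = j then gen (j + 1) (by omega) * gen j (by omega)
  else if i = j + 1 then gen j (by omega) * gen (j + 1) (by omega)
  else gen j (by omega)

theorem doubleGen_comm {n i j : ℕ} (hi : i + 1 < n) (hj : j + 1 < n) (h : i + 1 < j) (s : ℕ) :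
    doubleGen i hi s * doubleGen j hj (if s = i then i + 1 else if s = i + 1 then i else s) =
      doubleGen j hj s *
        doubleGen i hi (if s = j then j + 1 else if s = j + 1 then j else s) := by
  have c {a b : ℕ} (ha : a + 1 < n + 1) (hb : b + 1 < n + 1) (hab : a + 1 < b) :
      Commute (gen a ha) (gen b hb) := gen_comm ha hb hab
  rcases lt_trichotomy s i with h1 | h1 | h1
  · simp (disch := omega) only [doubleGen, if_pos, if_neg]
    exact c _ _ (by omega)
  · simp (disch := omega) only [doubleGen, if_pos, if_neg]
    exact (c _ _ (by omega)).mul_left (c _ _ (by omega))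
  rcases lt_trichotomy s (i + 1) with h2 | h2 | h2
  · omega
  · simp (disch := omega) only [doubleGen, if_pos, if_neg]
    exact (c _ _ (by omega)).mul_left (c _ _ (by omega))
  rcases lt_trichotomy s j with h3 | h3 | h3
  · simp (disch := omega) only [doubleGen, if_pos, if_neg]
    exact c _ _ (by omega)
  · simp (disch := omega) only [doubleGen, if_pos, if_neg]
    exact (c _ _ (by omega)).mul_right (c _ _ (by omega))
  rcases lt_trichotomy s (j + 1) with h4 | h4 | h4
  · omega
  · simp (disch := omega) only [doubleGen, if_pos, if_neg]
    exact (c _ _ (by omega)).mul_right (c _ _ (by omega))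
  · simp (disch := omega) only [doubleGen, if_neg]
    exact c _ _ (by omega)

theorem doubleGen_braid {n i : ℕ} (hi : i + 1 < n) (hj : i + 1 + 1 < n) (s : ℕ) :
    doubleGen i hi s *
        doubleGen (i + 1) hj (if s = i then i + 1 else if s = i + 1 then i else s) *
        doubleGen i hi
          (if (if s = i then i + 1 else if s = i + 1 then i else s) = i + 1 then i + 1 + 1
            else if (if s = i then i + 1 else if s = i + 1 then i else s) = i + 1 + 1 then i + 1
            else (if s = i then i + 1 else if s = i + 1 then i else s)) =
      doubleGen (i + 1) hj s *
        doubleGen i hi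
          (if s = i + 1 then i + 1 + 1 else if s = i + 1 + 1 then i + 1 else s) *
        doubleGen (i + 1) hj
          (if (if s = i + 1 then i + 1 + 1 else if s = i + 1 + 1 then i + 1 else s) = i then i + 1
            else if (if s = i + 1 then i + 1 + 1 else if s = i + 1 + 1 then i + 1 else s) = i + 1
              then i
            else (if s = i + 1 then i + 1 + 1 else if s = i + 1 + 1 then i + 1 else s)) := by
  have hx : i + 1 < n + 1 := by omega
  have hy : i + 1 + 1 < n + 1 := by omega
  have hz : i + 1 + 1 + 1 < n + 1 := by omega
  have hxy := gen_braid hx hy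
  have hyz := gen_braid hy hz
  have hxz := gen_comm hx hz (by omega)
  generalize ex : gen i hx = x at *
  generalize ey : gen (i + 1) hy = y at *
  generalize ez : gen (i + 1 + 1) hz = z at *
  rcases lt_trichotomy s i with h1 | h1 | h1
  · simp (disch := omega) only [doubleGen, if_pos, if_neg, ex, ey, ez]
    exact hyz
  · simp (disch := omega) only [doubleGen, if_pos, if_neg, if_true, ex, ey, ez]
    calc y * x * (z * y) * x = y * (x * z) * (y * x) := by simp only [mul_assoc]
      _ = y * z * (x * y * x) := by rw [hxz]; simp only [mul_assoc]
      _ = (y * z * y) * (x * y) := by rw [hxy]; simp only [mul_assoc]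
      _ = z * y * (z * x) * y := by rw [hyz]; simp only [mul_assoc]
      _ = z * (y * x) * (z * y) := by rw [← hxz]; simp only [mul_assoc]
  rcases lt_trichotomy s (i + 1) with h2 | h2 | h2
  · omega
  · simp (disch := omega) only [doubleGen, if_pos, if_neg, if_true, ex, ey, ez]
    calc x * y * z * (y * x) = x * (y * z * y) * x := by simp only [mul_assoc]
      _ = x * z * y * (z * x) := by rw [hyz]; simp only [mul_assoc]
      _ = z * (x * y) * (z * x) := by rw [hxz]; simp only [mul_assoc]
      _ = z * (x * y) * (x * z) := by rw [hxz]
      _ = z * (x * y * x) * z := by simp only [mul_assoc]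
      _ = z * y * x * (y * z) := by rw [hxy]; simp only [mul_assoc]
  rcases lt_trichotomy s (i + 1 + 1) with h3 | h3 | h3
  · omega
  · simp (disch := omega) only [doubleGen, if_pos, if_neg, if_true, ex, ey, ez]
    calc x * (y * z) * (x * y) = x * y * (z * x) * y := by simp only [mul_assoc]
      _ = (x * y * x) * (z * y) := by rw [← hxz]; simp only [mul_assoc]
      _ = y * x * (y * z * y) := by rw [hxy]; simp only [mul_assoc]
      _ = y * (x * z) * (y * z) := by rw [hyz]; simp only [mul_assoc]
      _ = y * z * (x * y) * z := by rw [hxz]; simp only [mul_assoc]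
  · simp (disch := omega) only [doubleGen, if_neg, ex, ey, ez]
    exact hxy

/-- Braids `x` with a family of braids indexed by the strands of `x` (numbered at the top), in
which `(f, x) * (g, y) = (i ↦ f i * g (x⁻¹ i), x * y)`. -/
abbrev StrandFamily (n m : ℕ) : Type :=
  (Fin n → Braid m) ⋊[mulAutArrow (G := Equiv.Perm (Fin n))] Equiv.Perm (Fin n)

theorem StrandFamily.mul_left {n m : ℕ} (x y : StrandFamily n m) (i : Fin n) :
    (x * y).left i = x.left i * y.left (x.right⁻¹ i) := rfl

/-- Simultaneous doubling of each of the strands of a braid: the component `i` of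
`doubleHom x` is `x` with the strand of top position `i` doubled. -/
def doubleHom (n : ℕ) : Braid n →* StrandFamily n (n + 1) :=
  lift (fun j h => ⟨fun i => doubleGen j h i, Equiv.swap ⟨j, by omega⟩ ⟨j + 1, h⟩⟩)
    (fun i j hi hj h => by
      refine SemidirectProduct.ext (funext fun s => ?_) (swap_comm_of_lt hi hj h)
      simp only [StrandFamily.mul_left, Equiv.swap_inv, swap_val]
      exact doubleGen_comm hi hj h s.1)
    (fun i hi hj => by
      refine SemidirectProduct.ext (funext fun s => ?_)
        (swap_braid (by simp) (by simp) (by simp [Nat.add_assoc]))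
      simp only [StrandFamily.mul_left, SemidirectProduct.mul_right, mul_inv_rev,
        Equiv.swap_inv, Equiv.Perm.mul_apply, swap_val]
      exact doubleGen_braid hi hj s.1)

/-- The operation `d_i`: doubling of the strand `i`, counted at the bottom. -/
def double {n : ℕ} (i : Fin n) (x : Braid n) : Braid (n + 1) :=
  (doubleHom n x).left (perm x i)

@[simp] theorem doubleHom_right {n : ℕ} (x : Braid n) : (doubleHom n x).right = perm x := by
  have h : (SemidirectProduct.rightHom : StrandFamily n (n + 1) →* Equiv.Perm (Fin n)).comp
      (doubleHom n) = perm := by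
    refine PresentedGroup.ext fun i => ?_
    change (doubleHom n (gen i.1 i.2)).right = perm (gen i.1 i.2)
    simp [doubleHom, perm]
  exact DFunLike.congr_fun h x

theorem double_mul {n : ℕ} (i : Fin n) (x y : Braid n) :
    double i (x * y) = double (perm y i) x * double i y := by
  simp [double, StrandFamily.mul_left]

theorem double_gen {n : ℕ} (i : Fin n) (j : ℕ) (h : j + 1 < n) :
    double i (gen j h) =
      if i.1 < j then gen (j + 1) (by omega)
      else if i.1 = j then gen j (by omega) * gen (j + 1) (by omega)
      else if i.1 = j + 1 then gen (j + 1) (by omega) * gen j (by omega)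
      else gen j (by omega) := by
  have h1 : double i (gen j h) = doubleGen j h
      ((Equiv.swap (⟨j, by omega⟩ : Fin n) ⟨j + 1, h⟩) i).1 := by
    simp [double, doubleHom, perm]
  rw [h1, swap_val]
  unfold doubleGen
  split_ifs <;> first | rfl | omega

end Braid

end Braids

/-! ## Parenthesized braids -/

section ParenthesizedBraids

/-- Parenthesizations: the empty one `1`, and the nonempty bracketings of points, elements of the
free magma on one generator.  The product is juxtaposition. -/
def PaB : Type := WithOne (FreeMagma Unit)

namespace PaB

instance : MulOneClass PaB := inferInstanceAs (MulOneClass (WithOne (FreeMagma Unit)))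

/-- A nonempty parenthesization. -/
def ofTree (t : FreeMagma Unit) : PaB := ((t : WithOne (FreeMagma Unit)))

/-- The number `|p|` of points of a parenthesization. -/
def length (p : PaB) : ℕ :=
  WithOne.recOneCoe (motive := fun _ => ℕ) 0 FreeMagma.length p

@[simp] theorem length_one : length 1 = 0 := rfl

@[simp] theorem length_mul (p q : PaB) : length (p * q) = length p + length q := by
  rcases p with _ | s
  · rcases q with _ | t
    · rfl
    · exact (Nat.zero_add _).symm
  · rcases q with _ | t
    · rfl
    · rfl

/-- Doubling of the point of index `i` of a nonempty bracketing: `•` becomes `(••)`. -/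
def doubleTree : FreeMagma Unit → ℕ → FreeMagma Unit
  | .of a, _ => .mul (.of a) (.of a)
  | .mul s t, i =>
    if i < s.length then .mul (doubleTree s i) t else .mul s (doubleTree t (i - s.length))

theorem length_doubleTree (t : FreeMagma Unit) (i : ℕ) :
    (doubleTree t i).length = t.length + 1 := by
  match t, i with
  | .of a, _ => rfl
  | .mul s t, i =>
    have hs := length_doubleTree s i
    have ht := length_doubleTree t (i - s.length)
    unfold doubleTree
    split_ifs
    · change (doubleTree s i).length + t.length = s.length + t.length + 1
      omega
    · change s.length + (doubleTree t (i - s.length)).length = s.length + t.length + 1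
      omega

/-- Doubling of the point of index `i` of a parenthesization. -/
def double (p : PaB) (i : Fin p.length) : PaB :=
  WithOne.recOneCoe (motive := fun _ => PaB) 1 (fun t => ofTree (doubleTree t i)) p

theorem length_double (p : PaB) (i : Fin p.length) : (p.double i).length = p.length + 1 := by
  rcases p with _ | t
  · exact i.elim0
  · exact length_doubleTree t i

/-- Morphisms of parenthesized braids `p ⟶ q`: braids with bottom end parenthesized by `p` and top
end parenthesized by `q`. -/
@[ext] structure Hom (p q : PaB) where
  length_eq : p.length = q.length
  braid : Braid p.length

instance : Category PaB where
  Hom := Hom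
  id p := ⟨rfl, 1⟩
  comp f g := ⟨f.length_eq.trans g.length_eq,
    Braid.cast f.length_eq.symm g.braid * f.braid⟩
  id_comp f := by
    refine Hom.ext ?_
    simp
  comp_id f := by
    refine Hom.ext ?_
    simp
  assoc f g h := by
    refine Hom.ext ?_
    simp [mul_assoc]

/-- Juxtaposition of parenthesized braids. -/
def tensorHom {p q p' q' : PaB} (f : p ⟶ q) (g : p' ⟶ q') : (p * p') ⟶ (q * q') :=
  Hom.mk (by rw [length_mul, length_mul, f.length_eq, g.length_eq])
    (Braid.cast (length_mul p p').symm (Braid.tensor f.braid g.braid))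

/-- The identity braid, as a morphism `(p q) r ⟶ p (q r)`. -/
def assocHom (p q r : PaB) : ((p * q) * r) ⟶ (p * (q * r)) :=
  Hom.mk (by simp only [length_mul, Nat.add_assoc]) 1

/-- The braid `c_{p,q}` in which the strands of `p` cross the strands of `q`. -/
def braidingHom (p q : PaB) : (p * q) ⟶ (q * p) :=
  Hom.mk (by simp only [length_mul, Nat.add_comm])
    (Braid.cast (length_mul p q).symm (Braid.blockCrossing p.length q.length))

/-- The top position of the strand with bottom position `i`. -/
def topIndex {p q : PaB} (f : p ⟶ q) (i : Fin p.length) : Fin q.length :=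
  Fin.cast f.length_eq (Braid.perm f.braid i)

/-- The operation `d_i` on parenthesized braids: doubling of the strand `i`, counted at the
bottom. -/
def doubleHom {p q : PaB} (f : p ⟶ q) (i : Fin p.length) :
    p.double i ⟶ q.double (topIndex f i) :=
  Hom.mk (by rw [length_double, length_double, f.length_eq])
    (Braid.cast (length_double p i).symm (Braid.double i f.braid))

end PaB

end ParenthesizedBraids

/-! ## Strictly monoidal functors from parenthesized braids to chord diagrams -/

section Functors

variable {k : Type u} [Field k]

/-- The cabled associator `Φ_{a,b,c}`: the three strands of `Φ` are replaced by `a`, `b` and `c`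
parallel strands. -/
noncomputable def cabledAssociator (Φ : ChordHat k (Fin 3)) (a b c : ℕ) :
    ChordHom k (a + b + c) (a + b + c) :=
  ChordHom.single
    (ChordHat.cable (fun j => if j.1 < a then 0 else if j.1 < a + b then 1 else 2) Φ)
    (Equiv.refl _)

variable (k) in
/-- The cabled `R`-matrix `R_{a,b}`: in `R = s · exp (t₁₂ / 2)`, with `s` the transposition, the
two strands (counted at the bottom) are replaced by `a` and `b` parallel strands. -/
noncomputable def cabledR (a b : ℕ) : ChordHom k (a + b) (b + a) :=
  ChordHom.mul (ChordHom.single 1 finAddFlip)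
    (ChordHom.single
      (ChordHat.cable (fun j => if j.1 < a then 0 else 1)
        (ChordHat.expChord (1 / 2 : k) (0 : Fin 2) 1))
      (Equiv.refl _))

/-- Strictly monoidal functors: they are strictly compatible with the empty object and with
juxtaposition of objects and of morphisms. -/
structure IsStrictMonoidal (Z : PaB ⥤ ChordCat k) : Prop where
  obj_one : Z.obj 1 = ⟨0⟩
  obj_mul : ∀ p q, Z.obj (p * q) = ⟨(Z.obj p).strands + (Z.obj q).strands⟩
  map_tensor : ∀ {p q p' q' : PaB} (f : p ⟶ q) (g : p' ⟶ q'),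
    Z.map (PaB.tensorHom f g) =
      eqToHom (obj_mul p p') ≫
        (show (⟨(Z.obj p).strands + (Z.obj p').strands⟩ : ChordCat k) ⟶
            ⟨(Z.obj q).strands + (Z.obj q').strands⟩ from
          ChordHom.tensor (Z.map f) (Z.map g)) ≫
        eqToHom (obj_mul q q').symm

/-- For a functor with `Z p = |p|` on objects, the value of `Z` on a morphism `p ⟶ q`, as a
morphism `n ⟶ m` where `|p| = n` and `|q| = m`. -/
noncomputable def mapOfLength (Z : PaB ⥤ ChordCat k)
    (hZ : ∀ p, Z.obj p = ⟨p.length⟩) {p q : PaB} (f : p ⟶ q) {n m : ℕ} (hn : p.length = n)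
    (hm : q.length = m) : ChordHom k n m :=
  show (⟨n⟩ : ChordCat k) ⟶ ⟨m⟩ from
    eqToHom (by rw [hZ, hn]) ≫ Z.map f ≫ eqToHom (by rw [hZ, hm])

/-- The properties that characterize the functor `Z` associated with `Φ`. -/
structure IsDrinfeldFunctor (Φ : ChordHat k (Fin 3)) (Z : PaB ⥤ ChordCat k) : Prop where
  strictMonoidal : IsStrictMonoidal Z
  obj_eq : ∀ p, Z.obj p = ⟨p.length⟩
  map_braiding : ∀ p q : PaB,
    mapOfLength Z obj_eq (PaB.braidingHom p q) (PaB.length_mul p q) (PaB.length_mul q p) =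
      cabledR k p.length q.length
  map_assoc : ∀ p q r : PaB,
    mapOfLength Z obj_eq (PaB.assocHom p q r)
        (n := p.length + q.length + r.length) (m := p.length + q.length + r.length)
        (by simp only [PaB.length_mul]) (by simp only [PaB.length_mul, Nat.add_assoc]) =
      cabledAssociator Φ p.length q.length r.length

/-- Compatibility with all the operations of doubling a strand: `Z (d_i B) = d_i (Z B)`. -/
def CommutesWithCabling (Z : PaB ⥤ ChordCat k) (hZ : ∀ p, Z.obj p = ⟨p.length⟩) : Prop :=
  ∀ {p q : PaB} (f : p ⟶ q) (i : Fin p.length),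
    mapOfLength Z hZ (PaB.doubleHom f i) (PaB.length_double p i) (PaB.length_double q _) =
      ChordHom.double i (mapOfLength Z hZ f rfl rfl)

end Functors

/-! Let `ℓ n` be the left-normed parenthesization of `n` points. Every parenthesization `p` is
joined to `ℓ |p|` by a trivial braid, composed of associativity morphisms, their inverses and
identities. Hence a morphism `f : p ⟶ q` is a trivial braid `p ⟶ ℓ |p|`, then a braid with
left-normed ends, then a trivial braid `ℓ |q| ⟶ q`. This decomposition gives both existence and
uniqueness.

For existence, fix one path from `p` to `ℓ |p|` and let `regroupPaB φ 0 p` be the corresponding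
product of inverse cabled associators. Let the Artin generator `i` act on `ℓ n` by `sigma φ i`,
which is `R` conjugated by `Φ_{i,1,1}`. Then `eval` is defined by the decomposition. It is
functorial as soon as the `sigma` satisfy the braid relations. Distant generators commute by
locality: a diagram on some strands commutes with any diagram in which these strands are parallel
(`commute_cab`). The cubic relation for `i = 0` is the Yang-Baxter argument: the hexagon
(`crossing_hexagon`) computes the crossing of two strands with one, and this crossing is natural
(`shift_mul_crossing`). The pentagon moves the relation to every `i` (`regroup_mul_shift_sigma`).

The pentagon also shows that reparenthesizing `ℓ n ⊗ p` may begin inside `p` (`regroupPaB_eq`),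
which gives compatibility with juxtaposition (`eval_tensorHom`). The value on associativity
morphisms holds by the choice of paths (`eval_assocHom`). The braids `c_{p,q}` satisfy two hexagons,
one for each argument, and so do the cabled `R`, by the hexagon axiom for the signs `+` and `-`. An
induction on `p` and `q` then compares them (`eval_braidingHom`). The condition `s_i Φ = 1` makes
the empty parenthesization a strict unit.

For cabling, doubling a strand of `ℓ n` gives a parenthesization other than `ℓ (n + 1)`, and
`Φ_{i,1,1}` joins the two. With these corrections at both ends, doubling is compatible with the
braid representation (`braidRep_double`; it is enough to check generators, by the pentagon and the
hexagons) and with reparenthesization (`regroupPaB_double`). The corrections cancel in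
`eval_doubleHom`.

For uniqueness, the braidings, the associativity morphisms, composition, inverses and juxtaposition
generate all of `PaB` (`IsDrinfeldFunctor.agreeOn`).

To avoid transport between `Fin n` and `Fin m`, all computations take place in one group,
`StrandGroup`, on the strands `ℕ`. The number of strands survives only as a support condition, and
`toHom` passes to the category at the end. Every identity between cablings reduces to a statement on
finite sets of natural numbers. -/

section ChordCabling

/-! ### Cabling along disjoint finite sets of strands, and locality. -/

variable {k : Type u} [Field k] {I J K : Type}

/-- The terms `l = i` and `l = j` together commute with the chord by the three-strand relation;
every other term has no strand in common with it. This is the source of all locality statements. -/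
theorem chord_commute_sum {A : Finset J} {i j m : J} (hi : i ∈ A) (hj : j ∈ A) (hm : m ∉ A) :
    Commute (chord k i j) (∑ l ∈ A, chord k l m) := by
  classical
  rcases eq_or_ne i j with rfl | hij
  · rw [chord_self]; exact Commute.zero_left _
  have hmi : m ≠ i := by rintro rfl; exact hm hi
  have hmj : m ≠ j := by rintro rfl; exact hm hj
  rw [← Finset.add_sum_erase _ _ hi,
    ← Finset.add_sum_erase _ _ (Finset.mem_erase.2 ⟨hij.symm, hj⟩), ← add_assoc]
  refine Commute.add_right ?_ (Commute.sum_right _ _ _ fun l hl => ?_)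
  · rw [chord_symm i m, chord_symm j m]
    exact chord_three m i j hmi hmj hij
  · simp only [Finset.mem_erase] at hl
    refine chord_comm i j l m hij (Ne.symm hl.2.1) hmi.symm (Ne.symm hl.1) hmj.symm ?_
    rintro rfl
    exact hm hl.2.2

/-- A family of disjoint finite sets of strands indexed by `I`, used to replace each strand `a`
by the parallel strands in `fib a`. -/
@[ext] structure StrandMap (I J : Type) where
  /-- the strands that replace the strand `a` -/
  fib : I → Finset J
  disj : ∀ ⦃a b⦄, a ≠ b → Disjoint (fib a) (fib b)

namespace StrandMap

/-- The family of singletons given by an injection. -/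
def ofEmb (g : I ↪ J) : StrandMap I J where
  fib a := {g a}
  disj a b h := by simpa using h

/-- The family of fibres of a map. -/
def ofFun [DecidableEq I] [Fintype J] (f : J → I) : StrandMap I J where
  fib a := Finset.univ.filter fun i => f i = a
  disj a b h := Finset.disjoint_left.2 fun x hx hx' => by
    simp only [Finset.mem_filter, Finset.mem_univ, true_and] at hx hx'
    exact h (hx.symm.trans hx')

open Classical in
/-- Composition of families of disjoint finite sets. -/
noncomputable def trans (F : StrandMap I J) (G : StrandMap J K) : StrandMap I K where
  fib a := (F.fib a).biUnion G.fib
  disj a b h := by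
    simp only [Finset.disjoint_biUnion_left, Finset.disjoint_biUnion_right]
    intro i hi j hj
    refine G.disj ?_
    rintro rfl
    first
      | exact Finset.disjoint_left.1 (F.disj h) hi hj
      | exact Finset.disjoint_left.1 (F.disj h) hj hi

@[simp] theorem mem_ofEmb (g : I ↪ J) (a : I) (x : J) : x ∈ (ofEmb g).fib a ↔ x = g a := by
  simp [ofEmb]

@[simp] theorem mem_ofFun [DecidableEq I] [Fintype J] (f : J → I) (a : I) (x : J) :
    x ∈ (ofFun f).fib a ↔ f x = a := by
  simp [ofFun]

@[simp] theorem mem_trans (F : StrandMap I J) (G : StrandMap J K) (a : I) (x : K) :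
    x ∈ (F.trans G).fib a ↔ ∃ y ∈ F.fib a, x ∈ G.fib y := by
  simp [trans]

theorem ext_mem {F G : StrandMap I J} (h : ∀ a x, x ∈ F.fib a ↔ x ∈ G.fib a) : F = G :=
  StrandMap.ext (funext fun a => Finset.ext (h a))

end StrandMap

open Classical in
/-- The sum of all chords between the strands over `a` and the strands over `b`. -/
noncomputable def StrandMap.chordSum (F : StrandMap I J) (a b : I) : ChordAlg k J :=
  if a = b then 0 else ∑ i ∈ F.fib a, ∑ j ∈ F.fib b, chord k i j

theorem StrandMap.chordSum_of_ne (F : StrandMap I J) {a b : I} (h : a ≠ b) :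
    F.chordSum a b = ∑ i ∈ F.fib a, ∑ j ∈ F.fib b, chord k i j := if_neg h

theorem StrandMap.chordSum_self (F : StrandMap I J) (a : I) : F.chordSum (k := k) a a = 0 :=
  if_pos rfl

theorem StrandMap.chordSum_symm (F : StrandMap I J) (a b : I) :
    F.chordSum (k := k) a b = F.chordSum b a := by
  by_cases h : a = b
  · subst h; rfl
  · rw [F.chordSum_of_ne h, F.chordSum_of_ne (Ne.symm h), Finset.sum_comm]
    exact Finset.sum_congr rfl fun _ _ => Finset.sum_congr rfl fun _ _ => chord_symm _ _

/-- A chord between two strands of a set `S` commutes with the sum of the chords between two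
cables, each of which contains `S` or is disjoint from it. -/
theorem StrandMap.chord_commute_chordSum (F : StrandMap I J) {S : Set J} {i j : J} (hi : i ∈ S)
    (hj : j ∈ S) (h : ∀ a, S ⊆ F.fib a ∨ Disjoint S (F.fib a : Set J)) (a b : I) :
    Commute (chord k i j) (F.chordSum a b) := by
  rcases eq_or_ne i j with rfl | hij
  · rw [chord_self]; exact Commute.zero_left _
  by_cases hab : a = b
  · rw [StrandMap.chordSum, if_pos hab]; exact Commute.zero_right _
  -- When one cable contains `S`, the chords are grouped by their end `m` on the other cable, and
  -- each group is a sum as in `chord_commute_sum`.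
  have key : ∀ a b, a ≠ b → S ⊆ F.fib a → Commute (chord k i j) (F.chordSum a b) := by
    intro a b hab ha
    rw [F.chordSum_of_ne hab, Finset.sum_comm]
    refine Commute.sum_right _ _ _ fun m hm => chord_commute_sum (ha hi) (ha hj) fun hm' => ?_
    exact Finset.disjoint_left.1 (F.disj hab) hm' hm
  rcases h a with ha | ha
  · exact key a b hab ha
  rcases h b with hb | hb
  · rw [F.chordSum_symm]
    exact key b a (Ne.symm hab) hb
  rw [F.chordSum_of_ne hab]
  refine Commute.sum_right _ _ _ fun l hl => Commute.sum_right _ _ _ fun m hm => ?_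
  have hd : ∀ {x y : J} {c : I}, Disjoint S (F.fib c : Set J) → x ∈ S → y ∈ F.fib c → x ≠ y := by
    rintro x y c hc hx hy rfl
    exact Set.disjoint_left.1 hc hx hy
  refine chord_comm _ _ _ _ hij (hd ha hi hl) (hd hb hi hm) (hd ha hj hl) (hd hb hj hm) ?_
  rintro rfl
  exact Finset.disjoint_left.1 (F.disj hab) hl hm

theorem StrandMap.chordSum_comm (F : StrandMap I J) (a b c d : I) (hab : a ≠ b) (hac : a ≠ c)
    (had : a ≠ d) (hbc : b ≠ c) (hbd : b ≠ d) (hcd : c ≠ d) :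
    Commute (F.chordSum (k := k) a b) (F.chordSum c d) := by
  rw [F.chordSum_of_ne hab, F.chordSum_of_ne hcd]
  have hd : ∀ {x y : J} {c d : I}, c ≠ d → x ∈ F.fib c → y ∈ F.fib d → x ≠ y := by
    rintro x y c d h hx hy rfl
    exact Finset.disjoint_left.1 (F.disj h) hx hy
  exact Commute.sum_left _ _ _ fun i hi => Commute.sum_left _ _ _ fun j hj =>
    Commute.sum_right _ _ _ fun l hl => Commute.sum_right _ _ _ fun m hm =>
      chord_comm _ _ _ _ (hd hab hi hj) (hd hac hi hl) (hd had hi hm) (hd hbc hj hl)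
        (hd hbd hj hm) (hd hcd hl hm)

/-- For each strand `m` over `a`, the sum runs over all strands in the union of the cables `b` and
`c`. A chord between these cables has both ends in this union, so `chord_commute_sum` applies. -/
theorem StrandMap.chordSum_three (F : StrandMap I J) (a b c : I) (hab : a ≠ b) (hac : a ≠ c)
    (hbc : b ≠ c) :
    Commute (F.chordSum (k := k) b c) (F.chordSum a b + F.chordSum a c) := by
  classical
  have hd : ∀ {x : J} {c d : I}, c ≠ d → x ∈ F.fib c → x ∉ F.fib d := fun h hx hy =>
    Finset.disjoint_left.1 (F.disj h) hx hy
  have e : F.chordSum (k := k) a b + F.chordSum a c =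
      ∑ m ∈ F.fib a, ∑ l ∈ F.fib b ∪ F.fib c, chord k l m := by
    rw [F.chordSum_of_ne hab, F.chordSum_of_ne hac, ← Finset.sum_add_distrib]
    refine Finset.sum_congr rfl fun m _ => ?_
    rw [Finset.sum_union (F.disj hbc)]
    simp only [chord_symm m]
  rw [e, F.chordSum_of_ne hbc]
  refine Commute.sum_left _ _ _ fun i hi => Commute.sum_left _ _ _ fun j hj =>
    Commute.sum_right _ _ _ fun m hm => chord_commute_sum (Finset.mem_union_left _ hi)
      (Finset.mem_union_right _ hj) ?_
  rw [Finset.mem_union, not_or]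
  exact ⟨hd hab hm, hd hac hm⟩

/-- Cabling of chord diagrams along a family of disjoint finite sets of strands. -/
noncomputable def ChordAlg.cab (F : StrandMap I J) : ChordAlg k I →ₐ[k] ChordAlg k J :=
  ChordAlg.lift F.chordSum F.chordSum_self F.chordSum_symm F.chordSum_comm F.chordSum_three

@[simp] theorem ChordAlg.cab_chord (F : StrandMap I J) (a b : I) :
    ChordAlg.cab F (chord k a b) = F.chordSum a b := by
  rw [ChordAlg.cab, ChordAlg.lift_chord]

theorem ChordAlg.relabel_eq_cab (g : I ↪ J) :
    ChordAlg.relabel (k := k) g = ChordAlg.cab (StrandMap.ofEmb g) := by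
  refine ChordAlg.hom_ext fun a b => ?_
  rw [ChordAlg.cab_chord, ChordAlg.relabel, ChordAlg.lift_chord]
  by_cases h : a = b
  · simp [StrandMap.chordSum, h, chord_self]
  · simp [StrandMap.chordSum, h, StrandMap.ofEmb]

theorem ChordAlg.cable_eq_cab [DecidableEq I] [Fintype J] (f : J → I) :
    ChordAlg.cable (k := k) f = ChordAlg.cab (StrandMap.ofFun f) := by
  refine ChordAlg.hom_ext fun a b => ?_
  rw [ChordAlg.cab_chord, ChordAlg.cable, ChordAlg.lift_chord]
  by_cases h : a = b
  · simp [StrandMap.chordSum, cableChord, h]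
  · simp [StrandMap.chordSum, cableChord, h, StrandMap.ofFun]

/-- Sums over a union of disjoint fibres split. Strands in different cables of `F` are distinct, so
the inner sums never fall in the case where `chordSum` is zero by convention. -/
theorem ChordAlg.cab_comp_cab (F : StrandMap I J) (G : StrandMap J K) :
    (ChordAlg.cab (k := k) G).comp (ChordAlg.cab F) = ChordAlg.cab (F.trans G) := by
  classical
  refine ChordAlg.hom_ext fun a b => ?_
  rw [AlgHom.comp_apply, ChordAlg.cab_chord, ChordAlg.cab_chord]
  by_cases h : a = b
  · simp [StrandMap.chordSum, h]
  rw [StrandMap.chordSum_of_ne _ h, StrandMap.chordSum_of_ne _ h]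
  have hU : ∀ a, (F.trans G).fib a = (F.fib a).biUnion G.fib := fun a => by ext; simp
  have hp : ∀ a, ((F.fib a : Set J)).PairwiseDisjoint G.fib := fun a i _ j _ hij => G.disj hij
  rw [hU, hU, Finset.sum_biUnion (hp a), map_sum]
  refine Finset.sum_congr rfl fun i hi => ?_
  rw [map_sum, Finset.sum_comm, Finset.sum_biUnion (hp b)]
  refine Finset.sum_congr rfl fun j hj => ?_
  have hij : i ≠ j := by
    rintro rfl
    exact Finset.disjoint_left.1 (F.disj h) hi hj
  rw [ChordAlg.cab_chord, StrandMap.chordSum_of_ne _ hij, Finset.sum_comm]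

/-! ### Completed chord diagrams -/

namespace ChordHat

theorem ext_coeff {x y : ChordHat k I}
    (h : ∀ d, PowerSeries.coeff d x.1 = PowerSeries.coeff d y.1) : x = y :=
  Subtype.ext (PowerSeries.ext h)

theorem coeff_map (φ : ChordAlg k I →ₐ[k] ChordAlg k J) (hφ) (x : ChordHat k I) (d : ℕ) :
    PowerSeries.coeff d (ChordHat.map φ hφ x).1 = φ (PowerSeries.coeff d x.1) := by
  change PowerSeries.coeff d (PowerSeries.mapAlgHom φ x.1) = _
  simp [PowerSeries.mapAlgHom_apply]

theorem coeff_mul' (x y : ChordHat k I) (d : ℕ) :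
    PowerSeries.coeff d (x * y).1 =
      ∑ p ∈ Finset.HasAntidiagonal.antidiagonal d, PowerSeries.coeff p.1 x.1 * PowerSeries.coeff p.2 y.1 :=
  PowerSeries.coeff_mul _ _ _

theorem commute_of_coeff {x y : ChordHat k I}
    (h : ∀ d e, Commute (PowerSeries.coeff d x.1) (PowerSeries.coeff e y.1)) : Commute x y := by
  refine ext_coeff fun d => ?_
  rw [coeff_mul', coeff_mul', ← Finset.Nat.sum_antidiagonal_swap]
  exact Finset.sum_congr rfl fun p _ => (h _ _).eq

/-- Cabling of completed chord diagrams along a family of disjoint finite sets of strands. -/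
noncomputable def cab (F : StrandMap I J) : ChordHat k I →ₐ[k] ChordHat k J :=
  ChordHat.map (ChordAlg.cab F) (fun a b => by
    rw [ChordAlg.cab_chord, StrandMap.chordSum]
    split_ifs
    · exact Submodule.zero_mem _
    · exact Submodule.sum_mem _ fun _ _ => Submodule.sum_mem _ fun _ _ =>
        chord_mem_degree_one _ _)

theorem coeff_cab (F : StrandMap I J) (x : ChordHat k I) (d : ℕ) :
    PowerSeries.coeff d (cab F x).1 = ChordAlg.cab F (PowerSeries.coeff d x.1) :=
  coeff_map _ _ _ _

theorem relabel_eq_cab (g : I ↪ J) (x : ChordHat k I) :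
    relabel g x = cab (StrandMap.ofEmb g) x :=
  ext_coeff fun d => by rw [relabel, coeff_map, coeff_cab, ChordAlg.relabel_eq_cab]

theorem cable_eq_cab [DecidableEq I] [Fintype J] (f : J → I) (x : ChordHat k I) :
    cable f x = cab (StrandMap.ofFun f) x :=
  ext_coeff fun d => by rw [cable, coeff_map, coeff_cab, ChordAlg.cable_eq_cab]

theorem cab_cab (F : StrandMap I J) (G : StrandMap J K) (x : ChordHat k I) :
    cab G (cab F x) = cab (F.trans G) x :=
  ext_coeff fun d => by
    rw [coeff_cab, coeff_cab, coeff_cab, ← ChordAlg.cab_comp_cab, AlgHom.comp_apply]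

theorem cab_refl (F : StrandMap I I) (h : ∀ a x, x ∈ F.fib a ↔ x = a) (x : ChordHat k I) :
    cab F x = x := by
  obtain rfl : F = StrandMap.ofEmb (Equiv.refl I).toEmbedding :=
    StrandMap.ext_mem fun a x => by simp [h]
  rw [← relabel_eq_cab, relabel_refl]

/-- By functoriality, two iterated cablings agree as soon as they replace each strand by the same
finite set. Later cabling identities reduce in this way to membership, which is mostly linear
arithmetic. -/
theorem cab_cab_eq {K' : Type} {F : StrandMap I J} {G : StrandMap J K} {F' : StrandMap I K'}
    {G' : StrandMap K' K}
    (h : ∀ a x, (∃ y ∈ F.fib a, x ∈ G.fib y) ↔ (∃ y ∈ F'.fib a, x ∈ G'.fib y))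
    (x : ChordHat k I) : cab G (cab F x) = cab G' (cab F' x) := by
  rw [cab_cab, cab_cab]
  congr 2
  exact StrandMap.ext_mem fun a x => by simpa using h a x

theorem cab_cab_eq_cab {F : StrandMap I J} {G : StrandMap J K} {H : StrandMap I K}
    (h : ∀ a x, (∃ y ∈ F.fib a, x ∈ G.fib y) ↔ x ∈ H.fib a)
    (x : ChordHat k I) : cab G (cab F x) = cab H x := by
  rw [cab_cab]
  congr 2
  exact StrandMap.ext_mem fun a x => by simpa using h a x

/-- The completed chord diagrams whose chords have both ends on strands in `S`. -/
noncomputable def on (k : Type u) [Field k] (S : Set I) : Subalgebra k (ChordHat k I) where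
  carrier := {x : ChordHat k I | ∀ d, PowerSeries.coeff d x.1 ∈
    Algebra.adjoin k {t : ChordAlg k I | ∃ i ∈ S, ∃ j ∈ S, t = chord k i j}}
  mul_mem' := by
    intro x y hx hy d
    rw [coeff_mul']
    exact Subalgebra.sum_mem _ fun p _ => Subalgebra.mul_mem _ (hx _) (hy _)
  add_mem' := by
    intro x y hx hy d
    change PowerSeries.coeff d (x.1 + y.1) ∈ _
    rw [map_add]
    exact Subalgebra.add_mem _ (hx d) (hy d)
  algebraMap_mem' := by
    intro r d
    change PowerSeries.coeff d (algebraMap k (PowerSeries (ChordAlg k I)) r) ∈ _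
    rw [PowerSeries.algebraMap_apply, PowerSeries.coeff_C]
    split_ifs
    · exact Subalgebra.algebraMap_mem _ r
    · exact Subalgebra.zero_mem _

theorem on_mono {S T : Set I} (h : S ⊆ T) : on k S ≤ on k T := fun _ hx d =>
  Algebra.adjoin_mono (by rintro _ ⟨i, hi, j, hj, e⟩; exact ⟨i, h hi, j, h hj, e⟩) (hx d)

theorem commute_of_mem_on {S : Set I} {x y : ChordHat k I} (hx : x ∈ on k S)
    (h : ∀ i ∈ S, ∀ j ∈ S, ∀ e, Commute (chord k i j) (PowerSeries.coeff e y.1)) :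
    Commute x y := by
  refine commute_of_coeff fun d e => ?_
  refine Algebra.adjoin_induction (p := fun z _ => Commute z (PowerSeries.coeff e y.1)) ?_ ?_ ?_ ?_
    (hx d)
  · rintro _ ⟨i, hi, j, hj, rfl⟩
    exact h i hi j hj e
  · exact fun r => Algebra.commutes r _
  · exact fun _ _ _ _ h h' => h.add_left h'
  · exact fun _ _ _ _ h h' => h.mul_left h'

/-- An element that commutes with the images of all chords commutes with the image of every chord diagram. -/
theorem commute_chordAlg {A : Type*} [Ring A] [Algebra k A] (φ : ChordAlg k I →ₐ[k] A) {y : A}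
    (h : ∀ i j, Commute y (φ (chord k i j))) (x : ChordAlg k I) : Commute y (φ x) := by
  obtain ⟨x, rfl⟩ := RingQuot.mkAlgHom_surjective k (ChordRel k I) x
  induction x using FreeAlgebra.induction with
  | grade0 r => rw [AlgHom.commutes, AlgHom.commutes]; exact (Algebra.commutes r y).symm
  | grade1 p => exact h p.1 p.2
  | mul a b ha hb => simpa only [map_mul] using ha.mul_right hb
  | add a b ha hb => simpa only [map_add] using ha.add_right hb

/-- Locality: a diagram on `S` commutes with a cabled diagram for which each cable contains `S` or
is disjoint from `S`. -/
theorem commute_cab {S : Set J} {x : ChordHat k J} (hx : x ∈ on k S) (F : StrandMap I J)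
    (h : ∀ a, S ⊆ F.fib a ∨ Disjoint S (F.fib a : Set J)) (y : ChordHat k I) :
    Commute x (cab F y) := by
  refine commute_of_mem_on hx fun i hi j hj e => ?_
  rw [coeff_cab]
  refine commute_chordAlg _ (fun a b => ?_) _
  rw [ChordAlg.cab_chord]
  exact F.chord_commute_chordSum hi hj h a b

theorem commute_of_disjoint {S T : Set I} (h : Disjoint S T) {x y : ChordHat k I}
    (hx : x ∈ on k S) (hy : y ∈ on k T) : Commute x y := by
  refine commute_of_mem_on hx fun i hi j hj e => Commute.symm ?_
  refine Algebra.adjoin_induction (p := fun z _ => Commute z (chord k i j)) ?_ ?_ ?_ ?_ (hy e)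
  · rintro _ ⟨l, hl, m, hm, rfl⟩
    rcases eq_or_ne i j with rfl | hij
    · rw [chord_self]; exact Commute.zero_right _
    rcases eq_or_ne l m with rfl | hlm
    · rw [chord_self]; exact Commute.zero_left _
    have hd : ∀ {x y : I}, x ∈ S → y ∈ T → y ≠ x := by
      rintro x y hx hy rfl
      exact Set.disjoint_left.1 h hx hy
    exact chord_comm _ _ _ _ hlm (hd hi hl) (hd hj hl) (hd hi hm) (hd hj hm) hij
  · exact fun r => Algebra.commutes r _
  · exact fun _ _ _ _ h h' => h.add_left h'
  · exact fun _ _ _ _ h h' => h.mul_left h'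

/-- Cablings that agree on the chords in `S` agree on diagrams on `S`. -/
theorem cab_eq_of_mem_on {S : Set I} {x : ChordHat k I} (hx : x ∈ on k S) (F G : StrandMap I J)
    (h : ∀ i ∈ S, F.fib i = G.fib i) : cab F x = cab G x := by
  refine ext_coeff fun d => ?_
  rw [coeff_cab, coeff_cab]
  refine Algebra.adjoin_induction
    (p := fun z _ => ChordAlg.cab F z = ChordAlg.cab G z) ?_ ?_ ?_ ?_ (hx d)
  · rintro _ ⟨i, hi, j, hj, rfl⟩
    simp only [ChordAlg.cab_chord, StrandMap.chordSum, h i hi, h j hj]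
  · intro r
    rw [AlgHom.commutes, AlgHom.commutes]
  · intro a b _ _ ha hb
    rw [map_add, map_add, ha, hb]
  · intro a b _ _ ha hb
    rw [map_mul, map_mul, ha, hb]

theorem cab_mem_on {S : Set I} {T : Set J} {x : ChordHat k I} (hx : x ∈ on k S)
    (F : StrandMap I J) (h : ∀ i ∈ S, ↑(F.fib i) ⊆ T) : cab F x ∈ on k T := by
  intro d
  rw [coeff_cab]
  refine Algebra.adjoin_induction (p := fun z _ => ChordAlg.cab F z ∈ Algebra.adjoin k
    {t : ChordAlg k J | ∃ i ∈ T, ∃ j ∈ T, t = chord k i j}) ?_ ?_ ?_ ?_ (hx d)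
  · rintro _ ⟨i, hi, j, hj, rfl⟩
    rw [ChordAlg.cab_chord, StrandMap.chordSum]
    split_ifs
    · exact Subalgebra.zero_mem _
    · exact Subalgebra.sum_mem _ fun a ha => Subalgebra.sum_mem _ fun b hb =>
        Algebra.subset_adjoin ⟨a, h i hi ha, b, h j hj hb, rfl⟩
  · intro r
    rw [AlgHom.commutes]
    exact Subalgebra.algebraMap_mem _ _
  · intro a b _ _ ha hb
    rw [map_add]; exact Subalgebra.add_mem _ ha hb
  · intro a b _ _ ha hb
    rw [map_mul]; exact Subalgebra.mul_mem _ ha hb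

theorem mem_on_univ (x : ChordHat k I) : x ∈ on k (Set.univ : Set I) := by
  intro d
  generalize PowerSeries.coeff d x.1 = z
  obtain ⟨z, rfl⟩ := RingQuot.mkAlgHom_surjective k (ChordRel k I) z
  induction z using FreeAlgebra.induction with
  | grade0 r => rw [AlgHom.commutes]; exact Subalgebra.algebraMap_mem _ _
  | grade1 p => exact Algebra.subset_adjoin ⟨p.1, trivial, p.2, trivial, rfl⟩
  | mul a b ha hb => rw [map_mul]; exact Subalgebra.mul_mem _ ha hb
  | add a b ha hb => rw [map_add]; exact Subalgebra.add_mem _ ha hb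

theorem cab_mem_on' {T : Set J} (F : StrandMap I J) (h : ∀ i, ↑(F.fib i) ⊆ T)
    (x : ChordHat k I) : cab F x ∈ on k T :=
  cab_mem_on (mem_on_univ x) F fun i _ => h i

end ChordHat

end ChordCabling

/-! ### The crossed product on the strands `ℕ`: supports, shifts and doubling. -/

section StrandGroups

variable {k : Type u} [Field k]

theorem ChordHat.relabel_comp_symm {I : Type} (σ : Equiv.Perm I) (x : ChordHat k I) :
    ChordHat.relabel σ.toEmbedding (ChordHat.relabel σ.symm.toEmbedding x) = x := by
  rw [← ChordHat.relabel_trans]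
  have : σ.symm.toEmbedding.trans σ.toEmbedding = (Equiv.refl I).toEmbedding := by ext; simp
  rw [this, ChordHat.relabel_refl]

variable (k) in
/-- The action of permutations on invertible completed chord diagrams, by relabelling. -/
noncomputable def relabelAut : Equiv.Perm ℕ →* MulAut (ChordHat k ℕ)ˣ where
  toFun σ :=
    { toFun := Units.map ((ChordHat.relabel σ.toEmbedding : ChordHat k ℕ →ₐ[k] ChordHat k ℕ) :
        ChordHat k ℕ →* ChordHat k ℕ)
      invFun := Units.map ((ChordHat.relabel σ.symm.toEmbedding : ChordHat k ℕ →ₐ[k] ChordHat k ℕ) :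
        ChordHat k ℕ →* ChordHat k ℕ)
      left_inv := fun x => Units.ext (ChordHat.relabel_comp_symm σ.symm x.1)
      right_inv := fun x => Units.ext (ChordHat.relabel_comp_symm σ x.1)
      map_mul' := map_mul _ }
  map_one' := by
    ext x : 2
    exact ChordHat.relabel_refl x.1
  map_mul' σ τ := by
    ext x : 2
    exact ChordHat.relabel_trans τ.toEmbedding σ.toEmbedding x.1

theorem relabelAut_val (σ : Equiv.Perm ℕ) (x : (ChordHat k ℕ)ˣ) :
    (relabelAut k σ x : ChordHat k ℕ) = ChordHat.relabel σ.toEmbedding x := rfl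

variable (k) in
/-- The group of invertible elements `D · σ` of the crossed product on the infinite set of
strands `ℕ`. -/
abbrev StrandGroup : Type u := (ChordHat k ℕ)ˣ ⋊[relabelAut k] Equiv.Perm ℕ

/-- Cabling of invertible completed chord diagrams. -/
noncomputable def unitsCab {I J : Type} (F : StrandMap I J) : (ChordHat k I)ˣ →* (ChordHat k J)ˣ :=
  Units.map ((ChordHat.cab F : ChordHat k I →ₐ[k] ChordHat k J) : ChordHat k I →* ChordHat k J)

@[simp] theorem unitsCab_val {I J : Type} (F : StrandMap I J) (x : (ChordHat k I)ˣ) :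
    (unitsCab F x : ChordHat k J) = ChordHat.cab F x := rfl

theorem relabelAut_eq_unitsCab (σ : Equiv.Perm ℕ) (x : (ChordHat k ℕ)ˣ) :
    relabelAut k σ x = unitsCab (StrandMap.ofEmb σ.toEmbedding) x :=
  Units.ext (ChordHat.relabel_eq_cab _ _)

theorem unitsCab_unitsCab_eq {I J J' K : Type} {F : StrandMap I J} {G : StrandMap J K}
    {F' : StrandMap I J'} {G' : StrandMap J' K}
    (h : ∀ a x, (∃ y ∈ F.fib a, x ∈ G.fib y) ↔ (∃ y ∈ F'.fib a, x ∈ G'.fib y))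
    (x : (ChordHat k I)ˣ) : unitsCab G (unitsCab F x) = unitsCab G' (unitsCab F' x) :=
  Units.ext (ChordHat.cab_cab_eq h _)

theorem unitsCab_unitsCab {I J K : Type} {F : StrandMap I J} {G : StrandMap J K}
    {H : StrandMap I K} (h : ∀ a x, (∃ y ∈ F.fib a, x ∈ G.fib y) ↔ x ∈ H.fib a)
    (x : (ChordHat k I)ˣ) : unitsCab G (unitsCab F x) = unitsCab H x :=
  Units.ext (ChordHat.cab_cab_eq_cab h _)

namespace StrandGroup

open SemidirectProduct

/-- The subgroup of the elements that involve only the strands in `S`. -/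
noncomputable def supp (k : Type u) [Field k] (S : Set ℕ) : Subgroup (StrandGroup k) where
  -- The condition on `u.left⁻¹` is imposed as well, so that closure under inversion needs no
  -- analysis of inverse power series inside `ChordHat.on k S`.
  carrier := {u | (u.left : ChordHat k ℕ) ∈ ChordHat.on k S ∧
    ((u.left⁻¹ : (ChordHat k ℕ)ˣ) : ChordHat k ℕ) ∈ ChordHat.on k S ∧ ∀ i ∉ S, u.right i = i}
  one_mem' := ⟨one_mem _, one_mem _, fun _ _ => rfl⟩
  mul_mem' := by
    rintro u v ⟨h1, h2, h3⟩ ⟨h4, h5, h6⟩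
    have hS : ∀ i ∈ S, u.right i ∈ S := fun i hi => by
      by_contra h
      rw [u.right.injective (h3 _ h)] at h
      exact h hi
    have hr : ∀ {x : ChordHat k ℕ}, x ∈ ChordHat.on k S →
        ChordHat.relabel u.right.toEmbedding x ∈ ChordHat.on k S := fun hx => by
      rw [ChordHat.relabel_eq_cab]
      refine ChordHat.cab_mem_on hx _ fun i hi => ?_
      simpa [StrandMap.ofEmb] using hS i hi
    refine ⟨?_, ?_, fun i hi => ?_⟩
    · exact mul_mem h1 (hr h4)
    · rw [mul_left, mul_inv_rev, ← map_inv]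
      exact mul_mem (hr h5) h2
    · rw [mul_right, Equiv.Perm.mul_apply, h6 i hi, h3 i hi]
  inv_mem' := by
    rintro u ⟨h1, h2, h3⟩
    have h3' : ∀ i ∉ S, u.right⁻¹ i = i := fun i hi => by
      rw [Equiv.Perm.inv_eq_iff_eq, h3 i hi]
    have hS : ∀ i ∈ S, u.right⁻¹ i ∈ S := fun i hi => by
      by_contra h
      rw [u.right⁻¹.injective (h3' _ h)] at h
      exact h hi
    have hr : ∀ {x : ChordHat k ℕ}, x ∈ ChordHat.on k S →
        ChordHat.relabel (u.right⁻¹).toEmbedding x ∈ ChordHat.on k S := fun hx => by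
      rw [ChordHat.relabel_eq_cab]
      refine ChordHat.cab_mem_on hx _ fun i hi => ?_
      simpa [StrandMap.ofEmb] using hS i hi
    refine ⟨?_, ?_, h3'⟩
    · exact hr h2
    · rw [inv_left, ← map_inv, inv_inv]
      exact hr h1

theorem supp_mono {S T : Set ℕ} (h : S ⊆ T) : supp k S ≤ supp k T := fun _ hu =>
  ⟨ChordHat.on_mono h hu.1, ChordHat.on_mono h hu.2.1, fun i hi => hu.2.2 i fun hi' => hi (h hi')⟩

theorem right_mem_of_mem_supp {S : Set ℕ} {u : StrandGroup k} (hu : u ∈ supp k S) {i : ℕ} :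
    u.right i ∈ S ↔ i ∈ S := by
  constructor
  · intro h
    by_contra hi
    exact hi (hu.2.2 i hi ▸ h)
  · intro hi
    by_contra h
    rw [u.right.injective (hu.2.2 _ h)] at h
    exact h hi

theorem inl_unitsCab_mem {I : Type} {S : Set ℕ} (F : StrandMap I ℕ) (h : ∀ i, ↑(F.fib i) ⊆ S)
    (x : (ChordHat k I)ˣ) : (inl (unitsCab F x) : StrandGroup k) ∈ supp k S := by
  refine ⟨ChordHat.cab_mem_on' F h _, ?_, fun _ _ => rfl⟩
  rw [left_inl, ← map_inv]
  exact ChordHat.cab_mem_on' F h _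

theorem inr_mem {S : Set ℕ} {σ : Equiv.Perm ℕ} (h : ∀ i ∉ S, σ i = i) :
    (inr σ : StrandGroup k) ∈ supp k S :=
  ⟨one_mem _, by rw [left_inr, inv_one]; exact one_mem _, h⟩

/-- The diagram part of `u` commutes by locality. Its permutation moves only points of `S`, hence
maps each cable to itself and fixes the cabled diagram. -/
theorem commute_inl_unitsCab {I : Type} {S : Set ℕ} {u : StrandGroup k} (hu : u ∈ supp k S)
    (F : StrandMap I ℕ) (h : ∀ a, S ⊆ F.fib a ∨ Disjoint S (F.fib a : Set ℕ))
    (x : (ChordHat k I)ˣ) : Commute u (inl (unitsCab F x)) := by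
  have h1 : Commute u.left (unitsCab F x) :=
    Units.ext (ChordHat.commute_cab hu.1 F h x.1)
  have h2 : relabelAut k u.right (unitsCab F x) = unitsCab F x := by
    rw [relabelAut_eq_unitsCab]
    refine unitsCab_unitsCab (fun a y => ?_) x
    simp only [StrandMap.mem_ofEmb, Equiv.coe_toEmbedding]
    have : (∃ z ∈ F.fib a, y = u.right z) ↔ u.right⁻¹ y ∈ F.fib a := by
      constructor
      · rintro ⟨z, hz, rfl⟩; simpa using hz
      · exact fun h => ⟨_, h, by simp⟩
    rw [this]
    by_cases hy : y ∈ S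
    · have hy' : u.right⁻¹ y ∈ S := right_mem_of_mem_supp (inv_mem hu) |>.2 hy
      rcases h a with ha | ha
      · exact ⟨fun _ => ha hy, fun _ => ha hy'⟩
      · exact ⟨fun h => (Set.disjoint_left.1 ha hy' h).elim,
          fun h => (Set.disjoint_left.1 ha hy h).elim⟩
    · rw [show u.right⁻¹ y = y from (inv_mem hu).2.2 y hy]
  refine SemidirectProduct.ext ?_ (by simp)
  simp only [mul_left, left_inl, right_inl, map_one, MulAut.one_apply, h2]
  exact h1

/-- Each permutation fixes the strands that carry the chords of the other diagram, so both actions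
are trivial and only disjoint chords have to commute. -/
theorem commute_of_disjoint {S T : Set ℕ} (h : Disjoint S T) {u v : StrandGroup k}
    (hu : u ∈ supp k S) (hv : v ∈ supp k T) : Commute u v := by
  have key : ∀ {S T : Set ℕ} (_ : Disjoint S T) {u v : StrandGroup k}
      (_ : u ∈ supp k S) (_ : v ∈ supp k T), relabelAut k u.right v.left = v.left := by
    intro S T h u v hu hv
    refine Units.ext ?_
    rw [relabelAut_val, ChordHat.relabel_eq_cab]
    conv_rhs => rw [← ChordHat.relabel_refl v.left.1, ChordHat.relabel_eq_cab]
    refine ChordHat.cab_eq_of_mem_on hv.1 _ _ fun i hi => ?_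
    have := hu.2.2 i (Set.disjoint_right.1 h hi)
    simp [StrandMap.ofEmb, this]
  refine SemidirectProduct.ext ?_ ?_
  · rw [mul_left, mul_left, key h hu hv, key h.symm hv hu]
    exact Units.ext (ChordHat.commute_of_disjoint h hu.1 hv.1)
  · ext i
    simp only [mul_right, Equiv.Perm.mul_apply]
    by_cases hi : i ∈ S
    · rw [hv.2.2 i (Set.disjoint_left.1 h hi), hv.2.2]
      exact Set.disjoint_left.1 h ((right_mem_of_mem_supp hu).2 hi)
    · rw [hu.2.2 i hi, hu.2.2]
      intro hi'
      by_cases hT : i ∈ T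
      · exact Set.disjoint_left.1 h hi' ((right_mem_of_mem_supp hv).2 hT)
      · exact hi (hv.2.2 i hT ▸ hi')

/-! ### Juxtaposition -/

theorem viaEmbedding_addLeft (n : ℕ) (σ : Equiv.Perm ℕ) (x : ℕ) :
    σ.viaEmbedding (addLeftEmbedding n) x = if x < n then x else n + σ (x - n) := by
  split_ifs with h
  · refine Equiv.Perm.viaEmbedding_apply_of_notMem _ _ _ ?_
    rintro ⟨y, rfl⟩
    simp at h
  · obtain ⟨y, rfl⟩ := Nat.exists_eq_add_of_le (not_lt.1 h)
    rw [Nat.add_sub_cancel_left]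
    exact Equiv.Perm.viaEmbedding_apply σ (addLeftEmbedding n) y

/-- The shift by `n` strands to the right. -/
noncomputable def shift (n : ℕ) : StrandGroup k →* StrandGroup k :=
  SemidirectProduct.map (unitsCab (StrandMap.ofEmb (addLeftEmbedding n)))
    (Equiv.Perm.viaEmbeddingHom (addLeftEmbedding n)) (fun σ => by
      ext x : 1
      simp only [MonoidHom.comp_apply, MulEquiv.coe_toMonoidHom, relabelAut_eq_unitsCab]
      refine unitsCab_unitsCab_eq (fun a y => ?_) x
      simp only [StrandMap.mem_ofEmb, exists_eq_left, Equiv.coe_toEmbedding,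
        Equiv.Perm.viaEmbeddingHom_apply, Equiv.Perm.viaEmbedding_apply])

@[simp] theorem shift_left (n : ℕ) (u : StrandGroup k) :
    (shift n u).left = unitsCab (StrandMap.ofEmb (addLeftEmbedding n)) u.left := rfl

theorem shift_right_apply (n : ℕ) (u : StrandGroup k) (x : ℕ) :
    (shift n u).right x = if x < n then x else n + u.right (x - n) := by
  rw [← viaEmbedding_addLeft]; rfl

theorem shift_zero (u : StrandGroup k) : shift 0 u = u := by
  refine SemidirectProduct.ext (Units.ext ?_) (Equiv.ext fun x => ?_)
  · exact ChordHat.cab_refl _ (fun a x => by simp [addLeftEmbedding]) _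
  · simp [shift_right_apply]

theorem shift_shift (n m : ℕ) (u : StrandGroup k) : shift n (shift m u) = shift (n + m) u := by
  refine SemidirectProduct.ext ?_ (Equiv.ext fun x => ?_)
  · refine unitsCab_unitsCab (fun a x => ?_) _
    simp [Nat.add_assoc]
  · simp only [shift_right_apply]
    split_ifs <;> first | omega | skip
    rw [Nat.sub_sub]; omega

theorem shift_inl (n : ℕ) (x : (ChordHat k ℕ)ˣ) :
    shift n (inl x : StrandGroup k) = inl (unitsCab (StrandMap.ofEmb (addLeftEmbedding n)) x) :=
  SemidirectProduct.map_inl _ _ _ _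

theorem shift_inr (n : ℕ) (σ : Equiv.Perm ℕ) :
    shift n (inr σ : StrandGroup k) = inr (σ.viaEmbedding (addLeftEmbedding n)) :=
  SemidirectProduct.map_inr _ _ _ _

theorem shift_mem {n m : ℕ} {u : StrandGroup k} (hu : u ∈ supp k (Set.Iio m)) :
    shift n u ∈ supp k (Set.Ico n (n + m)) := by
  have h : ∀ i ∈ Set.Iio m, ((StrandMap.ofEmb (addLeftEmbedding n)).fib i : Set ℕ) ⊆
      Set.Ico n (n + m) := by
    intro i hi
    simp only [Set.mem_Iio] at hi
    simp [StrandMap.ofEmb, hi]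
  refine ⟨ChordHat.cab_mem_on hu.1 _ h, ?_, fun i hi => ?_⟩
  · rw [shift_left, ← map_inv]
    exact ChordHat.cab_mem_on hu.2.1 _ h
  · rw [shift_right_apply]
    split_ifs with h
    · rfl
    · simp only [Set.mem_Ico, not_and, not_lt] at hi h
      have := hi h
      rw [hu.2.2 (i - n) (by simp; omega)]
      omega

theorem shift_mem_Iio {n m : ℕ} {u : StrandGroup k} (hu : u ∈ supp k (Set.Iio m)) :
    shift n u ∈ supp k (Set.Iio (n + m)) :=
  supp_mono (fun _ h => h.2) (shift_mem hu)

/-! ### Doubling of a strand -/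

/-- The increasing bijection from `ℕ` to the complement of `i`. -/
def skip (i y : ℕ) : ℕ := if y < i then y else y + 1

/-- The increasing map that takes the value `i` exactly at `i` and `i + 1`. -/
def merge (i x : ℕ) : ℕ := if x ≤ i then x else x - 1

/-- After a doubling, `i` is the left copy, and `skip i` numbers the remaining strands as they were
before. Permutations obtained by doubling are compared on these two kinds of points. -/
theorem eq_or_skip (i x : ℕ) : x = i ∨ ∃ y, x = skip i y := by
  rcases lt_trichotomy x i with h | h | h
  · exact Or.inr ⟨x, by simp [skip, h]⟩
  · exact Or.inl h
  · exact Or.inr ⟨x - 1, by unfold skip; split_ifs <;> omega⟩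

theorem merge_self (i : ℕ) : merge i i = i := by simp [merge]

theorem merge_skip (i y : ℕ) : merge i (skip i y) = y := by
  unfold merge skip; split_ifs <;> omega

theorem skip_ne (i y : ℕ) : skip i y ≠ i := by unfold skip; split_ifs <;> omega

/-- The map that sends `i` to `f i` and extends `f` to the other strands. -/
def doubleFun (i : ℕ) (f : ℕ → ℕ) (x : ℕ) : ℕ :=
  if x = i then f i else skip (f i) (f (if x < i then x else x - 1))

theorem doubleFun_self (i : ℕ) (f : ℕ → ℕ) : doubleFun i f i = f i := by
  simp [doubleFun]

theorem doubleFun_skip (i : ℕ) (f : ℕ → ℕ) (y : ℕ) :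
    doubleFun i f (skip i y) = skip (f i) (f y) := by
  have h2 : (if skip i y < i then skip i y else skip i y - 1) = y := by
    unfold skip; split_ifs <;> omega
  rw [doubleFun, if_neg (skip_ne i y), h2]

/-- The permutation `σ` with the strand `i` doubled. -/
def doublePerm (i : ℕ) (σ : Equiv.Perm ℕ) : Equiv.Perm ℕ where
  toFun := doubleFun i σ
  invFun := doubleFun (σ i) σ.symm
  left_inv x := by
    rcases eq_or_skip i x with rfl | ⟨y, rfl⟩
    · rw [doubleFun_self, doubleFun_self, σ.symm_apply_apply]
    · rw [doubleFun_skip, doubleFun_skip, σ.symm_apply_apply, σ.symm_apply_apply]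
  right_inv x := by
    rcases eq_or_skip (σ i) x with rfl | ⟨y, rfl⟩
    · rw [doubleFun_self, σ.symm_apply_apply, doubleFun_self]
    · rw [doubleFun_skip, σ.symm_apply_apply, doubleFun_skip, σ.apply_symm_apply]

theorem doublePerm_self (i : ℕ) (σ : Equiv.Perm ℕ) : doublePerm i σ i = σ i :=
  doubleFun_self i σ

theorem doublePerm_skip (i : ℕ) (σ : Equiv.Perm ℕ) (y : ℕ) :
    doublePerm i σ (skip i y) = skip (σ i) (σ y) :=
  doubleFun_skip i σ y

/-- The doubled permutation covers the original one. This makes the cabling of diagrams equivariant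
in `double_mul`. -/
theorem merge_doublePerm (i : ℕ) (σ : Equiv.Perm ℕ) (x : ℕ) :
    merge (σ i) (doublePerm i σ x) = σ (merge i x) := by
  rcases eq_or_skip i x with rfl | ⟨y, rfl⟩
  · rw [doublePerm_self, merge_self, merge_self]
  · rw [doublePerm_skip, merge_skip, merge_skip]

theorem doublePerm_mul (i : ℕ) (σ τ : Equiv.Perm ℕ) :
    doublePerm i (σ * τ) = doublePerm (τ i) σ * doublePerm i τ := by
  ext x
  rcases eq_or_skip i x with rfl | ⟨y, rfl⟩
  · simp [doublePerm_self]
  · simp [doublePerm_skip]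

theorem doublePerm_one (i : ℕ) : doublePerm i 1 = 1 := by
  ext x
  rcases eq_or_skip i x with rfl | ⟨y, rfl⟩
  · simp [doublePerm_self]
  · simp [doublePerm_skip]

/-- The family of strands that doubles the strand `i`. -/
def doubleMap (i : ℕ) : StrandMap ℕ ℕ where
  fib a := if a = i then {i, i + 1} else {skip i a}
  disj a b h := by
    rw [Finset.disjoint_left]
    intro x
    unfold skip
    split_ifs <;> simp <;> omega

@[simp] theorem mem_doubleMap (i a x : ℕ) : x ∈ (doubleMap i).fib a ↔ merge i x = a := by
  unfold doubleMap merge skip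
  dsimp only
  split_ifs <;> simp <;> omega

/-- Doubling of the strand `i`, counted at the bottom. -/
noncomputable def double (i : ℕ) (u : StrandGroup k) : StrandGroup k :=
  ⟨unitsCab (doubleMap (u.right i)) u.left, doublePerm i u.right⟩

/-- Strand `i` of the lower factor continues as strand `v.right i` of the upper one, so doubling is
multiplicative only with this change of index. -/
theorem double_mul (i : ℕ) (u v : StrandGroup k) :
    double i (u * v) = double (v.right i) u * double i v := by
  refine SemidirectProduct.ext ?_ (doublePerm_mul i u.right v.right)
  simp only [double, mul_left, mul_right, Equiv.Perm.mul_apply, map_mul]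
  congr 1
  rw [relabelAut_eq_unitsCab, relabelAut_eq_unitsCab]
  refine unitsCab_unitsCab_eq (fun a x => ?_) _
  simp only [StrandMap.mem_ofEmb, Equiv.coe_toEmbedding, mem_doubleMap]
  constructor
  · rintro ⟨y, rfl, h⟩
    refine ⟨(doublePerm (v.right i) u.right).symm x, ?_, by simp⟩
    refine u.right.injective ?_
    rw [← merge_doublePerm, Equiv.apply_symm_apply, h]
  · rintro ⟨y, rfl, rfl⟩
    exact ⟨_, rfl, merge_doublePerm _ _ _⟩

theorem double_one (i : ℕ) : double i (1 : StrandGroup k) = 1 :=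
  SemidirectProduct.ext (map_one _) (doublePerm_one i)

theorem double_inv (i : ℕ) (u : StrandGroup k) :
    double i u⁻¹ = (double (u.right⁻¹ i) u)⁻¹ := by
  rw [eq_inv_iff_mul_eq_one, ← inv_inv u]
  have := double_mul (u.right⁻¹ i) u⁻¹ u
  simpa [double_one] using this.symm

theorem double_inl {I : Type} (i : ℕ) {F G : StrandMap I ℕ} (x : (ChordHat k I)ˣ)
    (h : ∀ a x, merge i x ∈ F.fib a ↔ x ∈ G.fib a) :
    double i (inl (unitsCab F x) : StrandGroup k) = inl (unitsCab G x) := by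
  refine SemidirectProduct.ext ?_ (doublePerm_one i)
  refine unitsCab_unitsCab (fun a x => ?_) x
  simpa using h a x

/-- The doubled strand is to the right of everything that `u` involves. Since the set of strands is
infinite, the additional strand leaves no trace. -/
theorem double_eq_self {i m : ℕ} (h : m ≤ i) {u : StrandGroup k} (hu : u ∈ supp k (Set.Iio m)) :
    double i u = u := by
  have hr : ∀ x, m ≤ x → u.right x = x := fun x hx => hu.2.2 x (by simpa using hx)
  have hr' : ∀ x, x < m → u.right x < m := fun x hx => (right_mem_of_mem_supp hu).2 hx
  refine SemidirectProduct.ext (Units.ext ?_) (Equiv.ext fun x => ?_)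
  · change ChordHat.cab (doubleMap (u.right i)) u.left.1 = u.left.1
    rw [hr i h]
    conv_rhs => rw [← ChordHat.relabel_refl u.left.1, ChordHat.relabel_eq_cab]
    refine ChordHat.cab_eq_of_mem_on hu.1 _ _ fun j hj => Finset.ext fun x => ?_
    simp only [Set.mem_Iio] at hj
    simp only [mem_doubleMap, merge, StrandMap.mem_ofEmb, Equiv.coe_toEmbedding, Equiv.refl_apply]
    split_ifs <;> omega
  · change doublePerm i u.right x = u.right x
    rcases eq_or_skip i x with rfl | ⟨y, rfl⟩
    · rw [doublePerm_self]
    · rw [doublePerm_skip, hr i h]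
      by_cases hy : y < m
      · have e : ∀ z, z < m → skip i z = z := fun z hz => if_pos (by omega)
        rw [e y hy, e _ (hr' y hy)]
      · rw [hr y (by omega), hr]
        unfold skip
        split_ifs <;> omega

theorem double_shift (n i : ℕ) (u : StrandGroup k) :
    double (n + i) (shift n u) = shift n (double i u) := by
  have hr : (shift n u).right (n + i) = n + u.right i := by simp [shift_right_apply]
  refine SemidirectProduct.ext ?_ (Equiv.ext fun x => ?_)
  · change unitsCab (doubleMap ((shift n u).right (n + i))) (unitsCab _ u.left) =
      unitsCab _ (unitsCab _ u.left)
    rw [hr]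
    refine unitsCab_unitsCab_eq (fun a x => ?_) _
    simp only [StrandMap.mem_ofEmb, addLeftEmbedding_apply, mem_doubleMap, exists_eq_left, merge]
    constructor
    · intro h
      refine ⟨x - n, ?_, ?_⟩ <;> split_ifs at * <;> omega
    · rintro ⟨y, hy, rfl⟩
      split_ifs at * <;> omega
  · change doublePerm (n + i) (shift n u).right x = (shift n (double i u)).right x
    rw [shift_right_apply]
    change _ = if x < n then x else n + doublePerm i u.right (x - n)
    rcases eq_or_skip (n + i) x with rfl | ⟨y, rfl⟩
    · rw [doublePerm_self, hr, if_neg (by omega), Nat.add_sub_cancel_left, doublePerm_self]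
    · rw [doublePerm_skip, hr, shift_right_apply]
      by_cases hy : y < n
      · have e : skip (n + i) y = y := by unfold skip; split_ifs <;> omega
        have e' : skip (n + u.right i) y = y := by unfold skip; split_ifs <;> omega
        rw [e, if_pos hy, if_pos hy, e']
      · obtain ⟨z, rfl⟩ := Nat.exists_eq_add_of_le (not_lt.1 hy)
        have e : ∀ i z, skip (n + i) (n + z) = n + skip i z := by
          intro i z; unfold skip; split_ifs <;> omega
        rw [e, if_neg hy, if_neg (by omega), Nat.add_sub_cancel_left, Nat.add_sub_cancel_left, e,
          doublePerm_skip]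

end StrandGroup

end StrandGroups

/-! ### Invertibility of associators and exponentials; their cablings along consecutive blocks. -/

section AssociatorCabling

variable {k : Type u} [Field k]

/-! ### Invertibility -/

/-- The coefficients of the inverse series are determined recursively from those of `x`, and the
recursion respects the number of chords, so the inverse stays in the graded completion. -/
theorem ChordHat.isUnit_of_coeff_zero {I : Type} (x : ChordHat k I)
    (hx : PowerSeries.coeff 0 x.1 = 1) : IsUnit x := by
  have hc : PowerSeries.constantCoeff x.1 = ((1 : (ChordAlg k I)ˣ) : ChordAlg k I) := by
    rw [← PowerSeries.coeff_zero_eq_constantCoeff_apply, hx]; rfl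
  have hmem : PowerSeries.invOfUnit x.1 1 ∈ ChordHat k I := by
    intro d
    induction d using Nat.strong_induction_on with
    | _ d ih =>
      rw [PowerSeries.coeff_invOfUnit]
      split_ifs with h
      · subst h
        rw [ChordAlg.degree, pow_zero, inv_one]
        exact Submodule.mem_one.2 ⟨1, map_one _⟩
      · rw [inv_one, Units.val_one]
        refine (congrArg (· ∈ ChordAlg.degree k I d) (neg_one_mul _)).mpr
          (Submodule.neg_mem _ (Submodule.sum_mem _ fun p hp => ?_))
        split_ifs with hlt
        · rw [Finset.HasAntidiagonal.mem_antidiagonal] at hp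
          rw [← hp, ChordAlg.degree, pow_add]
          exact Submodule.mul_mem_mul (x.2 _) (ih _ hlt)
        · exact Submodule.zero_mem _
  exact ⟨⟨x, ⟨_, hmem⟩, Subtype.ext (PowerSeries.mul_invOfUnit _ _ hc),
    Subtype.ext (PowerSeries.invOfUnit_mul _ _ hc)⟩, rfl⟩

/-- The morphism that sends all chords to zero. -/
noncomputable def ChordAlg.augmentation (k : Type u) [Field k] (I : Type) : ChordAlg k I →ₐ[k] k :=
  ChordAlg.lift (fun _ _ => 0) (fun _ => rfl) (fun _ _ => rfl)
    (fun _ _ _ _ _ _ _ _ _ _ => Commute.zero_left _) (fun _ _ _ _ _ _ => Commute.zero_left _)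

theorem ChordHat.exists_coeff_zero {I : Type} (x : ChordHat k I) :
    ∃ r : k, PowerSeries.coeff 0 x.1 = algebraMap k (ChordAlg k I) r := by
  have h := x.2 0
  rw [ChordAlg.degree, pow_zero, Submodule.mem_one] at h
  exact h.imp fun _ h => h.symm

/-- The degree zero part is a scalar. Removing a strand does not change it and turns `Φ` into `1`,
so the scalar is `1`. -/
theorem IsAssociator.isUnit {Φ : ChordHat k (Fin 3)} (hΦ : IsAssociator Φ) : IsUnit Φ := by
  refine ChordHat.isUnit_of_coeff_zero Φ ?_
  obtain ⟨r, hr⟩ := ChordHat.exists_coeff_zero Φ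
  have h1 : PowerSeries.coeff 0 (ChordHat.remove 0 Φ).1 = 1 := by
    rw [hΦ.nondegenerate 0]
    exact PowerSeries.coeff_zero_one
  rw [ChordHat.remove, ChordHat.cable_eq_cab, ChordHat.coeff_cab, hr, AlgHom.commutes] at h1
  -- The augmentation recovers a scalar from its image in the algebra.
  have h2 := congrArg (ChordAlg.augmentation k (Fin 2)) h1
  rw [AlgHom.commutes, map_one] at h2
  rw [hr, show r = 1 from h2, map_one]

/-- An associator, as an invertible element. -/
noncomputable def IsAssociator.unit {Φ : ChordHat k (Fin 3)} (hΦ : IsAssociator Φ) :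
    (ChordHat k (Fin 3))ˣ := hΦ.isUnit.unit

@[simp] theorem IsAssociator.unit_val {Φ : ChordHat k (Fin 3)} (hΦ : IsAssociator Φ) :
    (hΦ.unit : ChordHat k (Fin 3)) = Φ := hΦ.isUnit.unit_spec

theorem ChordHat.coeff_expChord {I : Type} (c : k) (i j : I) (d : ℕ) :
    PowerSeries.coeff d (ChordHat.expChord c i j).1 =
      ((d.factorial : k)⁻¹) • (c • chord k i j) ^ d := by
  rw [ChordHat.expChord, PowerSeries.coeff_mk]

theorem ChordHat.expChord_zero {I : Type} (i j : I) :
    ChordHat.expChord (0 : k) i j = 1 := by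
  refine ChordHat.ext_coeff fun d => ?_
  change _ = PowerSeries.coeff d (1 : PowerSeries (ChordAlg k I))
  rw [ChordHat.coeff_expChord, zero_smul, PowerSeries.coeff_one]
  rcases Nat.eq_zero_or_pos d with rfl | h
  · simp
  · rw [zero_pow h.ne', smul_zero, if_neg h.ne']

theorem ChordHat.expChord_mul [CharZero k] {I : Type} (a b : k) (i j : I) :
    ChordHat.expChord a i j * ChordHat.expChord b i j = ChordHat.expChord (a + b) i j := by
  refine ChordHat.ext_coeff fun d => ?_
  rw [ChordHat.coeff_mul', ChordHat.coeff_expChord, add_smul,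
    Commute.add_pow' (((Commute.refl (chord k i j)).smul_left a).smul_right b), Finset.smul_sum]
  refine Finset.sum_congr rfl fun p hp => ?_
  rw [Finset.HasAntidiagonal.mem_antidiagonal] at hp
  rw [ChordHat.coeff_expChord, ChordHat.coeff_expChord, smul_mul_smul_comm, ← Nat.cast_smul_eq_nsmul k,
    smul_smul]
  congr 1
  subst hp
  have h := Nat.add_choose_mul_factorial_mul_factorial p.1 p.2
  rw [← Nat.choose_symm_add] at h
  have h' : (((p.1 + p.2).choose p.1 : ℕ) : k) * (p.1.factorial : k) * (p.2.factorial : k) =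
      ((p.1 + p.2).factorial : k) := by exact_mod_cast h
  have h1 : (p.1.factorial : k) ≠ 0 := by exact_mod_cast Nat.factorial_ne_zero _
  have h2 : (p.2.factorial : k) ≠ 0 := by exact_mod_cast Nat.factorial_ne_zero _
  have h3 : ((p.1 + p.2).factorial : k) ≠ 0 := by exact_mod_cast Nat.factorial_ne_zero _
  field_simp
  rw [← h']
  ring

theorem ChordHat.expChord_symm {I : Type} (c : k) (i j : I) :
    ChordHat.expChord c i j = ChordHat.expChord c j i :=
  ChordHat.ext_coeff fun d => by rw [coeff_expChord, coeff_expChord, chord_symm]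

theorem ChordHat.cab_ofEmb_expChord {I J : Type} (g : I ↪ J) (c : k) (i j : I) :
    ChordHat.cab (StrandMap.ofEmb g) (ChordHat.expChord c i j) =
      ChordHat.expChord c (g i) (g j) :=
  ChordHat.ext_coeff fun d => by
    rw [coeff_cab, coeff_expChord, coeff_expChord, ← ChordAlg.relabel_eq_cab, map_smul, map_pow,
      map_smul, ChordAlg.relabel, ChordAlg.lift_chord]

theorem ChordHat.cab_expChord_eq_one {I J : Type} (F : StrandMap I J) (c : k) (i j : I)
    (h : F.fib i = ∅ ∨ F.fib j = ∅) : ChordHat.cab F (ChordHat.expChord c i j) = 1 := by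
  have h0 : F.chordSum (k := k) i j = 0 := by
    unfold StrandMap.chordSum
    split_ifs
    · rfl
    · rcases h with h | h <;> simp [h]
  rw [← map_one (ChordHat.cab F), ← ChordHat.expChord_zero (k := k) i j]
  refine ChordHat.ext_coeff fun d => ?_
  simp only [coeff_cab, coeff_expChord, map_smul, map_pow, ChordAlg.cab_chord, h0, smul_zero,
    zero_smul, map_zero]

/-- The exponential of a multiple of `t₁₂`, as an invertible element. -/
noncomputable def expUnit [CharZero k] (c : k) : (ChordHat k (Fin 2))ˣ where
  val := ChordHat.expChord c 0 1
  inv := ChordHat.expChord (-c) 0 1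
  val_inv := by rw [ChordHat.expChord_mul, add_neg_cancel, ChordHat.expChord_zero]
  inv_val := by rw [ChordHat.expChord_mul, neg_add_cancel, ChordHat.expChord_zero]

theorem expUnit_inv [CharZero k] (c : k) : (expUnit c)⁻¹ = expUnit (-c) := Units.ext rfl

/-! ### Consecutive blocks of strands -/

namespace StrandMap

/-- Two consecutive blocks of strands. -/
def block₂ (a b : ℕ) : StrandMap (Fin 2) ℕ where
  fib := ![Finset.Ico 0 a, Finset.Ico a (a + b)]
  disj i j h := by
    rw [Finset.disjoint_left]
    fin_cases i <;> fin_cases j <;> simp at h ⊢ <;> omega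

/-- Three consecutive blocks of strands. -/
def block₃ (a b c : ℕ) : StrandMap (Fin 3) ℕ where
  fib := ![Finset.Ico 0 a, Finset.Ico a (a + b), Finset.Ico (a + b) (a + b + c)]
  disj i j h := by
    rw [Finset.disjoint_left]
    fin_cases i <;> fin_cases j <;> simp at h ⊢ <;> omega

/-- Four consecutive blocks of strands. -/
def block₄ (a b c d : ℕ) : StrandMap (Fin 4) ℕ where
  fib := ![Finset.Ico 0 a, Finset.Ico a (a + b), Finset.Ico (a + b) (a + b + c),
    Finset.Ico (a + b + c) (a + b + c + d)]
  disj i j h := by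
    rw [Finset.disjoint_left]
    fin_cases i <;> fin_cases j <;> simp at h ⊢ <;> omega

@[simp] theorem mem_block₂_zero (a b x : ℕ) : x ∈ (block₂ a b).fib 0 ↔ x < a := by
  simp [block₂]
@[simp] theorem mem_block₂_one (a b x : ℕ) :
    x ∈ (block₂ a b).fib 1 ↔ a ≤ x ∧ x < a + b := by simp [block₂]
@[simp] theorem mem_block₃_zero (a b c x : ℕ) : x ∈ (block₃ a b c).fib 0 ↔ x < a := by
  simp [block₃]
@[simp] theorem mem_block₃_one (a b c x : ℕ) :
    x ∈ (block₃ a b c).fib 1 ↔ a ≤ x ∧ x < a + b := by simp [block₃]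
@[simp] theorem mem_block₃_two (a b c x : ℕ) :
    x ∈ (block₃ a b c).fib 2 ↔ a + b ≤ x ∧ x < a + b + c := by simp [block₃]
@[simp] theorem mem_block₄_zero (a b c d x : ℕ) : x ∈ (block₄ a b c d).fib 0 ↔ x < a := by
  simp [block₄]
@[simp] theorem mem_block₄_one (a b c d x : ℕ) :
    x ∈ (block₄ a b c d).fib 1 ↔ a ≤ x ∧ x < a + b := by simp [block₄]
@[simp] theorem mem_block₄_two (a b c d x : ℕ) :
    x ∈ (block₄ a b c d).fib 2 ↔ a + b ≤ x ∧ x < a + b + c := by simp [block₄]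
@[simp] theorem mem_block₄_three (a b c d x : ℕ) :
    x ∈ (block₄ a b c d).fib 3 ↔ a + b + c ≤ x ∧ x < a + b + c + d := by simp [block₄]

end StrandMap

namespace StrandGroup

open SemidirectProduct StrandMap

/-- The cabled associator `Φ_{a,b,c}`. -/
noncomputable def assoc (φ : (ChordHat k (Fin 3))ˣ) (a b c : ℕ) : StrandGroup k :=
  inl (unitsCab (block₃ a b c) φ)

theorem assoc_mem (φ : (ChordHat k (Fin 3))ˣ) (a b c : ℕ) :
    assoc φ a b c ∈ supp k (Set.Iio (a + b + c)) := by
  refine inl_unitsCab_mem _ (fun i x hx => ?_) _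
  revert i
  simp [Fin.forall_fin_succ]
  omega

/-- In each of the four alternatives, every block contains `S` or misses it, as locality requires.
This is the naturality of the associator. -/
theorem commute_assoc {S : Set ℕ} {u : StrandGroup k} (hu : u ∈ supp k S)
    (φ : (ChordHat k (Fin 3))ˣ) (a b c : ℕ)
    (h : S ⊆ Set.Iio a ∨ S ⊆ Set.Ico a (a + b) ∨ S ⊆ Set.Ico (a + b) (a + b + c) ∨
      S ⊆ Set.Ici (a + b + c)) : Commute u (assoc φ a b c) := by
  refine commute_inl_unitsCab hu _ (fun i => ?_) φ
  simp only [Set.subset_def, Set.disjoint_left, Finset.mem_coe, Set.mem_Iio, Set.mem_Ico,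
    Set.mem_Ici] at h ⊢
  fin_cases i
  · simp only [Fin.zero_eta, mem_block₃_zero]
    rcases h with h | h | h | h
    · exact Or.inl h
    all_goals exact Or.inr fun x hx => by have := h x hx; omega
  · simp only [Fin.mk_one, mem_block₃_one]
    rcases h with h | h | h | h
    · exact Or.inr fun x hx => by have := h x hx; omega
    · exact Or.inl h
    all_goals exact Or.inr fun x hx => by have := h x hx; omega
  · simp only [Fin.reduceFinMk, mem_block₃_two]
    rcases h with h | h | h | h
    · exact Or.inr fun x hx => by have := h x hx; omega
    · exact Or.inr fun x hx => by have := h x hx; omega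
    · exact Or.inl h
    · exact Or.inr fun x hx => by have := h x hx; omega

theorem double_assoc_left (φ : (ChordHat k (Fin 3))ˣ) (a b c : ℕ) {i : ℕ} (h : i < a) :
    double i (assoc φ a b c) = assoc φ (a + 1) b c := by
  refine double_inl i φ fun j x => ?_
  unfold merge
  revert j
  simp only [Fin.forall_fin_succ, mem_block₃_zero]
  split_ifs <;> simp <;> omega

theorem double_assoc_middle (φ : (ChordHat k (Fin 3))ˣ) (a b c : ℕ) {i : ℕ} (h : a ≤ i)
    (h' : i < a + b) : double i (assoc φ a b c) = assoc φ a (b + 1) c := by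
  refine double_inl i φ fun j x => ?_
  unfold merge
  revert j
  simp only [Fin.forall_fin_succ, mem_block₃_zero]
  split_ifs <;> simp <;> omega

theorem double_assoc_right (φ : (ChordHat k (Fin 3))ˣ) (a b c : ℕ) {i : ℕ} (h : a + b ≤ i)
    (h' : i < a + b + c) : double i (assoc φ a b c) = assoc φ a b (c + 1) := by
  refine double_inl i φ fun j x => ?_
  unfold merge
  revert j
  simp only [Fin.forall_fin_succ, mem_block₃_zero]
  split_ifs <;> simp <;> omega

end StrandGroup

end AssociatorCabling

/-! ### The axioms of an associator in cabled form. -/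

section AssociatorRelations

variable {k : Type u} [Field k]

theorem exists_eq_add_iff (n x : ℕ) (P : ℕ → Prop) :
    (∃ y, P y ∧ x = n + y) ↔ n ≤ x ∧ P (x - n) := by
  constructor
  · rintro ⟨y, hy, rfl⟩
    simpa using hy
  · rintro ⟨h, hP⟩
    exact ⟨_, hP, by omega⟩

namespace StrandGroup

open SemidirectProduct StrandMap

variable {Φ : ChordHat k (Fin 3)}

/-- The pentagon on four strands is cabled along blocks of lengths `n`, `m`, `q`, `r`. Each of its
five factors becomes an iterated cabling of `Φ`, identified by its blocks. -/
theorem assoc_pentagon (hΦ : IsAssociator Φ) (n m q r : ℕ) :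
    shift n (assoc hΦ.unit m q r) * assoc hΦ.unit n (m + q) r * assoc hΦ.unit n m q =
      assoc hΦ.unit n m (q + r) * assoc hΦ.unit (n + m) q r := by
  have h := congrArg (ChordHat.cab (block₄ n m q r)) hΦ.pentagon
  simp only [map_mul, ChordHat.relabel_eq_cab, ChordHat.double, ChordHat.cable_eq_cab] at h
  unfold assoc
  rw [shift_inl, ← map_mul, ← map_mul, ← map_mul]
  congr 1
  refine Units.ext ?_
  simp only [Units.val_mul, unitsCab_val, IsAssociator.unit_val]
  have e1 : ChordHat.cab (block₄ n m q r) (ChordHat.cab (ofEmb (Fin.succEmb 3)) Φ) =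
      ChordHat.cab (ofEmb (addLeftEmbedding n)) (ChordHat.cab (block₃ m q r) Φ) := by
    refine ChordHat.cab_cab_eq (fun i x => ?_) Φ
    revert i
    simp [Fin.forall_fin_succ, exists_eq_add_iff]
    omega
  have e2 : ChordHat.cab (block₄ n m q r) (ChordHat.cab (ofFun (Fin.predAbove 1)) Φ) =
      ChordHat.cab (block₃ n (m + q) r) Φ := by
    refine ChordHat.cab_cab_eq_cab (fun i x => ?_) Φ
    revert i
    simp [Fin.forall_fin_succ, Fin.exists_fin_succ, Fin.predAbove]
    omega
  have e3 : ChordHat.cab (block₄ n m q r) (ChordHat.cab (ofEmb (Fin.castSuccEmb (n := 3))) Φ) =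
      ChordHat.cab (block₃ n m q) Φ := by
    refine ChordHat.cab_cab_eq_cab (fun i x => ?_) Φ
    revert i
    simp [Fin.forall_fin_succ]
  have e4 : ChordHat.cab (block₄ n m q r) (ChordHat.cab (ofFun (Fin.predAbove 2)) Φ) =
      ChordHat.cab (block₃ n m (q + r)) Φ := by
    refine ChordHat.cab_cab_eq_cab (fun i x => ?_) Φ
    revert i
    have e : Fin.castPred (2 : Fin 4) (by decide) = 2 := rfl
    simp [Fin.forall_fin_succ, Fin.exists_fin_succ, Fin.predAbove, e]
    omega
  have e5 : ChordHat.cab (block₄ n m q r) (ChordHat.cab (ofFun (Fin.predAbove 0)) Φ) =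
      ChordHat.cab (block₃ (n + m) q r) Φ := by
    refine ChordHat.cab_cab_eq_cab (fun i x => ?_) Φ
    revert i
    simp [Fin.forall_fin_succ, Fin.exists_fin_succ, Fin.predAbove]
    omega
  rw [e1, e2, e3, e4, e5] at h
  exact h

/-- A cabling with an empty block factors through the removal of the corresponding strand, which
sends `Φ` to `1`. -/
theorem assoc_eq_one_of_remove (hΦ : IsAssociator Φ) {a b c : ℕ} (G : StrandMap (Fin 2) ℕ)
    (i : Fin 3) (h : ∀ j x, (∃ y, i.succAbove y = j ∧ x ∈ G.fib y) ↔ x ∈ (block₃ a b c).fib j) :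
    assoc hΦ.unit a b c = 1 := by
  have e := congrArg (ChordHat.cab G) (hΦ.nondegenerate i)
  rw [map_one, ChordHat.remove, ChordHat.cable_eq_cab,
    ChordHat.cab_cab_eq_cab (H := block₃ a b c) (fun j x => by simpa using h j x)] at e
  unfold assoc
  rw [← map_one inl]
  congr 1
  exact Units.ext (by simpa using e)

theorem assoc_zero_left (hΦ : IsAssociator Φ) (b c : ℕ) : assoc hΦ.unit 0 b c = 1 := by
  refine assoc_eq_one_of_remove hΦ (block₂ b c) 0 fun j x => ?_
  revert j
  simp [Fin.forall_fin_succ, Fin.exists_fin_succ]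

theorem assoc_zero_middle (hΦ : IsAssociator Φ) (a c : ℕ) : assoc hΦ.unit a 0 c = 1 := by
  refine assoc_eq_one_of_remove hΦ (block₂ a c) 1 fun j x => ?_
  revert j
  simp [Fin.forall_fin_succ, Fin.exists_fin_succ, Fin.succAbove]

theorem assoc_zero_right (hΦ : IsAssociator Φ) (a b : ℕ) : assoc hΦ.unit a b 0 = 1 := by
  refine assoc_eq_one_of_remove hΦ (block₂ a b) 2 fun j x => ?_
  revert j
  simp [Fin.forall_fin_succ, Fin.exists_fin_succ, Fin.succAbove]

/-- The permutation that exchanges two consecutive blocks of lengths `a` and `b`. -/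
def blockPerm (a b : ℕ) : Equiv.Perm ℕ where
  toFun x := if x < a then x + b else if x < a + b then x - a else x
  invFun x := if x < b then x + a else if x < b + a then x - b else x
  left_inv x := by dsimp only; split_ifs <;> omega
  right_inv x := by dsimp only; split_ifs <;> omega

theorem blockPerm_apply (a b x : ℕ) :
    blockPerm a b x = if x < a then x + b else if x < a + b then x - a else x := rfl

theorem blockPerm_inv (a b : ℕ) : (blockPerm a b)⁻¹ = blockPerm b a := rfl

/-- The block next to `b` is exchanged with it first, then the other one: the hexagon on the level
of permutations. -/
theorem blockPerm_add (a a' b : ℕ) : blockPerm (a + a') b =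
    blockPerm a b * (blockPerm a' b).viaEmbedding (addLeftEmbedding a) := by
  ext x
  simp only [Equiv.Perm.mul_apply, viaEmbedding_addLeft, blockPerm_apply]
  split_ifs <;> omega

theorem inl_relabelAut_mul_inr (σ : Equiv.Perm ℕ) (x : (ChordHat k ℕ)ˣ) :
    (inl (relabelAut k σ x) * inr σ : StrandGroup k) = inr σ * inl x := by
  rw [inl_aut, map_inv, inv_mul_cancel_right]

variable [CharZero k]

/-- The cabling of `s · exp (c t₁₂)`, where `s` is the transposition. -/
noncomputable def crossing (c : k) (a b : ℕ) : StrandGroup k :=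
  inr (blockPerm a b) * inl (unitsCab (block₂ a b) (expUnit c))

theorem crossing_mem (c : k) (a b : ℕ) : crossing c a b ∈ supp k (Set.Iio (a + b)) := by
  refine mul_mem (inr_mem fun i hi => ?_) (inl_unitsCab_mem _ (fun i x hx => ?_) _)
  · simp only [Set.mem_Iio] at hi
    rw [blockPerm_apply, if_neg (by omega), if_neg (by omega)]
  · revert i
    simp [Fin.forall_fin_succ]
    omega

theorem crossing_right (c : k) (a b : ℕ) : (crossing c a b).right = blockPerm a b := by
  simp [crossing]

theorem crossing_zero_left (c : k) (b : ℕ) : crossing c 0 b = 1 := by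
  have h1 : blockPerm 0 b = 1 := by
    ext x
    simp [blockPerm_apply]
  have h2 : unitsCab (block₂ 0 b) (expUnit c) = 1 :=
    Units.ext (ChordHat.cab_expChord_eq_one _ _ _ _ (Or.inl rfl))
  rw [crossing, h1, h2, map_one, map_one, mul_one]

/-- The chord is symmetric in its two strands, so the exponential passes through the exchange of the
blocks. Thus the hexagon with the negative sign becomes a relation between inverses of positive
crossings. -/
theorem crossing_neg (c : k) (a b : ℕ) : crossing (-c) b a = (crossing c a b)⁻¹ := by
  have e : relabelAut k (blockPerm b a) (unitsCab (block₂ b a) (expUnit c)) =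
      unitsCab (block₂ a b) (expUnit c) := by
    rw [relabelAut_eq_unitsCab]
    refine Units.ext ?_
    simp only [unitsCab_val, expUnit]
    conv_lhs => rw [ChordHat.expChord_symm]
    -- The symmetry of the chord is expressed as a relabelling, so that the claim becomes an
    -- equality of strand maps.
    have hs : ChordHat.expChord c (1 : Fin 2) 0 =
        ChordHat.cab (ofEmb (Equiv.swap (0 : Fin 2) 1).toEmbedding)
          (ChordHat.expChord c 0 1) := by
      rw [ChordHat.cab_ofEmb_expChord]; simp
    rw [hs, ChordHat.cab_cab, ChordHat.cab_cab]
    congr 2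
    refine ext_mem fun i x => ?_
    have hx : ∀ P : ℕ → Prop, (∃ y, P y ∧ x = blockPerm b a y) ↔ P (blockPerm a b x) := by
      intro P
      constructor
      · rintro ⟨y, hy, rfl⟩
        simpa [← blockPerm_inv b a] using hy
      · intro h
        exact ⟨_, h, by simp [← blockPerm_inv b a]⟩
    revert i
    simp [Fin.forall_fin_succ, hx]
    simp only [blockPerm_apply]
    split_ifs <;> omega
  rw [crossing, crossing, ← expUnit_inv, mul_inv_rev, ← map_inv inr, blockPerm_inv, map_inv,
    map_inv, ← map_inv inl, ← inl_relabelAut_mul_inr, map_inv, e, map_inv]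

/-- The braiding is natural with respect to the morphisms of the left block. -/
theorem shift_mul_crossing {a : ℕ} {u : StrandGroup k} (hu : u ∈ supp k (Set.Iio a)) (c : k)
    (b : ℕ) : shift b u * crossing c a b = crossing c a b * u := by
  have h1 : shift b u * inr (blockPerm a b) = inr (blockPerm a b) * u := by
    refine SemidirectProduct.ext ?_ ?_
    · simp only [mul_left, left_inr, map_one, mul_one, one_mul, right_inr, shift_left,
        relabelAut_eq_unitsCab]
      refine Units.ext (ChordHat.cab_eq_of_mem_on hu.1 _ _ fun i hi => ?_)
      simp only [Set.mem_Iio] at hi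
      ext x
      simp [blockPerm_apply, hi, Nat.add_comm]
    · ext x
      simp only [mul_right, right_inr, Equiv.Perm.mul_apply, shift_right_apply, blockPerm_apply]
      by_cases hx : x < a
      · have := (right_mem_of_mem_supp hu (i := x)).2 hx
        simp only [Set.mem_Iio] at this
        rw [if_pos hx, if_pos this, if_neg (by omega), Nat.add_sub_cancel, Nat.add_comm]
      · rw [hu.2.2 x hx, if_neg hx]
        split_ifs
        · rfl
        · omega
        · omega
        · rw [hu.2.2 _ (by simp; omega)]
          omega
  have h2 : Commute u (inl (unitsCab (block₂ a b) (expUnit c))) := by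
    refine commute_inl_unitsCab hu _ (fun i => ?_) _
    simp only [Set.subset_def, Set.disjoint_left, Finset.mem_coe, Set.mem_Iio]
    revert i
    simp only [Fin.forall_fin_two, mem_block₂_zero, mem_block₂_one]
    exact ⟨Or.inl fun _ h => h, Or.inr fun _ h => by omega⟩
  rw [crossing, ← mul_assoc, h1, mul_assoc, h2.eq, mul_assoc]

theorem double_crossing_left (c : k) : double 0 (crossing c 1 1) = crossing c 2 1 := by
  rw [crossing, double_mul, right_inl, Equiv.Perm.one_apply, crossing]
  congr 1
  · refine SemidirectProduct.ext (map_one _) ?_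
    ext x
    change doublePerm 0 (blockPerm 1 1) x = blockPerm 2 1 x
    rcases eq_or_skip 0 x with rfl | ⟨y, rfl⟩
    · rw [doublePerm_self]; simp [blockPerm_apply]
    · rw [doublePerm_skip]
      simp only [blockPerm_apply, skip]
      split_ifs <;> omega
  · refine double_inl _ _ fun i x => ?_
    unfold merge
    revert i
    simp only [Fin.forall_fin_succ, mem_block₂_zero]
    split_ifs <;> simp <;> omega

theorem double_crossing_right (c : k) : double 1 (crossing c 1 1) = crossing c 1 2 := by
  rw [crossing, double_mul, right_inl, Equiv.Perm.one_apply, crossing]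
  congr 1
  · refine SemidirectProduct.ext (map_one _) ?_
    ext x
    change doublePerm 1 (blockPerm 1 1) x = blockPerm 1 2 x
    rcases eq_or_skip 1 x with rfl | ⟨y, rfl⟩
    · rw [doublePerm_self]; simp [blockPerm_apply]
    · rw [doublePerm_skip]
      simp only [blockPerm_apply, skip]
      split_ifs <;> omega
  · refine double_inl _ _ fun i x => ?_
    unfold merge
    revert i
    simp only [Fin.forall_fin_succ, mem_block₂_zero]
    split_ifs <;> simp <;> omega

/-- The hexagon axiom is cabled along three blocks and multiplied on the left by the permutation `σ
* τ`, where `τ` exchanges `a'` with `b` and then `σ` exchanges `a` with `b`. Moving the permutations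
to their places inside the product absorbs the relabellings. -/
theorem crossing_hexagon (hΦ : IsAssociator Φ) {c : k} (hc : c = 1 / 2 ∨ c = -(1 / 2))
    (a a' b : ℕ) : crossing c (a + a') b =
      assoc hΦ.unit b a a' * crossing c a b * (assoc hΦ.unit a b a')⁻¹ *
        shift a (crossing c a' b) * assoc hΦ.unit a a' b := by
  set F := block₃ a a' b
  set τ := (blockPerm a' b).viaEmbedding (addLeftEmbedding a) with hτ
  set σ := blockPerm a b with hσ
  let g02 : Fin 2 ↪ Fin 3 := ⟨![0, 2], by decide⟩
  let g12 : Fin 2 ↪ Fin 3 := ⟨![1, 2], by decide⟩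
  let g201 : Fin 3 ↪ Fin 3 := ⟨![2, 0, 1], by decide⟩
  let g021 : Fin 3 ↪ Fin 3 := ⟨![0, 2, 1], by decide⟩
  -- the hexagon relation for invertible elements
  have h : unitsCab (ofFun (Fin.predAbove (0 : Fin 2))) (expUnit c) =
      unitsCab (ofEmb g201) hΦ.unit * unitsCab (ofEmb g02) (expUnit c) *
        unitsCab (ofEmb g021) (hΦ.unit)⁻¹ * unitsCab (ofEmb g12) (expUnit c) * hΦ.unit := by
    have h := hΦ.hexagon c hc
    have hinv : Ring.inverse Φ = ((hΦ.unit⁻¹ : (ChordHat k (Fin 3))ˣ) : ChordHat k (Fin 3)) := by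
      conv_lhs => rw [← hΦ.unit_val]
      exact Ring.inverse_unit _
    rw [hinv] at h
    refine Units.ext ?_
    have e1 : ChordHat.cab (ofEmb g02) (ChordHat.expChord c 0 1) = ChordHat.expChord c 0 2 :=
      ChordHat.cab_ofEmb_expChord _ _ _ _
    have e2 : ChordHat.cab (ofEmb g12) (ChordHat.expChord c 0 1) = ChordHat.expChord c 1 2 :=
      ChordHat.cab_ofEmb_expChord _ _ _ _
    simp only [Units.val_mul, unitsCab_val, expUnit, e1, e2, IsAssociator.unit_val]
    simpa only [ChordHat.relabel_eq_cab, ChordHat.double, ChordHat.cable_eq_cab] using h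
  have hx : ∀ x (P : ℕ → Prop), (∃ y, P y ∧ x = τ y) ↔ P (τ⁻¹ x) := by
    intro x P
    constructor
    · rintro ⟨y, hy, rfl⟩; simpa using hy
    · intro h; exact ⟨_, h, by simp⟩
  have hinvτ : ∀ x, τ⁻¹ x = if x < a then x else a + blockPerm b a' (x - a) := by
    intro x
    rw [Equiv.Perm.inv_eq_iff_eq, hτ, viaEmbedding_addLeft]
    simp only [blockPerm_apply]
    split_ifs <;> omega
  have hinvστ : ∀ x, (σ * τ)⁻¹ x = blockPerm b (a + a') x := by
    intro x
    rw [hσ, hτ, ← blockPerm_add, blockPerm_inv]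
  have hx' : ∀ x (P : ℕ → Prop), (∃ y, P y ∧ x = σ (τ y)) ↔ P ((σ * τ)⁻¹ x) := by
    intro x P
    constructor
    · rintro ⟨y, hy, rfl⟩; simpa using hy
    · intro h; exact ⟨_, h, by simp⟩
  -- Above `σ * τ` the blocks read `b`, `a`, `a'`; above `τ` alone they read `a`, `b`, `a'`. So `r1`
  -- involves `σ * τ`, `r2` and `r3` involve `τ`, and the factors below the crossings need no
  -- permutation.
  have r1 : unitsCab (block₃ b a a') hΦ.unit =
      relabelAut k (σ * τ) (unitsCab F (unitsCab (ofEmb g201) hΦ.unit)) := by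
    rw [relabelAut_eq_unitsCab]
    refine Units.ext ?_
    simp only [unitsCab_val, ChordHat.cab_cab]
    congr 2
    refine ext_mem fun i x => ?_
    revert i
    simp [Fin.forall_fin_succ, hx', hinvστ, blockPerm_apply, g201, F, -mul_inv_rev]
    split_ifs <;> omega
  have r2 : unitsCab (block₂ a b) (expUnit c) =
      relabelAut k τ (unitsCab F (unitsCab (ofEmb g02) (expUnit c))) := by
    rw [relabelAut_eq_unitsCab]
    refine Units.ext ?_
    simp only [unitsCab_val, ChordHat.cab_cab]
    congr 2
    refine ext_mem fun i x => ?_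
    revert i
    simp [Fin.forall_fin_succ, hx, hinvτ, blockPerm_apply, g02, F]
    split_ifs <;> omega
  have r3 : unitsCab (block₃ a b a') hΦ.unit =
      relabelAut k τ (unitsCab F (unitsCab (ofEmb g021) hΦ.unit)) := by
    rw [relabelAut_eq_unitsCab]
    refine Units.ext ?_
    simp only [unitsCab_val, ChordHat.cab_cab]
    congr 2
    refine ext_mem fun i x => ?_
    revert i
    simp [Fin.forall_fin_succ, hx, hinvτ, blockPerm_apply, g021, F]
    split_ifs <;> omega
  have r4 : unitsCab (ofEmb (addLeftEmbedding a)) (unitsCab (block₂ a' b) (expUnit c)) =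
      unitsCab F (unitsCab (ofEmb g12) (expUnit c)) := by
    refine unitsCab_unitsCab_eq (fun i x => ?_) _
    revert i
    simp [Fin.forall_fin_succ, exists_eq_add_iff, g12, F]
    omega
  have r5 : unitsCab (block₂ (a + a') b) (expUnit c) =
      unitsCab F (unitsCab (ofFun (Fin.predAbove (0 : Fin 2))) (expUnit c)) := by
    symm
    refine unitsCab_unitsCab (fun i x => ?_) _
    revert i
    simp [Fin.forall_fin_succ, Fin.exists_fin_succ, Fin.predAbove, F]
    omega
  have hL : crossing c (a + a') b = inr (σ * τ) * inl (unitsCab F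
      (unitsCab (ofFun (Fin.predAbove (0 : Fin 2))) (expUnit c))) := by
    rw [crossing, r5, blockPerm_add]
  rw [hL, h]
  simp only [crossing, assoc, map_mul (shift a), r1, r2, r3, shift_inr, shift_inl, r4]
  rw [← hσ, ← hτ, show block₃ a a' b = F from rfl]
  -- Each action becomes a conjugation by a permutation, and these conjugations telescope.
  simp only [inl_aut]
  simp only [map_mul, map_inv]
  group

end StrandGroup

end AssociatorRelations

/-! ### Reparenthesizations and the representation of the braid group on left-normed
parenthesizations. -/

section BraidRepresentation

theorem Braid.induction {n : ℕ} {P : Braid n → Prop} (one : P 1)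
    (gen : ∀ i h, P (Braid.gen i h)) (mul : ∀ x y, P x → P y → P (x * y))
    (inv : ∀ x, P x → P x⁻¹) (x : Braid n) : P x := by
  have hx : x ∈ Subgroup.closure (Set.range (PresentedGroup.of (rels := braidRels n))) := by
    rw [PresentedGroup.closure_range_of]; trivial
  induction hx using Subgroup.closure_induction with
  | mem x hx => obtain ⟨i, rfl⟩ := hx; exact gen i.1 i.2
  | one => exact one
  | mul x y _ _ hx hy => exact mul x y hx hy
  | inv x _ hx => exact inv x hx

variable {k : Type u} [Field k]

namespace StrandGroup

open SemidirectProduct StrandMap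

/-! ### Reparenthesization -/

/-- The image of the reparenthesization `ℓ n ⊗ ℓ m ⟶ ℓ (n + m)`, where `ℓ n` is the left-normed
parenthesization of `n` points. -/
noncomputable def regroup (φ : (ChordHat k (Fin 3))ˣ) (n : ℕ) : ℕ → StrandGroup k
  | 0 => 1
  -- Since `ℓ (m + 1) = ℓ m ⊗ •`, the path is `ℓ n ⊗ (ℓ m ⊗ •) ⟶ (ℓ n ⊗ ℓ m) ⊗ • ⟶ ℓ (n + m) ⊗ •`.
  | m + 1 => regroup φ n m * (assoc φ n m 1)⁻¹

theorem regroup_mem (φ : (ChordHat k (Fin 3))ˣ) (n m : ℕ) :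
    regroup φ n m ∈ supp k (Set.Iio (n + m)) := by
  induction m with
  | zero => exact one_mem _
  | succ m ih =>
    exact mul_mem (supp_mono (Set.Iio_subset_Iio (by omega)) ih) (inv_mem (assoc_mem φ n m 1))

theorem commute_regroup (φ : (ChordHat k (Fin 3))ˣ) {n : ℕ} {u : StrandGroup k}
    (hu : u ∈ supp k (Set.Iio n)) (m : ℕ) : Commute u (regroup φ n m) := by
  induction m with
  | zero => exact Commute.one_right _
  | succ m ih => exact ih.mul_right (commute_assoc hu φ n m 1 (Or.inl subset_rfl)).inv_right

/-- The image of the reparenthesization `ℓ n ⊗ t ⟶ ℓ (n + |t|)` for a nonempty bracketing `t`. -/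
noncomputable def regroupTree (φ : (ChordHat k (Fin 3))ˣ) : ℕ → FreeMagma Unit → StrandGroup k
  | _, .of _ => 1
  -- The path is `ℓ n ⊗ (s t) ⟶ (ℓ n ⊗ s) ⊗ t ⟶ ℓ (n + |s|) ⊗ t ⟶ ℓ (n + |s| + |t|)`.
  | n, .mul s t => regroupTree φ (n + s.length) t * regroupTree φ n s *
      (assoc φ n s.length t.length)⁻¹

/-- The image of the reparenthesization `ℓ n ⊗ p ⟶ ℓ (n + |p|)`. -/
noncomputable def regroupPaB (φ : (ChordHat k (Fin 3))ˣ) (n : ℕ) (p : PaB) : StrandGroup k :=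
  WithOne.recOneCoe (motive := fun _ => StrandGroup k) 1 (regroupTree φ n) p

end StrandGroup

/-- The parenthesization of one point. -/
def PaB.point : PaB := PaB.ofTree (.of ())

@[simp] theorem PaB.length_point : PaB.point.length = 1 := rfl

theorem PaB.induction {P : PaB → Prop} (one : P 1) (point : P PaB.point)
    (mul : ∀ p q, P p → P q → P (p * q)) (p : PaB) : P p := by
  rcases p with _ | t
  · exact one
  · change P (PaB.ofTree t)
    induction t with
    | ih1 _ => exact point
    | ih2 s t hs ht => exact mul _ _ hs ht

namespace StrandGroup

open SemidirectProduct StrandMap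

variable {Φ : ChordHat k (Fin 3)}

@[simp] theorem regroupPaB_one (φ : (ChordHat k (Fin 3))ˣ) (n : ℕ) : regroupPaB φ n 1 = 1 := rfl

@[simp] theorem regroupPaB_point (φ : (ChordHat k (Fin 3))ˣ) (n : ℕ) :
    regroupPaB φ n PaB.point = 1 := rfl

/-- The recursion on trees persists when a factor is empty because `Φ` with an empty block is `1`.
This is where strictness of the unit meets nondegeneracy. -/
theorem regroupPaB_mul (hΦ : IsAssociator Φ) (n : ℕ) (p q : PaB) :
    regroupPaB hΦ.unit n (p * q) = regroupPaB hΦ.unit (n + p.length) q * regroupPaB hΦ.unit n p *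
      (assoc hΦ.unit n p.length q.length)⁻¹ := by
  rcases p with _ | s
  · change regroupPaB hΦ.unit n (1 * q) = regroupPaB hΦ.unit (n + PaB.length 1) q *
      regroupPaB hΦ.unit n 1 * (assoc hΦ.unit n (PaB.length 1) q.length)⁻¹
    rw [one_mul, PaB.length_one, assoc_zero_middle]
    simp
  rcases q with _ | t
  · change regroupPaB hΦ.unit n (PaB.ofTree s * 1) =
      regroupPaB hΦ.unit (n + (PaB.ofTree s).length) 1 *
      regroupPaB hΦ.unit n (PaB.ofTree s) *
        (assoc hΦ.unit n (PaB.ofTree s).length (PaB.length 1))⁻¹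
    rw [mul_one, PaB.length_one, assoc_zero_right]
    simp
  · rfl

theorem regroupPaB_zero_mul (hΦ : IsAssociator Φ) (p q : PaB) :
    regroupPaB hΦ.unit 0 (p * q) =
      regroupPaB hΦ.unit p.length q * regroupPaB hΦ.unit 0 p := by
  rw [regroupPaB_mul, assoc_zero_left, inv_one, mul_one, zero_add]

theorem regroupPaB_mem (hΦ : IsAssociator Φ) (n : ℕ) (p : PaB) :
    regroupPaB hΦ.unit n p ∈ supp k (Set.Iio (n + p.length)) := by
  induction p using PaB.induction generalizing n with
  | one => exact one_mem _
  | point => exact one_mem _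
  | mul p q hp hq =>
    rw [regroupPaB_mul, PaB.length_mul, ← add_assoc]
    exact mul_mem (mul_mem (hq _) (supp_mono (Set.Iio_subset_Iio (by omega)) (hp n)))
      (inv_mem (assoc_mem _ _ _ _))

theorem regroupPaB_zero_mem (hΦ : IsAssociator Φ) (p : PaB) :
    regroupPaB hΦ.unit 0 p ∈ supp k (Set.Iio p.length) := by
  simpa using regroupPaB_mem hΦ 0 p

theorem assoc_right (φ : (ChordHat k (Fin 3))ˣ) (a b c : ℕ) : (assoc φ a b c).right = 1 := rfl

theorem regroupPaB_right (hΦ : IsAssociator Φ) (n : ℕ) (p : PaB) :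
    (regroupPaB hΦ.unit n p).right = 1 := by
  induction p using PaB.induction generalizing n with
  | one => rfl
  | point => rfl
  | mul p q hp hq => rw [regroupPaB_mul, mul_right, mul_right, hp, hq, inv_right, assoc_right]; simp

/-- The pentagon for reparenthesizations: the two ways to pass from `(ℓ n ⊗ ℓ m) ⊗ p` to
`ℓ (n + m + |p|)` agree. -/
theorem regroupPaB_mul_regroup (hΦ : IsAssociator Φ) (n m : ℕ) (p : PaB) :
    regroupPaB hΦ.unit (n + m) p * regroup hΦ.unit n m =
      regroup hΦ.unit n (m + p.length) * shift n (regroupPaB hΦ.unit m p) *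
        assoc hΦ.unit n m p.length := by
  induction p using PaB.induction generalizing m with
  | one => simp [assoc_zero_right]
  | point => simp [regroup]
  | mul p q hp hq =>
    have hq' := hq (m + p.length)
    have hp' := hp m
    have c1 : Commute (regroup hΦ.unit n m) (assoc hΦ.unit (n + m) p.length q.length) :=
      commute_assoc (regroup_mem _ n m) _ _ _ _ (Or.inl subset_rfl)
    have c2 : Commute (shift n (regroupPaB hΦ.unit m p))
        (assoc hΦ.unit n (m + p.length) q.length) :=
      commute_assoc (shift_mem (regroupPaB_mem hΦ m p)) _ _ _ _ (Or.inr (Or.inl subset_rfl))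
    have pent := assoc_pentagon hΦ n m p.length q.length
    rw [regroupPaB_mul, regroupPaB_mul, PaB.length_mul, ← add_assoc m, map_mul, map_mul, map_inv]
    rw [← add_assoc n] at hq'
    -- The pentagon, solved for the associator whose last block is the whole of `p * q`.
    have e1 : assoc hΦ.unit n m (p.length + q.length) =
        shift n (assoc hΦ.unit m p.length q.length) *
          assoc hΦ.unit n (m + p.length) q.length * assoc hΦ.unit n m p.length *
            (assoc hΦ.unit (n + m) p.length q.length)⁻¹ := by
      rw [pent, mul_inv_cancel_right]
    rw [e1]
    calc _ = regroupPaB hΦ.unit (n + m + p.length) q * (regroupPaB hΦ.unit (n + m) p *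
          regroup hΦ.unit n m) * (assoc hΦ.unit (n + m) p.length q.length)⁻¹ := by
          simp only [mul_assoc, c1.inv_right.eq]
      _ = (regroupPaB hΦ.unit (n + m + p.length) q * regroup hΦ.unit n (m + p.length)) *
          shift n (regroupPaB hΦ.unit m p) * assoc hΦ.unit n m p.length *
            (assoc hΦ.unit (n + m) p.length q.length)⁻¹ := by
          rw [hp']; simp only [mul_assoc]
      _ = regroup hΦ.unit n (m + p.length + q.length) *
          shift n (regroupPaB hΦ.unit (m + p.length) q) *
          (assoc hΦ.unit n (m + p.length) q.length * shift n (regroupPaB hΦ.unit m p)) *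
          assoc hΦ.unit n m p.length * (assoc hΦ.unit (n + m) p.length q.length)⁻¹ := by
          rw [hq']; simp only [mul_assoc]
      _ = _ := by
          rw [← c2.eq]; group

/-- The case `m = 0` of the preceding pentagon: `ℓ n ⊗ p` may first be left-normed inside `p`, then
merged with `ℓ n`. -/
theorem regroupPaB_eq (hΦ : IsAssociator Φ) (n : ℕ) (p : PaB) :
    regroupPaB hΦ.unit n p =
      regroup hΦ.unit n p.length * shift n (regroupPaB hΦ.unit 0 p) := by
  have h := regroupPaB_mul_regroup hΦ n 0 p
  simpa [assoc_zero_middle, regroup] using h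

theorem commute_shift {n m : ℕ} {u v : StrandGroup k} (hu : u ∈ supp k (Set.Iio n))
    (hv : v ∈ supp k (Set.Iio m)) {l : ℕ} (h : n ≤ l) : Commute u (shift l v) := by
  refine commute_of_disjoint ?_ hu (shift_mem hv)
  rw [Set.disjoint_left]
  intro x hx hx'
  simp only [Set.mem_Iio, Set.mem_Ico] at hx hx'
  omega

/-! ### The images of the Artin generators -/

variable [CharZero k]

/-- The image of the generator `σ i`. -/
noncomputable def sigma (φ : (ChordHat k (Fin 3))ˣ) (i : ℕ) : StrandGroup k :=
  -- In `(ℓ i ⊗ •) ⊗ •` the last two points have to be grouped together before they cross.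
  (assoc φ i 1 1)⁻¹ * shift i (crossing (1 / 2) 1 1) * assoc φ i 1 1

theorem sigma_mem (φ : (ChordHat k (Fin 3))ˣ) (i : ℕ) : sigma φ i ∈ supp k (Set.Iio (i + 2)) :=
  mul_mem (mul_mem (inv_mem (assoc_mem φ i 1 1)) (shift_mem_Iio (crossing_mem _ 1 1)))
    (assoc_mem φ i 1 1)

/-- The strands of `u` lie in the left block of `Φ_{i,1,1}` and are disjoint from the two that
cross. -/
theorem commute_sigma (φ : (ChordHat k (Fin 3))ˣ) {n i : ℕ} {u : StrandGroup k}
    (hu : u ∈ supp k (Set.Iio n)) (h : n ≤ i) : Commute u (sigma φ i) := by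
  have h1 : Commute u (assoc φ i 1 1) :=
    commute_assoc hu φ i 1 1 (Or.inl (Set.Iio_subset_Iio h))
  exact (h1.inv_right.mul_right (commute_shift hu (crossing_mem _ 1 1) h)).mul_right h1

/-- Inserting `ℓ n` on the left changes the index of a generator, up to regrouping. For `m = i + 2`
this is the pentagon with blocks `n`, `i`, `1`, `1`, since the crossing lies in the last block of
`Φ_{n,i,2}`. For larger `m` the generator lies in the middle block of the additional associator. -/
theorem regroup_mul_shift_sigma (hΦ : IsAssociator Φ) (n : ℕ) {i m : ℕ} (h : i + 2 ≤ m) :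
    regroup hΦ.unit n m * shift n (sigma hΦ.unit i) =
      sigma hΦ.unit (n + i) * regroup hΦ.unit n m := by
  induction m, h using Nat.le_induction with
  | base =>
    have pent := assoc_pentagon hΦ n i 1 1
    have c1 : Commute (assoc hΦ.unit n i 2) (shift (n + i) (crossing (1 / 2 : k) 1 1)) :=
      (commute_assoc (shift_mem (crossing_mem _ 1 1)) _ _ _ _
        (Or.inr (Or.inr (Or.inl subset_rfl)))).symm
    have c2 : Commute (regroup hΦ.unit n i) (sigma hΦ.unit (n + i)) :=
      commute_sigma _ (regroup_mem _ n i) le_rfl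
    have e : shift n (assoc hΦ.unit i 1 1) = assoc hΦ.unit n i 2 * assoc hΦ.unit (n + i) 1 1 *
        (assoc hΦ.unit n i 1)⁻¹ * (assoc hΦ.unit n (i + 1) 1)⁻¹ := by
      rw [← pent]; group
    have e2 : shift n (sigma hΦ.unit i) = assoc hΦ.unit n (i + 1) 1 * assoc hΦ.unit n i 1 *
        sigma hΦ.unit (n + i) * (assoc hΦ.unit n i 1)⁻¹ * (assoc hΦ.unit n (i + 1) 1)⁻¹ := by
      rw [sigma, map_mul, map_mul, map_inv, shift_shift, e]
      calc _ = assoc hΦ.unit n (i + 1) 1 * assoc hΦ.unit n i 1 *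
            (assoc hΦ.unit (n + i) 1 1)⁻¹ * ((assoc hΦ.unit n i 2)⁻¹ *
            (shift (n + i) (crossing (1 / 2 : k) 1 1) * assoc hΦ.unit n i 2)) *
            assoc hΦ.unit (n + i) 1 1 * (assoc hΦ.unit n i 1)⁻¹ *
            (assoc hΦ.unit n (i + 1) 1)⁻¹ := by group
        _ = _ := by rw [← c1.eq, sigma]; group
    rw [e2]
    change regroup hΦ.unit n i * (assoc hΦ.unit n i 1)⁻¹ * (assoc hΦ.unit n (i + 1) 1)⁻¹ * _ =
      _ * (regroup hΦ.unit n i * (assoc hΦ.unit n i 1)⁻¹ * (assoc hΦ.unit n (i + 1) 1)⁻¹)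
    calc _ = (regroup hΦ.unit n i * sigma hΦ.unit (n + i)) * (assoc hΦ.unit n i 1)⁻¹ *
          (assoc hΦ.unit n (i + 1) 1)⁻¹ := by group
      _ = _ := by rw [c2.eq]; group
  | succ m hm ih =>
    have c : Commute (shift n (sigma hΦ.unit i)) (assoc hΦ.unit n m 1) :=
      commute_assoc (shift_mem (sigma_mem _ i)) _ _ _ _
        (Or.inr (Or.inl (Set.Ico_subset_Ico_right (by omega))))
    rw [regroup, mul_assoc, ← c.inv_right.eq, ← mul_assoc, ih, mul_assoc]

theorem sigma_comm (φ : (ChordHat k (Fin 3))ˣ) {i j : ℕ} (h : i + 1 < j) :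
    sigma φ i * sigma φ j = sigma φ j * sigma φ i :=
  commute_sigma φ (sigma_mem φ i) h

/-- For `i = 0`, the hexagon writes the crossing of two strands with one as `Φ_{1,1,1} σ₀ σ₁`, and
naturality of that crossing with respect to `σ₀` gives the relation. Conjugation by `regroup`
carries it to every `i`. -/
theorem sigma_braid (hΦ : IsAssociator Φ) (i : ℕ) :
    sigma hΦ.unit i * sigma hΦ.unit (i + 1) * sigma hΦ.unit i =
      sigma hΦ.unit (i + 1) * sigma hΦ.unit i * sigma hΦ.unit (i + 1) := by
  -- No associator appears, because its first block is empty.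
  have h0 : sigma hΦ.unit 0 = crossing (1 / 2 : k) 1 1 := by
    rw [sigma, assoc_zero_left, shift_zero]; group
  have key : sigma hΦ.unit 0 * sigma hΦ.unit 1 * sigma hΦ.unit 0 =
      sigma hΦ.unit 1 * sigma hΦ.unit 0 * sigma hΦ.unit 1 := by
    have hex := crossing_hexagon hΦ (c := 1 / 2) (Or.inl rfl) 1 1 1
    have nat := shift_mul_crossing (crossing_mem (1 / 2 : k) 1 1) (1 / 2) 1
    have e : crossing (1 / 2 : k) (1 + 1) 1 =
        assoc hΦ.unit 1 1 1 * (sigma hΦ.unit 0 * sigma hΦ.unit 1) := by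
      rw [hex, h0, sigma]; group
    have e' : shift 1 (crossing (1 / 2 : k) 1 1) =
        assoc hΦ.unit 1 1 1 * sigma hΦ.unit 1 * (assoc hΦ.unit 1 1 1)⁻¹ := by
      rw [sigma]; group
    rw [e, e', ← h0] at nat
    refine mul_left_cancel (a := assoc hΦ.unit 1 1 1) ?_
    calc _ = _ := by group
      _ = _ := nat.symm
      _ = _ := by group
  -- The same conjugating element `regroup hΦ.unit i 3` serves both generators, so the relation can
  -- be conjugated as a whole.
  have t : ∀ j, j + 2 ≤ 3 → sigma hΦ.unit (i + j) =
      regroup hΦ.unit i 3 * shift i (sigma hΦ.unit j) * (regroup hΦ.unit i 3)⁻¹ := fun j hj => by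
    rw [regroup_mul_shift_sigma hΦ i hj, mul_inv_cancel_right]
  have t0 := t 0 (by omega)
  have t1 := t 1 (by omega)
  have key' := congrArg (shift i) key
  simp only [map_mul] at key'
  rw [add_zero] at t0
  rw [t0, t1]
  calc _ = regroup hΦ.unit i 3 * (shift i (sigma hΦ.unit 0) * shift i (sigma hΦ.unit 1) *
        shift i (sigma hΦ.unit 0)) * (regroup hΦ.unit i 3)⁻¹ := by group
    _ = _ := by rw [key']; group

/-- The representation of the braid group given by the left-normed parenthesization. -/
noncomputable def braidRep (hΦ : IsAssociator Φ) (n : ℕ) : Braid n →* StrandGroup k :=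
  Braid.lift (fun i _ => sigma hΦ.unit i) (fun _ _ _ _ h => sigma_comm _ h)
    (fun i _ _ => sigma_braid hΦ i)

@[simp] theorem braidRep_gen (hΦ : IsAssociator Φ) {n i : ℕ} (h : i + 1 < n) :
    braidRep hΦ n (Braid.gen i h) = sigma hΦ.unit i :=
  Braid.lift_gen _ _ _ i h

@[simp] theorem braidRep_cast (hΦ : IsAssociator Φ) {n m : ℕ} (h : n = m) (x : Braid n) :
    braidRep hΦ m (Braid.cast h x) = braidRep hΦ n x := by
  subst h; rfl

theorem braidRep_mem (hΦ : IsAssociator Φ) {n : ℕ} (x : Braid n) :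
    braidRep hΦ n x ∈ supp k (Set.Iio n) := by
  induction x using Braid.induction with
  | one => rw [map_one]; exact one_mem _
  | gen i h =>
    rw [braidRep_gen]
    exact supp_mono (Set.Iio_subset_Iio (by omega)) (sigma_mem _ i)
  | mul x y hx hy => rw [map_mul]; exact mul_mem hx hy
  | inv x hx => rw [map_inv]; exact inv_mem hx

/-- Since `ℓ (n + m)` extends `ℓ n` on the right, the generators keep their images; this is the
advantage of left-normed parenthesizations. -/
theorem braidRep_inl (hΦ : IsAssociator Φ) {n : ℕ} (m : ℕ) (x : Braid n) :
    braidRep hΦ (n + m) (Braid.inl m x) = braidRep hΦ n x := by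
  induction x using Braid.induction with
  | one => simp only [map_one]
  | gen i h => rw [Braid.inl, Braid.lift_gen, braidRep_gen, braidRep_gen]
  | mul x y hx hy => simp only [map_mul, hx, hy]
  | inv x hx => simp only [map_inv, hx]

theorem braidRep_inr (hΦ : IsAssociator Φ) (n : ℕ) {m : ℕ} (x : Braid m) :
    braidRep hΦ (n + m) (Braid.inr n x) =
      regroup hΦ.unit n m * shift n (braidRep hΦ m x) * (regroup hΦ.unit n m)⁻¹ := by
  induction x using Braid.induction with
  | one => simp only [map_one]; group
  | gen i h =>
    rw [Braid.inr, Braid.lift_gen, braidRep_gen, braidRep_gen, regroup_mul_shift_sigma hΦ n h,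
      mul_inv_cancel_right]
  | mul x y hx hy => simp only [map_mul, hx, hy]; group
  | inv x hx => simp only [map_inv, hx]; group

theorem sigma_right (φ : (ChordHat k (Fin 3))ˣ) (i x : ℕ) :
    (sigma φ i).right x = if x = i then i + 1 else if x = i + 1 then i else x := by
  simp only [sigma, mul_right, inv_right, assoc_right, inv_one, one_mul, mul_one, shift_right_apply,
    crossing_right, blockPerm_apply]
  split_ifs <;> omega

theorem braidRep_right (hΦ : IsAssociator Φ) {n : ℕ} (x : Braid n) (i : Fin n) :
    (braidRep hΦ n x).right i = Braid.perm x i := by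
  induction x using Braid.induction generalizing i with
  | one => simp
  | gen j h => rw [braidRep_gen, sigma_right, Braid.perm, Braid.lift_gen, Braid.swap_val]
  | mul x y hx hy => simp only [map_mul, mul_right, Equiv.Perm.mul_apply, hx, hy]
  | inv x hx =>
    rw [map_inv, map_inv, inv_right, Equiv.Perm.inv_eq_iff_eq, hx, ← Equiv.Perm.mul_apply, mul_inv_cancel, Equiv.Perm.one_apply]

/-! ### The images of parenthesized braids -/

/-- The image of a braid whose bottom and top ends are parenthesized by `p` and `q`. -/
noncomputable def eval (hΦ : IsAssociator Φ) {p q : PaB} (f : p ⟶ q) : StrandGroup k :=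
  (regroupPaB hΦ.unit 0 q)⁻¹ * braidRep hΦ p.length f.braid * regroupPaB hΦ.unit 0 p

theorem eval_mem (hΦ : IsAssociator Φ) {p q : PaB} (f : p ⟶ q) :
    eval hΦ f ∈ supp k (Set.Iio p.length) := by
  refine mul_mem (mul_mem (inv_mem ?_) (braidRep_mem hΦ _)) (regroupPaB_zero_mem hΦ p)
  rw [f.length_eq]
  exact regroupPaB_zero_mem hΦ q

theorem eval_id (hΦ : IsAssociator Φ) (p : PaB) : eval hΦ (𝟙 p) = 1 := by
  have h : (𝟙 p : p ⟶ p).braid = 1 := rfl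
  rw [eval, h, map_one, mul_one, inv_mul_cancel]

theorem eval_comp (hΦ : IsAssociator Φ) {p q r : PaB} (f : p ⟶ q) (g : q ⟶ r) :
    eval hΦ (f ≫ g) = eval hΦ g * eval hΦ f := by
  have h : (f ≫ g).braid = Braid.cast f.length_eq.symm g.braid * f.braid := rfl
  rw [eval, h, map_mul, braidRep_cast, eval, eval]
  group

/-- By `regroupPaB_eq` and `braidRep_inr`, both ends and the right-hand braid involve the same
factor `regroup`. It commutes with the left-hand braid and cancels; the remaining left and right
factors have disjoint supports. -/
theorem eval_tensorHom (hΦ : IsAssociator Φ) {p q p' q' : PaB} (f : p ⟶ q) (g : p' ⟶ q') :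
    eval hΦ (PaB.tensorHom f g) = eval hΦ f * shift p.length (eval hΦ g) := by
  have h : (PaB.tensorHom f g).braid =
    Braid.cast (PaB.length_mul p p').symm (Braid.tensor f.braid g.braid) := rfl
  rw [eval, h, braidRep_cast, Braid.tensor, map_mul, braidRep_inl, braidRep_inr,
    regroupPaB_zero_mul, regroupPaB_zero_mul, regroupPaB_eq, regroupPaB_eq hΦ p.length, eval, eval,
    ← f.length_eq, ← g.length_eq]
  have c1 := commute_regroup hΦ.unit (braidRep_mem hΦ f.braid) p'.length
  have hq' : regroupPaB hΦ.unit 0 q' ∈ supp k (Set.Iio p'.length) := by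
    rw [g.length_eq]; exact regroupPaB_zero_mem hΦ q'
  have c2 := commute_shift (braidRep_mem hΦ f.braid) (inv_mem hq') le_rfl
  have c3 := commute_shift (regroupPaB_zero_mem hΦ p)
    (mul_mem (mul_mem (inv_mem hq') (braidRep_mem hΦ g.braid)) (regroupPaB_zero_mem hΦ p')) le_rfl
  calc _ = (regroupPaB hΦ.unit 0 q)⁻¹ * ((shift p.length (regroupPaB hΦ.unit 0 q'))⁻¹ *
        ((regroup hΦ.unit p.length p'.length)⁻¹ * (braidRep hΦ p.length f.braid *
        regroup hΦ.unit p.length p'.length))) * shift p.length (braidRep hΦ p'.length g.braid) *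
        shift p.length (regroupPaB hΦ.unit 0 p') * regroupPaB hΦ.unit 0 p := by group
    _ = (regroupPaB hΦ.unit 0 q)⁻¹ * (shift p.length (regroupPaB hΦ.unit 0 q')⁻¹ *
        braidRep hΦ p.length f.braid) * shift p.length (braidRep hΦ p'.length g.braid) *
        shift p.length (regroupPaB hΦ.unit 0 p') * regroupPaB hΦ.unit 0 p := by
        rw [c1.eq, inv_mul_cancel_left, map_inv]
    _ = (regroupPaB hΦ.unit 0 q)⁻¹ * braidRep hΦ p.length f.braid *
        (shift p.length ((regroupPaB hΦ.unit 0 q')⁻¹ * braidRep hΦ p'.length g.braid *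
          regroupPaB hΦ.unit 0 p') * regroupPaB hΦ.unit 0 p) := by
        rw [← c2.eq]; simp only [map_mul, mul_assoc]
    _ = _ := by rw [← c3.eq]; simp only [mul_assoc]

/-- The chosen paths from the two parenthesizations differ by a single associator, up to a
reparenthesization of `p`, which commutes with it by locality. -/
theorem eval_assocHom (hΦ : IsAssociator Φ) (p q r : PaB) :
    eval hΦ (PaB.assocHom p q r) = assoc hΦ.unit p.length q.length r.length := by
  have h : (PaB.assocHom p q r).braid = 1 := rfl
  have c : Commute (regroupPaB hΦ.unit 0 p) (assoc hΦ.unit p.length q.length r.length) :=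
    commute_assoc (regroupPaB_zero_mem hΦ p) _ _ _ _ (Or.inl subset_rfl)
  rw [eval, h, map_one, mul_one, regroupPaB_zero_mul, regroupPaB_zero_mul, regroupPaB_zero_mul,
    regroupPaB_mul, PaB.length_mul]
  calc _ = (regroupPaB hΦ.unit 0 p)⁻¹ * (assoc hΦ.unit p.length q.length r.length *
        regroupPaB hΦ.unit 0 p) := by group
    _ = _ := by rw [← c.eq]; group

end StrandGroup

end BraidRepresentation

/-! ### Values on the braidings, and compatibility with doubling. -/

section BraidingAndCabling

variable {k : Type u} [Field k]

namespace StrandGroup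

open SemidirectProduct StrandMap

variable {Φ : ChordHat k (Fin 3)}

/-! ### Cabling of reparenthesizations -/

theorem double_mul_of_right {i : ℕ} (u : StrandGroup k) {v : StrandGroup k} (hv : v.right = 1) :
    double i (u * v) = double i u * double i v := by
  rw [double_mul, hv, Equiv.Perm.one_apply]

theorem double_inv_of_right {i : ℕ} {u : StrandGroup k} (hu : u.right = 1) :
    double i u⁻¹ = (double i u)⁻¹ := by
  rw [double_inv, hu, inv_one, Equiv.Perm.one_apply]

theorem double_shift_of_lt {i n : ℕ} (h : i < n) (u : StrandGroup k) :
    double i (shift n u) = shift (n + 1) u := by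
  have hr : (shift n u).right i = i := by rw [shift_right_apply, if_pos h]
  refine SemidirectProduct.ext ?_ (Equiv.ext fun x => ?_)
  · change unitsCab (doubleMap ((shift n u).right i)) (unitsCab _ u.left) = unitsCab _ u.left
    rw [hr]
    refine unitsCab_unitsCab (fun a x => ?_) _
    simp only [mem_ofEmb, addLeftEmbedding_apply, mem_doubleMap, exists_eq_left, merge]
    split_ifs <;> omega
  · change doublePerm i (shift n u).right x = (shift (n + 1) u).right x
    rcases eq_or_skip i x with rfl | ⟨y, rfl⟩
    · rw [doublePerm_self, hr, shift_right_apply, if_pos (by omega)]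
    · rw [doublePerm_skip, hr, shift_right_apply, shift_right_apply]
      by_cases hy : y < n
      · have : skip i y < n + 1 := by unfold skip; split_ifs <;> omega
        rw [if_pos hy, if_pos this]
      · have e : skip i y = y + 1 := by unfold skip; split_ifs <;> omega
        rw [if_neg hy, e, if_neg (by omega), Nat.add_sub_add_right]
        unfold skip
        split_ifs <;> omega

/-- Doubling point `i` of `ℓ n` gives a parenthesization which `Φ_{i,1,1}⁻¹` joins to `ℓ (n + 1)`.
This correction occurs at both ends of the path, since the doubled point belongs to `ℓ n`. -/
theorem double_regroupPaB (hΦ : IsAssociator Φ) {i n : ℕ} (h : i < n) (p : PaB) :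
    regroupPaB hΦ.unit (n + 1) p = (assoc hΦ.unit i 1 1)⁻¹ * double i (regroupPaB hΦ.unit n p) *
      assoc hΦ.unit i 1 1 := by
  induction p using PaB.induction generalizing n with
  | one => simp [double_one]
  | point => simp [double_one]
  | mul p q hp hq =>
    have e : n + 1 + p.length = n + p.length + 1 := by omega
    have c : Commute (assoc hΦ.unit i 1 1) (assoc hΦ.unit (n + 1) p.length q.length) :=
      commute_assoc (assoc_mem _ i 1 1) _ _ _ _ (Or.inl (Set.Iio_subset_Iio (by omega)))
    rw [regroupPaB_mul, e, hq (by omega), hp h, regroupPaB_mul,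
      double_mul_of_right _ (by rw [inv_right, assoc_right, inv_one]),
      double_mul_of_right _ (regroupPaB_right hΦ _ _), double_inv_of_right (assoc_right _ _ _ _),
      double_assoc_left _ _ _ _ h]
    simp only [mul_assoc, c.inv_right.eq, mul_inv_cancel_left]

/-- Here the doubled point belongs to `t`, so only the top end has to be corrected. If it is in the
left factor, the right factor is reparenthesized over a doubled `ℓ (n + |s|)`, as in
`double_regroupPaB`; if it is in the right factor, the path of the left factor is unaffected. -/
theorem regroupTree_doubleTree (hΦ : IsAssociator Φ) (n : ℕ) (t : FreeMagma Unit) {j : ℕ}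
    (h : j < t.length) : regroupTree hΦ.unit n (PaB.doubleTree t j) =
      (assoc hΦ.unit (n + j) 1 1)⁻¹ * double (n + j) (regroupTree hΦ.unit n t) := by
  induction t generalizing n j with
  | ih1 a =>
    obtain rfl : j = 0 := Nat.lt_one_iff.1 h
    change 1 * 1 * (assoc hΦ.unit n 1 1)⁻¹ = (assoc hΦ.unit n 1 1)⁻¹ * double n 1
    rw [double_one]; group
  | ih2 s t hs ht =>
    have hlt : j < s.length + t.length := h
    have e1 : double (n + j) (regroupTree hΦ.unit n (.mul s t)) =
        double (n + j) (regroupTree hΦ.unit (n + s.length) t) *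
          double (n + j) (regroupTree hΦ.unit n s) *
          (double (n + j) (assoc hΦ.unit n s.length t.length))⁻¹ := by
      rw [regroupTree, double_mul_of_right _ (by rw [inv_right, assoc_right, inv_one]),
        double_mul_of_right _ (show (regroupTree hΦ.unit n s).right = 1 from
          regroupPaB_right hΦ n (PaB.ofTree s)),
        double_inv_of_right (assoc_right _ _ _ _)]
    change regroupTree hΦ.unit n (PaB.doubleTree (.mul s t) j) =
      (assoc hΦ.unit (n + j) 1 1)⁻¹ * double (n + j) (regroupTree hΦ.unit n (.mul s t))
    rw [e1, PaB.doubleTree]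
    split_ifs with hj
    · have e2 : regroupTree hΦ.unit (n + (s.length + 1)) t = _ :=
        double_regroupPaB hΦ (n := n + s.length) (i := n + j) (by omega) (PaB.ofTree t)
      rw [regroupTree, PaB.length_doubleTree, hs n hj, e2,
        double_assoc_middle _ _ _ _ (by omega) (by omega)]
      change (assoc hΦ.unit (n + j) 1 1)⁻¹ *
        double (n + j) (regroupTree hΦ.unit (n + s.length) t) * _ * _ * _ = _
      group
    · have e2 : n + s.length + (j - s.length) = n + j := by omega
      have e3 : double (n + j) (regroupTree hΦ.unit n s) = regroupTree hΦ.unit n s :=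
        double_eq_self (m := n + s.length) (by omega) (regroupPaB_mem hΦ n (PaB.ofTree s))
      rw [regroupTree, PaB.length_doubleTree, ht (n + s.length) (by omega), e2, e3,
        double_assoc_right _ _ _ _ (by omega) (by omega)]
      group

theorem regroupPaB_double (hΦ : IsAssociator Φ) (p : PaB) (i : Fin p.length) :
    regroupPaB hΦ.unit 0 (p.double i) =
      (assoc hΦ.unit i 1 1)⁻¹ * double i (regroupPaB hΦ.unit 0 p) := by
  rcases p with _ | t
  · exact i.elim0
  · have h := regroupTree_doubleTree hΦ 0 t (j := i) i.2
    rw [zero_add] at h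
    exact h

/-! ### The braiding -/

variable [CharZero k]

theorem crossing_zero_right (c : k) (a : ℕ) : crossing c a 0 = 1 := by
  have h := crossing_neg (-c) 0 a
  rw [neg_neg, crossing_zero_left, inv_one] at h
  exact h

/-- This is the inverse of the hexagon for the negative sign. -/
theorem crossing_hexagon_right (hΦ : IsAssociator Φ) (a b b' : ℕ) :
    crossing (1 / 2) a (b + b') =
      (assoc hΦ.unit b b' a)⁻¹ * shift b (crossing (1 / 2) a b') * assoc hΦ.unit b a b' *
        crossing (1 / 2) a b * (assoc hΦ.unit a b b')⁻¹ := by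
  have h := crossing_hexagon hΦ (c := -(1 / 2)) (Or.inr rfl) b b' a
  rw [crossing_neg, crossing_neg, crossing_neg, map_inv] at h
  rw [← inv_inj, h]
  group

theorem regroupPaB_assoc (hΦ : IsAssociator Φ) (p q r : PaB) :
    regroupPaB hΦ.unit 0 (p * q * r) =
      regroupPaB hΦ.unit 0 (p * (q * r)) * assoc hΦ.unit p.length q.length r.length := by
  have h : (PaB.assocHom p q r).braid = 1 := rfl
  rw [← eval_assocHom, eval, h, map_one]
  group

theorem braidRep_braid (hΦ : IsAssociator Φ) {p q : PaB} (f : p ⟶ q) :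
    braidRep hΦ p.length f.braid =
      regroupPaB hΦ.unit 0 q * eval hΦ f * (regroupPaB hΦ.unit 0 p)⁻¹ := by
  rw [eval]; group

theorem braidRep_tensorHom_id (hΦ : IsAssociator Φ) {p q : PaB} (f : p ⟶ q) (r : PaB) :
    braidRep hΦ _ (PaB.tensorHom f (𝟙 r)).braid = braidRep hΦ _ f.braid := by
  have h : (PaB.tensorHom f (𝟙 r)).braid =
    Braid.cast (PaB.length_mul p r).symm (Braid.tensor f.braid 1) := rfl
  rw [h, braidRep_cast, Braid.tensor, map_one, mul_one, braidRep_inl]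

theorem braidRep_id_tensorHom (hΦ : IsAssociator Φ) {p q : PaB} (f : p ⟶ q) (r : PaB) :
    braidRep hΦ _ (PaB.tensorHom (𝟙 r) f).braid =
      braidRep hΦ _ (Braid.inr r.length f.braid) := by
  have h : (PaB.tensorHom (𝟙 r) f).braid =
    Braid.cast (PaB.length_mul r p).symm (Braid.tensor 1 f.braid) := rfl
  rw [h, braidRep_cast, Braid.tensor, map_one, one_mul]

/-- In the image the generators no longer carry bounds, so block crossings can be cut by splitting
`List.range`. -/
theorem braidRep_blockCrossing (hΦ : IsAssociator Φ) (n m : ℕ) :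
    braidRep hΦ (n + m) (Braid.blockCrossing n m) =
      ((List.range n).map fun i =>
        ((List.range m).reverse.map fun j => sigma hΦ.unit (i + j)).prod).prod := by
  rw [Braid.blockCrossing, map_list_prod, List.map_map,
    ← List.map_coe_finRange_eq_range (n := n), List.map_map]
  congr 1
  refine List.map_congr_left fun i _ => ?_
  simp only [Function.comp_apply]
  rw [map_list_prod, List.map_map, ← List.map_coe_finRange_eq_range, ← List.map_reverse,
    List.map_map]
  congr 1
  refine List.map_congr_left fun j _ => ?_
  simp only [Function.comp_apply]
  exact braidRep_gen hΦ _

theorem braidRep_inr_blockCrossing (hΦ : IsAssociator Φ) (l n m : ℕ) :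
    braidRep hΦ (l + (n + m)) (Braid.inr l (Braid.blockCrossing n m)) =
      ((List.range n).map fun i =>
        ((List.range m).reverse.map fun j => sigma hΦ.unit (l + (i + j))).prod).prod := by
  rw [Braid.blockCrossing, map_list_prod, map_list_prod, List.map_map, List.map_map,
    ← List.map_coe_finRange_eq_range (n := n), List.map_map]
  congr 1
  refine List.map_congr_left fun i _ => ?_
  simp only [Function.comp_apply]
  rw [map_list_prod, map_list_prod, List.map_map, List.map_map,
    ← List.map_coe_finRange_eq_range, ← List.map_reverse, List.map_map]
  congr 1
  refine List.map_congr_left fun j _ => ?_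
  simp only [Function.comp_apply, Braid.inr, Braid.lift_gen]
  exact braidRep_gen hΦ _

theorem braidRep_braidingHom (hΦ : IsAssociator Φ) (p q : PaB) :
    braidRep hΦ _ (PaB.braidingHom p q).braid =
      braidRep hΦ _ (Braid.blockCrossing p.length q.length) := by
  have h : (PaB.braidingHom p q).braid =
    Braid.cast (PaB.length_mul p q).symm (Braid.blockCrossing p.length q.length) := rfl
  rw [h, braidRep_cast]

/-- As braids, `c_{pp',q}` is `c_{p,q}` with `p'` added on the right, on top of `c_{p',q}` with `p`
added on the left: the outer product is cut after its first `|p|` factors. The associators record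
the changes of parenthesization. -/
theorem eval_braidingHom_mul_left (hΦ : IsAssociator Φ) (p p' q : PaB) :
    eval hΦ (PaB.braidingHom (p * p') q) =
      assoc hΦ.unit q.length p.length p'.length * eval hΦ (PaB.braidingHom p q) *
        (assoc hΦ.unit p.length q.length p'.length)⁻¹ *
        shift p.length (eval hΦ (PaB.braidingHom p' q)) *
          assoc hΦ.unit p.length p'.length q.length := by
  have hb : braidRep hΦ _ (PaB.braidingHom (p * p') q).braid =
      braidRep hΦ _ (PaB.tensorHom (PaB.braidingHom p q) (𝟙 p')).braid *
        braidRep hΦ _ (PaB.tensorHom (𝟙 p) (PaB.braidingHom p' q)).braid := by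
    rw [braidRep_tensorHom_id, braidRep_id_tensorHom, braidRep_braidingHom, braidRep_braidingHom,
      PaB.length_mul, braidRep_blockCrossing, braidRep_blockCrossing]
    have : (PaB.braidingHom p' q).braid =
      Braid.cast (PaB.length_mul p' q).symm (Braid.blockCrossing p'.length q.length) := rfl
    have e : braidRep hΦ _ (Braid.inr p.length (PaB.braidingHom p' q).braid) =
        braidRep hΦ _ (Braid.inr p.length (Braid.blockCrossing p'.length q.length)) := by
      rw [this, braidRep_inr, braidRep_inr, braidRep_cast, PaB.length_mul]
    rw [e, braidRep_inr_blockCrossing, List.range_add, List.map_append, List.prod_append,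
      List.map_map]
    simp only [Function.comp_def, add_assoc]
  rw [eval, hb, braidRep_braid, braidRep_braid, eval_tensorHom, eval_tensorHom, eval_id, eval_id,
    map_one, mul_one, one_mul, regroupPaB_assoc hΦ p p' q, regroupPaB_assoc hΦ p q p',
    regroupPaB_assoc hΦ q p p']
  group

/-- The other hexagon is needed only for a single strand on the left. The block crossing is then one
inner product, which can be cut without reordering factors. -/
theorem eval_braidingHom_point_mul (hΦ : IsAssociator Φ) (q q' : PaB) :
    eval hΦ (PaB.braidingHom PaB.point (q * q')) =
      (assoc hΦ.unit q.length q'.length 1)⁻¹ *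
        shift q.length (eval hΦ (PaB.braidingHom PaB.point q')) *
        assoc hΦ.unit q.length 1 q'.length * eval hΦ (PaB.braidingHom PaB.point q) *
          (assoc hΦ.unit 1 q.length q'.length)⁻¹ := by
  have hb : braidRep hΦ _ (PaB.braidingHom PaB.point (q * q')).braid =
      braidRep hΦ _ (PaB.tensorHom (𝟙 q) (PaB.braidingHom PaB.point q')).braid *
        braidRep hΦ _ (PaB.tensorHom (PaB.braidingHom PaB.point q) (𝟙 q')).braid := by
    rw [braidRep_tensorHom_id, braidRep_id_tensorHom, braidRep_braidingHom, braidRep_braidingHom,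
      PaB.length_mul, braidRep_blockCrossing, braidRep_blockCrossing]
    have : (PaB.braidingHom PaB.point q').braid =
      Braid.cast (PaB.length_mul PaB.point q').symm
        (Braid.blockCrossing PaB.point.length q'.length) := rfl
    have e : braidRep hΦ _ (Braid.inr q.length (PaB.braidingHom PaB.point q').braid) =
        braidRep hΦ _ (Braid.inr q.length (Braid.blockCrossing PaB.point.length q'.length)) := by
      rw [this, braidRep_inr, braidRep_inr, braidRep_cast, PaB.length_mul]
    rw [e, braidRep_inr_blockCrossing, PaB.length_point]
    simp [List.range_add, Function.comp_def]
  have hpt : PaB.point.length = 1 := rfl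
  rw [eval, hb, braidRep_braid, braidRep_braid, eval_tensorHom, eval_tensorHom, eval_id, eval_id,
    map_one, mul_one, one_mul, regroupPaB_assoc hΦ PaB.point q q',
    regroupPaB_assoc hΦ q PaB.point q', regroupPaB_assoc hΦ q q' PaB.point, hpt]
  group

/-- Both sides satisfy the same two hexagons. Induction on `p` reduces to one strand on the left,
induction on `q` to a single crossing, where the associators are trivial. -/
theorem eval_braidingHom (hΦ : IsAssociator Φ) (p q : PaB) :
    eval hΦ (PaB.braidingHom p q) = crossing (1 / 2) p.length q.length := by
  induction p using PaB.induction with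
  | one =>
    rw [eval, braidRep_braidingHom, braidRep_blockCrossing, PaB.length_one, crossing_zero_left,
      one_mul, mul_one]
    simp
  | mul p p' hp hp' =>
    rw [eval_braidingHom_mul_left, hp, hp', PaB.length_mul, crossing_hexagon hΦ (Or.inl rfl)]
  | point =>
    induction q using PaB.induction with
    | one =>
      rw [eval, braidRep_braidingHom, braidRep_blockCrossing, PaB.length_one, crossing_zero_right,
        one_mul, mul_one]
      simp
    | mul q q' hq hq' =>
      rw [eval_braidingHom_point_mul, hq, hq', PaB.length_mul, PaB.length_point,
        crossing_hexagon_right hΦ]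
    | point =>
      rw [eval, braidRep_braidingHom, braidRep_blockCrossing, regroupPaB_zero_mul]
      simp [sigma, assoc_zero_left, shift_zero]

/-! ### Cabling of the Artin generators -/

theorem double_sigma_of_lt (φ : (ChordHat k (Fin 3))ˣ) {i j : ℕ} (h : i < j) :
    double i (sigma φ j) = sigma φ (j + 1) := by
  have hr : (shift j (crossing (1 / 2 : k) 1 1)).right i = i := by
    rw [shift_right_apply, if_pos h]
  rw [sigma, double_mul_of_right _ (assoc_right _ _ _ _), double_mul, hr,
    double_inv_of_right (assoc_right _ _ _ _), double_assoc_left _ _ _ _ h, double_shift_of_lt h,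
    sigma]

/-- Doubling turns the crossing into one of two strands with one, which the hexagon expands. The
pentagon rewrites the shifted `Φ_{1,1,1}` in associators with first block `j` or `j + 1`; those with
a block of length two commute with the crossing inside that block and cancel. -/
theorem double_sigma_left (hΦ : IsAssociator Φ) (j : ℕ) :
    sigma hΦ.unit j * sigma hΦ.unit (j + 1) = (assoc hΦ.unit (j + 1) 1 1)⁻¹ *
      double j (sigma hΦ.unit j) * assoc hΦ.unit j 1 1 := by
  have hr : (shift j (crossing (1 / 2 : k) 1 1)).right j = j + 1 := by
    rw [shift_right_apply, if_neg (by omega), crossing_right, Nat.sub_self]; rfl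
  have hs : double j (shift j (crossing (1 / 2 : k) 1 1)) = shift j (crossing (1 / 2) 2 1) := by
    rw [← double_crossing_left]; exact double_shift j 0 _
  have hd : double j (sigma hΦ.unit j) = (assoc hΦ.unit j 1 2)⁻¹ *
      shift j (crossing (1 / 2) 2 1) * assoc hΦ.unit j 2 1 := by
    conv_lhs => rw [sigma]
    rw [double_mul_of_right _ (assoc_right _ _ _ _), double_mul, hr,
      double_inv_of_right (assoc_right _ _ _ _), hs,
      double_assoc_right _ _ _ _ (by omega) (by omega),
      double_assoc_middle _ _ _ _ (by omega) (by omega)]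
  have hex : crossing (1 / 2 : k) 2 1 = _ := crossing_hexagon hΦ (Or.inl rfl) 1 1 1
  have pent := assoc_pentagon hΦ j 1 1 1
  have c1 : Commute (shift j (crossing (1 / 2 : k) 1 1)) (assoc hΦ.unit j 2 1) :=
    commute_assoc (shift_mem (crossing_mem _ 1 1)) _ _ _ _ (Or.inr (Or.inl subset_rfl))
  have c2 : Commute (shift (j + 1) (crossing (1 / 2 : k) 1 1)) (assoc hΦ.unit j 1 2) :=
    commute_assoc (shift_mem (crossing_mem _ 1 1)) _ _ _ _ (Or.inr (Or.inr (Or.inl subset_rfl)))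
  rw [hd, hex, map_mul, map_mul, map_mul, map_mul, map_inv, shift_shift, sigma, sigma]
  have hP : shift j (assoc hΦ.unit 1 1 1) = assoc hΦ.unit j 1 2 * assoc hΦ.unit (j + 1) 1 1 *
      (assoc hΦ.unit j 1 1)⁻¹ * (assoc hΦ.unit j 2 1)⁻¹ := by
    rw [← pent]; group
  rw [hP]
  symm
  calc _ = (assoc hΦ.unit j 1 1)⁻¹ * ((assoc hΦ.unit j 2 1)⁻¹ *
        (shift j (crossing (1 / 2 : k) 1 1) * assoc hΦ.unit j 2 1)) * assoc hΦ.unit j 1 1 *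
        (assoc hΦ.unit (j + 1) 1 1)⁻¹ * ((assoc hΦ.unit j 1 2)⁻¹ *
        (shift (j + 1) (crossing (1 / 2 : k) 1 1) * assoc hΦ.unit j 1 2)) *
        assoc hΦ.unit (j + 1) 1 1 := by group
    _ = _ := by rw [c1.eq, c2.eq]; group

/-- The mirror computation, with the hexagon that splits the right block. -/
theorem double_sigma_right (hΦ : IsAssociator Φ) (j : ℕ) :
    sigma hΦ.unit (j + 1) * sigma hΦ.unit j = (assoc hΦ.unit j 1 1)⁻¹ *
      double (j + 1) (sigma hΦ.unit j) * assoc hΦ.unit (j + 1) 1 1 := by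
  have hr : (shift j (crossing (1 / 2 : k) 1 1)).right (j + 1) = j := by
    rw [shift_right_apply, if_neg (by omega), crossing_right, Nat.add_sub_cancel_left]; rfl
  have hs : double (j + 1) (shift j (crossing (1 / 2 : k) 1 1)) =
      shift j (crossing (1 / 2) 1 2) := by
    rw [← double_crossing_right]; exact double_shift j 1 _
  have hd : double (j + 1) (sigma hΦ.unit j) = (assoc hΦ.unit j 2 1)⁻¹ *
      shift j (crossing (1 / 2) 1 2) * assoc hΦ.unit j 1 2 := by
    conv_lhs => rw [sigma]
    rw [double_mul_of_right _ (assoc_right _ _ _ _), double_mul, hr,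
      double_inv_of_right (assoc_right _ _ _ _), hs,
      double_assoc_middle _ _ _ _ (by omega) (by omega),
      double_assoc_right _ _ _ _ (by omega) (by omega)]
  have hex : crossing (1 / 2 : k) 1 2 = _ := crossing_hexagon_right hΦ 1 1 1
  have pent := assoc_pentagon hΦ j 1 1 1
  have c1 : Commute (shift j (crossing (1 / 2 : k) 1 1)) (assoc hΦ.unit j 2 1) :=
    commute_assoc (shift_mem (crossing_mem _ 1 1)) _ _ _ _ (Or.inr (Or.inl subset_rfl))
  have c2 : Commute (shift (j + 1) (crossing (1 / 2 : k) 1 1)) (assoc hΦ.unit j 1 2) :=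
    commute_assoc (shift_mem (crossing_mem _ 1 1)) _ _ _ _ (Or.inr (Or.inr (Or.inl subset_rfl)))
  rw [hd, hex, map_mul, map_mul, map_mul, map_mul, map_inv, shift_shift, sigma, sigma]
  have hP : shift j (assoc hΦ.unit 1 1 1) = assoc hΦ.unit j 1 2 * assoc hΦ.unit (j + 1) 1 1 *
      (assoc hΦ.unit j 1 1)⁻¹ * (assoc hΦ.unit j 2 1)⁻¹ := by
    rw [← pent]; group
  rw [hP]
  symm
  calc _ = (assoc hΦ.unit (j + 1) 1 1)⁻¹ * ((assoc hΦ.unit j 1 2)⁻¹ *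
        (shift (j + 1) (crossing (1 / 2 : k) 1 1) * assoc hΦ.unit j 1 2)) *
        assoc hΦ.unit (j + 1) 1 1 * (assoc hΦ.unit j 1 1)⁻¹ * ((assoc hΦ.unit j 2 1)⁻¹ *
        (shift j (crossing (1 / 2 : k) 1 1) * assoc hΦ.unit j 2 1)) *
        assoc hΦ.unit j 1 1 := by group
    _ = _ := by rw [c1.eq, c2.eq]; group

end StrandGroup

theorem Braid.double_one {n : ℕ} (i : Fin n) : Braid.double i (1 : Braid n) = 1 := by
  simp [Braid.double]

theorem Braid.double_inv {n : ℕ} (i : Fin n) (x : Braid n) :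
    Braid.double i x⁻¹ = (Braid.double (Braid.perm x⁻¹ i) x)⁻¹ := by
  refine (inv_eq_of_mul_eq_one_right ?_).symm
  rw [← Braid.double_mul, mul_inv_cancel, Braid.double_one]

namespace StrandGroup

open SemidirectProduct StrandMap

variable {Φ : ChordHat k (Fin 3)} [CharZero k]

/-- The associators compare `ℓ (n + 1)` with the doubled `ℓ n`, at the bottom and top positions of
the strand. Both sides are multiplicative with the same shift of index, so generators suffice: the
strand passes to the left of the crossing, is one of its two strands, or passes to the right. -/
theorem braidRep_double (hΦ : IsAssociator Φ) {n : ℕ} (i : Fin n) (x : Braid n) :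
    braidRep hΦ (n + 1) (Braid.double i x) = (assoc hΦ.unit (Braid.perm x i) 1 1)⁻¹ *
      double i (braidRep hΦ n x) * assoc hΦ.unit i 1 1 := by
  induction x using Braid.induction generalizing i with
  | one => simp [Braid.double_one, double_one]
  | gen j h =>
    rw [Braid.double_gen, Braid.perm, Braid.lift_gen, Braid.swap_val, braidRep_gen]
    split_ifs <;> try omega
    · have c : Commute (assoc hΦ.unit i 1 1) (sigma hΦ.unit (j + 1)) :=
        commute_sigma _ (assoc_mem _ i.1 1 1) (by omega)
      rw [braidRep_gen, double_sigma_of_lt _ ‹i.1 < j›, mul_assoc, ← c.eq, inv_mul_cancel_left]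
    · rw [map_mul, braidRep_gen, braidRep_gen, double_sigma_left hΦ, ‹i.1 = j›]
    · rw [map_mul, braidRep_gen, braidRep_gen, double_sigma_right hΦ, ‹i.1 = j + 1›]
    · have c : Commute (sigma hΦ.unit j) (assoc hΦ.unit i 1 1) :=
        commute_assoc (sigma_mem _ j) _ _ _ _ (Or.inl (Set.Iio_subset_Iio (by omega)))
      rw [braidRep_gen, double_eq_self (m := j + 2) (by omega) (sigma_mem _ j), mul_assoc, c.eq,
        inv_mul_cancel_left]
  | mul x y hx hy =>
    rw [Braid.double_mul, map_mul, map_mul, map_mul, hx, hy, double_mul, braidRep_right,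
      Equiv.Perm.mul_apply]
    group
  | inv x hx =>
    have e : (braidRep hΦ n x).right⁻¹ (i : ℕ) = Braid.perm x⁻¹ i := by
      rw [← inv_right, ← map_inv, braidRep_right]
    rw [Braid.double_inv, map_inv, hx, map_inv (braidRep hΦ n), double_inv, e, ← Equiv.Perm.mul_apply,
      ← map_mul, mul_inv_cancel, map_one, Equiv.Perm.one_apply]
    group

/-- The corrections of `regroupPaB_double` at the two ends cancel those of `braidRep_double`. -/
theorem eval_doubleHom (hΦ : IsAssociator Φ) {p q : PaB} (f : p ⟶ q) (i : Fin p.length) :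
    eval hΦ (PaB.doubleHom f i) = double i (eval hΦ f) := by
  have h : (PaB.doubleHom f i).braid =
    Braid.cast (PaB.length_double p i).symm (Braid.double i f.braid) := rfl
  have ht : ((PaB.topIndex f i : Fin q.length) : ℕ) = Braid.perm f.braid i := rfl
  rw [eval, h, braidRep_cast, braidRep_double, regroupPaB_double, regroupPaB_double, ht, eval,
    double_mul_of_right _ (regroupPaB_right hΦ _ _), double_mul, braidRep_right,
    double_inv_of_right (regroupPaB_right hΦ _ _)]
  group

end StrandGroup

end BraidingAndCabling

/-! ### Return to finitely many strands, and construction of the functor. -/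

section DrinfeldFunctor

variable {k : Type u} [Field k]

namespace ChordHom

theorem mul_single_single {n m l : ℕ} (D' : ChordHat k (Fin l)) (τ : Fin m ≃ Fin l)
    (D : ChordHat k (Fin m)) (σ : Fin n ≃ Fin m) :
    mul (single D' τ) (single D σ) =
      single (D' * ChordHat.relabel τ.toEmbedding D) (σ.trans τ) := by
  unfold mul
  rw [Finset.sum_eq_single τ, Finset.sum_eq_single σ]
  · simp [single]
  · intro σ' _ h
    funext ρ
    simp [single, h]
    rfl
  · simp
  · intro τ' _ h
    refine Finset.sum_eq_zero fun σ' _ => ?_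
    funext ρ
    simp [single, h]
    rfl
  · simp

theorem tensor_single_single {n m n' m' : ℕ} (D : ChordHat k (Fin m)) (σ : Fin n ≃ Fin m)
    (D' : ChordHat k (Fin m')) (τ : Fin n' ≃ Fin m') :
    tensor (single D σ) (single D' τ) =
      single (ChordHat.relabel (Fin.castAddEmb m') D * ChordHat.relabel (Fin.natAddEmb m) D')
        (sumPerm σ τ) := by
  unfold tensor
  rw [Finset.sum_eq_single σ, Finset.sum_eq_single τ]
  · simp [single]
  · intro σ' _ h
    funext ρ
    simp [single, h]
    rfl
  · simp
  · intro τ' _ h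
    refine Finset.sum_eq_zero fun σ' _ => ?_
    funext ρ
    simp [single, h]
    rfl
  · simp

theorem double_single {n m : ℕ} (i : Fin n) (D : ChordHat k (Fin m)) (σ : Fin n ≃ Fin m) :
    double i (single D σ) = single (ChordHat.double (σ i) D) (doublePerm i σ) := by
  unfold double
  rw [Finset.sum_eq_single σ]
  · simp [single]
  · intro σ' _ h
    funext ρ
    simp [single, h]
    rfl
  · simp

end ChordHom

namespace StrandGroup

open SemidirectProduct StrandMap

/-- Removal of all the strands except the first `m` ones. -/
noncomputable def restrict (m : ℕ) : ChordHat k ℕ →ₐ[k] ChordHat k (Fin m) :=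
  ChordHat.cab (ofFun Fin.val)

open Classical in
/-- The morphism `n ⟶ m` given by an element `D · σ` that involves only the first `n = m`
strands. -/
noncomputable def toHom (n m : ℕ) (u : StrandGroup k) : ChordHom k n m :=
  -- Bijections are compared through their values in `ℕ`, so `n` and `m` may be equal only
  -- propositionally and no transport occurs.
  fun ρ => if ∀ i, (ρ i : ℕ) = u.right i then restrict m u.left.1 else 0

theorem toHom_eq_single {n m : ℕ} {u : StrandGroup k} {D : ChordHat k (Fin m)} {σ : Fin n ≃ Fin m}
    (hD : restrict m u.left.1 = D) (hσ : ∀ i, (σ i : ℕ) = u.right i) :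
    toHom n m u = ChordHom.single D σ := by
  funext ρ
  unfold toHom ChordHom.single
  rw [hD]
  refine if_congr ⟨fun h => ?_, ?_⟩ rfl rfl
  · ext i
    rw [h, hσ]
  · rintro rfl
    exact hσ

theorem exists_equiv {n : ℕ} {u : StrandGroup k} (hu : u ∈ supp k (Set.Iio n)) :
    ∃ σ : Fin n ≃ Fin n, ∀ i, (σ i : ℕ) = u.right i := by
  have h : ∀ i : Fin n, u.right i < n := fun i => (right_mem_of_mem_supp hu).2 i.2
  have hinj : Function.Injective (fun i : Fin n => (⟨u.right i, h i⟩ : Fin n)) := fun i j hij =>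
    Fin.ext (u.right.injective (Fin.mk.inj_iff.1 hij))
  exact ⟨Equiv.ofBijective _ (Finite.injective_iff_bijective.1 hinj), fun i => rfl⟩

theorem toHom_one (n : ℕ) : toHom n n (1 : StrandGroup k) = ChordHom.one n :=
  toHom_eq_single (map_one _) fun _ => rfl

/-- Because `v.right` preserves the first `n` strands, removing the others commutes with relabelling
by it. -/
theorem toHom_mul {n m l : ℕ} {u v : StrandGroup k} (hu : u ∈ supp k (Set.Iio n))
    (hv : v ∈ supp k (Set.Iio n)) (hm : n = m) (hl : m = l) :
    toHom n l (v * u) = ChordHom.mul (toHom m l v) (toHom n m u) := by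
  subst hm hl
  obtain ⟨σ, hσ⟩ := exists_equiv hu
  obtain ⟨τ, hτ⟩ := exists_equiv hv
  rw [toHom_eq_single rfl hσ, toHom_eq_single rfl hτ, ChordHom.mul_single_single]
  refine toHom_eq_single ?_ fun i => ?_
  · rw [mul_left, Units.val_mul, map_mul, relabelAut_val, ChordHat.relabel_eq_cab,
      ChordHat.relabel_eq_cab, restrict]
    congr 1
    refine ChordHat.cab_cab_eq (fun a x => ?_) _
    simp only [mem_ofEmb, Equiv.coe_toEmbedding, mem_ofFun, exists_eq_left]
    constructor
    · intro h
      refine ⟨τ.symm x, ?_, by simp⟩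
      refine v.right.injective ?_
      rw [← h, ← hτ, Equiv.apply_symm_apply]
    · rintro ⟨y, rfl, rfl⟩
      exact hτ y
  · rw [Equiv.trans_apply, hτ, hσ, mul_right, Equiv.Perm.mul_apply]

theorem toHom_tensor {n m n' m' : ℕ} {u v : StrandGroup k} (hu : u ∈ supp k (Set.Iio n))
    (hv : v ∈ supp k (Set.Iio n')) (hm : n = m) (hm' : n' = m') :
    toHom (n + n') (m + m') (u * shift n v) =
      ChordHom.tensor (toHom n m u) (toHom n' m' v) := by
  subst hm hm'
  obtain ⟨σ, hσ⟩ := exists_equiv hu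
  obtain ⟨τ, hτ⟩ := exists_equiv hv
  rw [toHom_eq_single rfl hσ, toHom_eq_single rfl hτ, ChordHom.tensor_single_single]
  refine toHom_eq_single ?_ fun i => ?_
  · rw [mul_left, Units.val_mul, map_mul, relabelAut_val, shift_left, unitsCab_val,
      ChordHat.relabel_eq_cab, ChordHat.relabel_eq_cab, ChordHat.relabel_eq_cab, restrict, restrict,
      restrict, ChordHat.cab_cab, ChordHat.cab_cab, ChordHat.cab_cab, ChordHat.cab_cab]
    congr 1
    -- The chords of `u` are on the first `n` strands, where keeping `n + n'` strands amounts to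
    -- keeping `n` and then including.
    · refine ChordHat.cab_eq_of_mem_on hu.1 _ _ fun a ha => Finset.ext fun x => ?_
      simp only [Set.mem_Iio] at ha
      simp only [mem_ofFun, mem_trans, mem_ofEmb, Fin.castAddEmb_apply]
      constructor
      · rintro rfl
        exact ⟨⟨x, ha⟩, rfl, rfl⟩
      · rintro ⟨y, rfl, rfl⟩
        rfl
    · congr 2
      refine ext_mem fun a x => ?_
      have hr : u.right (n + a) = n + a := hu.2.2 _ (by simp)
      simp only [mem_ofFun, mem_trans, mem_ofEmb, exists_eq_left, addLeftEmbedding_apply,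
        Equiv.coe_toEmbedding, hr, Fin.natAddEmb_apply]
      constructor
      · intro h
        exact ⟨⟨a, by omega⟩, rfl, Fin.ext h⟩
      · rintro ⟨y, rfl, rfl⟩
        rfl
  · rw [mul_right, Equiv.Perm.mul_apply, shift_right_apply]
    unfold ChordHom.sumPerm
    refine Fin.addCases (fun i => ?_) (fun i => ?_) i
    · simp [hσ]
    · have hr : u.right (n + v.right i) = n + v.right i := hu.2.2 _ (by simp)
      simp [hτ, hr]

theorem toHom_double {n m : ℕ} {u : StrandGroup k} (hu : u ∈ supp k (Set.Iio n)) (hm : n = m)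
    (i : Fin n) : toHom (n + 1) (m + 1) (double i u) = ChordHom.double i (toHom n m u) := by
  subst hm
  obtain ⟨σ, hσ⟩ := exists_equiv hu
  rw [toHom_eq_single rfl hσ, ChordHom.double_single]
  refine toHom_eq_single ?_ fun x => ?_
  · change ChordHat.cab _ (ChordHat.cab (doubleMap (u.right i)) u.left.1) = _
    rw [ChordHat.double, ChordHat.cable_eq_cab, restrict]
    refine ChordHat.cab_cab_eq (fun a x => ?_) _
    rw [← hσ]
    have hx : merge (σ i) x = Fin.predAbove (σ i) x := by
      unfold merge Fin.predAbove
      simp only [Fin.lt_def, Fin.val_castSucc]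
      split_ifs <;> first | omega | simp
    simp only [mem_doubleMap, mem_ofFun]
    constructor
    · rintro ⟨y, rfl, rfl⟩
      exact ⟨_, hx.symm, rfl⟩
    · rintro ⟨y, rfl, rfl⟩
      exact ⟨_, hx, rfl⟩
  · change _ = doublePerm i u.right x
    unfold ChordHom.doublePerm
    have hs : ∀ (j y : Fin n), ((j.castSucc.succAbove y : Fin (n + 1)) : ℕ) = skip j y := by
      intro j y
      unfold skip Fin.succAbove
      simp only [Fin.lt_def, Fin.val_castSucc]
      split_ifs <;> simp
    rcases eq_or_ne x i.castSucc with rfl | h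
    · simp [doublePerm_self, hσ]
    · obtain ⟨y, rfl⟩ := Fin.exists_succAbove_eq h
      rw [hs, doublePerm_skip]
      simp [hs, hσ]

theorem toHom_assoc (φ : (ChordHat k (Fin 3))ˣ) (a b c : ℕ) :
    toHom (a + b + c) (a + b + c) (assoc φ a b c) = cabledAssociator φ.1 a b c := by
  refine toHom_eq_single ?_ fun i => rfl
  rw [restrict, ChordHat.cable_eq_cab]
  refine ChordHat.cab_cab_eq_cab (fun i x => ?_) _
  have hx := x.2
  revert i
  simp only [Fin.forall_fin_succ, mem_ofFun]
  split_ifs <;> simp <;> omega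

theorem toHom_crossing [CharZero k] (a b : ℕ) :
    toHom (a + b) (b + a) (crossing (1 / 2) a b) = cabledR k a b := by
  have h1 : (inr (blockPerm a b) : StrandGroup k) ∈ supp k (Set.Iio (a + b)) :=
    inr_mem fun i hi => by
      simp only [Set.mem_Iio] at hi
      rw [blockPerm_apply, if_neg (by omega), if_neg (by omega)]
  have h2 : (inl (unitsCab (block₂ a b) (expUnit (1 / 2))) : StrandGroup k) ∈
      supp k (Set.Iio (a + b)) := inl_unitsCab_mem _ (fun i x hx => by
    revert i
    simp [Fin.forall_fin_succ]
    omega) _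
  rw [crossing, toHom_mul h2 h1 rfl (Nat.add_comm a b), cabledR]
  congr 1
  · refine toHom_eq_single (map_one _) fun i => ?_
    rw [right_inr, blockPerm_apply]
    refine Fin.addCases (fun i => ?_) (fun i => ?_) i
    · simp [Nat.add_comm]
    · simp
  · refine toHom_eq_single ?_ fun i => rfl
    rw [restrict, ChordHat.cable_eq_cab]
    refine ChordHat.cab_cab_eq_cab (fun i x => ?_) _
    have hx := x.2
    revert i
    simp only [Fin.forall_fin_succ, mem_ofFun]
    split_ifs <;> simp <;> omega

/-- Transport changes only the parameters of `toHom`, never the group element, so all coherence with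
`eqToHom` is absorbed here. -/
theorem eqToHom_comp_toHom {n m n' m' : ℕ} (h : (⟨n'⟩ : ChordCat k) = ⟨n⟩)
    (h' : (⟨m⟩ : ChordCat k) = ⟨m'⟩) (u : StrandGroup k) :
    eqToHom h ≫ (show (⟨n⟩ : ChordCat k) ⟶ ⟨m⟩ from toHom n m u) ≫ eqToHom h' =
      toHom n' m' u := by
  cases h
  cases h'
  simp

/-- The functor associated with an associator. -/
noncomputable def drinfeldFunctor [CharZero k] {Φ : ChordHat k (Fin 3)} (hΦ : IsAssociator Φ) :
    PaB ⥤ ChordCat k where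
  obj p := ⟨p.length⟩
  map {p q} f := toHom p.length q.length (eval hΦ f)
  map_id p := by
    rw [eval_id]
    exact toHom_one _
  map_comp {p q r} f g := by
    have hg : eval hΦ g ∈ supp k (Set.Iio p.length) := by
      rw [f.length_eq]; exact eval_mem hΦ g
    rw [eval_comp]
    exact toHom_mul (eval_mem hΦ f) hg f.length_eq g.length_eq

theorem drinfeldFunctor_obj [CharZero k] {Φ : ChordHat k (Fin 3)} (hΦ : IsAssociator Φ) (p : PaB) :
    (drinfeldFunctor hΦ).obj p = ⟨p.length⟩ := rfl

theorem mapOfLength_drinfeldFunctor [CharZero k] {Φ : ChordHat k (Fin 3)} (hΦ : IsAssociator Φ)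
    (h : ∀ p, (drinfeldFunctor hΦ).obj p = ⟨p.length⟩) {p q : PaB} (f : p ⟶ q) {n m : ℕ}
    (hn : p.length = n) (hm : q.length = m) :
    mapOfLength (drinfeldFunctor hΦ) h f hn hm = toHom n m (eval hΦ f) := by
  subst hn hm
  exact eqToHom_comp_toHom _ _ _

theorem isDrinfeldFunctor_drinfeldFunctor [CharZero k] {Φ : ChordHat k (Fin 3)}
    (hΦ : IsAssociator Φ) : IsDrinfeldFunctor Φ (drinfeldFunctor hΦ) where
  strictMonoidal :=
    { obj_one := rfl
      obj_mul := fun p q => congrArg ChordCat.mk (PaB.length_mul p q)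
      map_tensor := fun {p q p' q'} f g => by
        have h := toHom_tensor (eval_mem hΦ f) (eval_mem hΦ g) f.length_eq g.length_eq
        change toHom (p * p').length (q * q').length (eval hΦ (PaB.tensorHom f g)) =
          eqToHom _ ≫ (show (⟨p.length + p'.length⟩ : ChordCat k) ⟶ ⟨q.length + q'.length⟩ from
            ChordHom.tensor (toHom p.length q.length (eval hΦ f))
              (toHom p'.length q'.length (eval hΦ g))) ≫ eqToHom _
        rw [← h, eval_tensorHom]
        exact (eqToHom_comp_toHom _ _ _).symm }
  obj_eq := drinfeldFunctor_obj hΦ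
  map_braiding p q := by
    rw [mapOfLength_drinfeldFunctor, eval_braidingHom, toHom_crossing]
  map_assoc p q r := by
    rw [mapOfLength_drinfeldFunctor, eval_assocHom, toHom_assoc, IsAssociator.unit_val]

theorem commutesWithCabling_drinfeldFunctor [CharZero k] {Φ : ChordHat k (Fin 3)}
    (hΦ : IsAssociator Φ) (h : ∀ p, (drinfeldFunctor hΦ).obj p = ⟨p.length⟩) :
    CommutesWithCabling (drinfeldFunctor hΦ) h := by
  intro p q f i
  rw [mapOfLength_drinfeldFunctor, mapOfLength_drinfeldFunctor, eval_doubleHom,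
    toHom_double (eval_mem hΦ f) f.length_eq]

end StrandGroup

end DrinfeldFunctor

/-! ### Generation of parenthesized braids, and uniqueness. -/

section Uniqueness

namespace PaB

/-- The identity braid between two parenthesizations of the same number of points. -/
def idHom (p q : PaB) (h : p.length = q.length) : p ⟶ q := Hom.mk h 1

theorem idHom_self (p : PaB) : idHom p p rfl = 𝟙 p := rfl

theorem comp_braid {p q r : PaB} (f : p ⟶ q) (g : q ⟶ r) :
    (f ≫ g).braid = Braid.cast f.length_eq.symm g.braid * f.braid := rfl

theorem tensorHom_braid {p q p' q' : PaB} (f : p ⟶ q) (g : p' ⟶ q') :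
    (tensorHom f g).braid = Braid.cast (length_mul p p').symm (Braid.tensor f.braid g.braid) := rfl

theorem idHom_braid (p q : PaB) (h : p.length = q.length) : (idHom p q h).braid = 1 := rfl

theorem id_braid (p : PaB) : (𝟙 p : p ⟶ p).braid = 1 := rfl

theorem hom_ext {p q : PaB} {f g : p ⟶ q} (h : f.braid = g.braid) : f = g := Hom.ext h

theorem idHom_comp_idHom (p q r : PaB) (h : p.length = q.length) (h' : q.length = r.length) :
    idHom p q h ≫ idHom q r h' = idHom p r (h.trans h') :=
  hom_ext (by simp [comp_braid, idHom_braid])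

theorem tensorHom_idHom (p q p' q' : PaB) (h : p.length = q.length) (h' : p'.length = q'.length) :
    tensorHom (idHom p q h) (idHom p' q' h') =
      idHom (p * p') (q * q') (by rw [length_mul, length_mul, h, h']) :=
  hom_ext (by simp [tensorHom_braid, idHom_braid, Braid.tensor])

/-- The left-normed parenthesization of `n` points. -/
def leftNormed : ℕ → PaB
  | 0 => 1
  | n + 1 => leftNormed n * point

@[simp] theorem length_leftNormed (n : ℕ) : (leftNormed n).length = n := by
  induction n with
  | zero => rfl
  | succ n ih => rw [leftNormed, length_mul, ih, length_point]

/-- A braid, with both ends parenthesized by the left-normed parenthesization. -/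
def braidHom (n : ℕ) (b : Braid n) : leftNormed n ⟶ leftNormed n :=
  Hom.mk rfl (Braid.cast (length_leftNormed n).symm b)

theorem braidHom_braid (n : ℕ) (b : Braid n) :
    (braidHom n b).braid = Braid.cast (length_leftNormed n).symm b := rfl

theorem braidHom_one (n : ℕ) : braidHom n 1 = 𝟙 _ :=
  hom_ext (by rw [braidHom_braid, map_one, id_braid])

theorem braidHom_mul (n : ℕ) (x y : Braid n) : braidHom n (x * y) = braidHom n y ≫ braidHom n x :=
  hom_ext (by rw [comp_braid, braidHom_braid, braidHom_braid, braidHom_braid, map_mul,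
    Braid.cast_refl])

theorem _root_.Braid.cast_gen {n m : ℕ} (h : n = m) (i : ℕ) (hi : i + 1 < n) :
    Braid.cast h (Braid.gen i hi) = Braid.gen i (h ▸ hi) := by
  subst h; rfl

/-- Since `ℓ (n + 1) = ℓ n ⊗ •`, a generator that does not touch the last strand is obtained by
juxtaposition. -/
theorem braidHom_gen_of_lt {n i : ℕ} (h : i + 1 < n) (h' : i + 1 < n + 1) :
    braidHom (n + 1) (Braid.gen i h') = tensorHom (braidHom n (Braid.gen i h)) (𝟙 point) := by
  refine hom_ext ?_
  rw [tensorHom_braid, braidHom_braid, braidHom_braid, id_braid, Braid.tensor, map_one, mul_one,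
    Braid.cast_gen, Braid.cast_gen, Braid.inl, Braid.lift_gen, Braid.cast_gen]
  rfl

/-- The last two points are grouped, crossed and ungrouped, so the last generator is expressed by an
associativity morphism, its inverse and `c_{•,•}`. -/
theorem braidHom_gen_last (i : ℕ) (h : i + 1 < i + 2) :
    braidHom (i + 2) (Braid.gen i h) = assocHom (leftNormed i) point point ≫
      tensorHom (𝟙 (leftNormed i)) (braidingHom point point) ≫
        idHom (leftNormed i * (point * point)) (leftNormed i * point * point)
          (by simp only [length_mul, Nat.add_assoc]) := by
  refine hom_ext ?_
  have h1 : (assocHom (leftNormed i) point point).braid = 1 := rfl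
  have h3 : Braid.blockCrossing 1 1 = Braid.gen 0 (by omega) := by
    simp [Braid.blockCrossing, List.finRange_succ]
  have h2 : (braidingHom point point).braid = Braid.gen 0 (by simp) :=
    (congrArg (Braid.cast (length_mul point point).symm) h3).trans (Braid.cast_gen _ _ _)
  rw [comp_braid, comp_braid, tensorHom_braid, braidHom_braid, id_braid, idHom_braid, Braid.tensor,
    map_one, map_one, one_mul, one_mul, h1, mul_one, h2, Braid.cast_gen,
    Braid.inr, Braid.lift_gen, Braid.cast_gen, Braid.cast_gen]
  congr 1
  simp

end PaB

variable {k : Type u} [Field k]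

namespace ChordCat

theorem eqToHom_comp_tensor {X Y X' Y' : ChordCat k} {n m n' m' : ℕ} (hX : X = ⟨n⟩) (hY : Y = ⟨m⟩)
    (hX' : X' = ⟨n'⟩) (hY' : Y' = ⟨m'⟩) (f : X ⟶ Y) (g : X' ⟶ Y')
    (h : (⟨n + n'⟩ : ChordCat k) = ⟨X.strands + X'.strands⟩)
    (h' : (⟨Y.strands + Y'.strands⟩ : ChordCat k) = ⟨m + m'⟩) :
    eqToHom h ≫ (show (⟨X.strands + X'.strands⟩ : ChordCat k) ⟶ ⟨Y.strands + Y'.strands⟩ from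
        ChordHom.tensor f g) ≫ eqToHom h' =
      ChordHom.tensor
        (show ChordHom k n m from
          (eqToHom hX.symm ≫ f ≫ eqToHom hY : (⟨n⟩ : ChordCat k) ⟶ ⟨m⟩))
        (show ChordHom k n' m' from
          (eqToHom hX'.symm ≫ g ≫ eqToHom hY' : (⟨n'⟩ : ChordCat k) ⟶ ⟨m'⟩)) := by
  subst hX hY hX' hY'
  simp

end ChordCat

section MapOfLength

variable (Z : PaB ⥤ ChordCat k) (hZ : ∀ p, Z.obj p = ⟨p.length⟩)

theorem mapOfLength_id (p : PaB) : mapOfLength Z hZ (𝟙 p) rfl rfl = ChordHom.one p.length := by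
  unfold mapOfLength
  rw [Z.map_id]
  simp
  rfl

theorem mapOfLength_comp {p q r : PaB} (f : p ⟶ q) (g : q ⟶ r) :
    mapOfLength Z hZ (f ≫ g) rfl rfl =
      ChordHom.mul (mapOfLength Z hZ g rfl rfl) (mapOfLength Z hZ f rfl rfl) := by
  have h : (eqToHom (hZ p).symm ≫ Z.map (f ≫ g) ≫ eqToHom (hZ r) :
      (⟨p.length⟩ : ChordCat k) ⟶ ⟨r.length⟩) =
      (eqToHom (hZ p).symm ≫ Z.map f ≫ eqToHom (hZ q)) ≫
        (eqToHom (hZ q).symm ≫ Z.map g ≫ eqToHom (hZ r)) := by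
    simp
  exact h

theorem mapOfLength_tensorHom (hs : IsStrictMonoidal Z) {p q p' q' : PaB} (f : p ⟶ q)
    (g : p' ⟶ q') :
    mapOfLength Z hZ (PaB.tensorHom f g) (PaB.length_mul p p') (PaB.length_mul q q') =
      ChordHom.tensor (mapOfLength Z hZ f rfl rfl) (mapOfLength Z hZ g rfl rfl) := by
  unfold mapOfLength
  rw [hs.map_tensor]
  refine Eq.trans ?_ (ChordCat.eqToHom_comp_tensor (hZ p) (hZ q) (hZ p') (hZ q') (Z.map f)
    (Z.map g) (by rw [hZ, hZ]) (by rw [hZ, hZ]))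
  simp

end MapOfLength

/-- Two functors with `Z p = |p|` agree on a morphism. -/
def AgreeOn (Z Z' : PaB ⥤ ChordCat k) (hZ : ∀ p, Z.obj p = ⟨p.length⟩)
    (hZ' : ∀ p, Z'.obj p = ⟨p.length⟩) {p q : PaB} (f : p ⟶ q) : Prop :=
  mapOfLength Z hZ f rfl rfl = mapOfLength Z' hZ' f rfl rfl

namespace AgreeOn

variable {Z Z' : PaB ⥤ ChordCat k} {hZ : ∀ p, Z.obj p = ⟨p.length⟩}
  {hZ' : ∀ p, Z'.obj p = ⟨p.length⟩}

theorem of_mapOfLength {p q : PaB} {f : p ⟶ q} {n m : ℕ} (hn : p.length = n) (hm : q.length = m)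
    (h : mapOfLength Z hZ f hn hm = mapOfLength Z' hZ' f hn hm) : AgreeOn Z Z' hZ hZ' f := by
  subst hn hm
  exact h

theorem id (p : PaB) : AgreeOn Z Z' hZ hZ' (𝟙 p) := by
  rw [AgreeOn, mapOfLength_id, mapOfLength_id]

theorem comp {p q r : PaB} {f : p ⟶ q} {g : q ⟶ r} (hf : AgreeOn Z Z' hZ hZ' f)
    (hg : AgreeOn Z Z' hZ hZ' g) : AgreeOn Z Z' hZ hZ' (f ≫ g) := by
  rw [AgreeOn, mapOfLength_comp, mapOfLength_comp, hf, hg]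

/-- The values of the two functors on `g` are inverses of the same morphism. -/
theorem of_inverse {p q : PaB} {f : p ⟶ q} {g : q ⟶ p} (hf : AgreeOn Z Z' hZ hZ' f)
    (hfg : f ≫ g = 𝟙 p) (hgf : g ≫ f = 𝟙 q) : AgreeOn Z Z' hZ hZ' g := by
  have h1 := mapOfLength_comp Z hZ f g
  have h2 := mapOfLength_comp Z' hZ' g f
  rw [hfg, mapOfLength_id] at h1
  rw [hgf, mapOfLength_id, ← hf] at h2
  rw [AgreeOn, ← ChordHom.mul_one (mapOfLength Z hZ g rfl rfl), h2, ChordHom.mul_assoc, ← h1,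
    ChordHom.one_mul]

theorem tensorHom (hs : IsStrictMonoidal Z) (hs' : IsStrictMonoidal Z') {p q p' q' : PaB}
    {f : p ⟶ q} {g : p' ⟶ q'} (hf : AgreeOn Z Z' hZ hZ' f) (hg : AgreeOn Z Z' hZ hZ' g) :
    AgreeOn Z Z' hZ hZ' (PaB.tensorHom f g) := by
  refine of_mapOfLength (PaB.length_mul p p') (PaB.length_mul q q') ?_
  rw [mapOfLength_tensorHom Z hZ hs, mapOfLength_tensorHom Z' hZ' hs', hf, hg]

theorem map_eq {p q : PaB} {f : p ⟶ q} (hf : AgreeOn Z Z' hZ hZ' f) :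
    Z.map f = eqToHom ((hZ p).trans (hZ' p).symm) ≫ Z'.map f ≫
      eqToHom ((hZ' q).trans (hZ q).symm) := by
  have h : (eqToHom (hZ p).symm ≫ Z.map f ≫ eqToHom (hZ q) :
      (⟨p.length⟩ : ChordCat k) ⟶ ⟨q.length⟩) =
      eqToHom (hZ' p).symm ≫ Z'.map f ≫ eqToHom (hZ' q) := hf
  have e : Z.map f = eqToHom (hZ p) ≫ (eqToHom (hZ p).symm ≫ Z.map f ≫ eqToHom (hZ q)) ≫
      eqToHom (hZ q).symm := by simp
  rw [e, h]
  simp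

end AgreeOn

variable {Φ : ChordHat k (Fin 3)} {Z Z' : PaB ⥤ ChordCat k}

namespace IsDrinfeldFunctor

theorem agreeOn_assocHom (hZ : IsDrinfeldFunctor Φ Z) (hZ' : IsDrinfeldFunctor Φ Z')
    (p q r : PaB) : AgreeOn Z Z' hZ.obj_eq hZ'.obj_eq (PaB.assocHom p q r) :=
  AgreeOn.of_mapOfLength _ _ ((hZ.map_assoc p q r).trans (hZ'.map_assoc p q r).symm)

theorem agreeOn_braidingHom (hZ : IsDrinfeldFunctor Φ Z) (hZ' : IsDrinfeldFunctor Φ Z')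
    (p q : PaB) : AgreeOn Z Z' hZ.obj_eq hZ'.obj_eq (PaB.braidingHom p q) :=
  AgreeOn.of_mapOfLength _ _ ((hZ.map_braiding p q).trans (hZ'.map_braiding p q).symm)

theorem agreeOn_idHom_symm (hZ : IsDrinfeldFunctor Φ Z) (hZ' : IsDrinfeldFunctor Φ Z') {p q : PaB}
    {h : p.length = q.length} (hf : AgreeOn Z Z' hZ.obj_eq hZ'.obj_eq (PaB.idHom p q h)) :
    AgreeOn Z Z' hZ.obj_eq hZ'.obj_eq (PaB.idHom q p h.symm) :=
  hf.of_inverse (by rw [PaB.idHom_comp_idHom, PaB.idHom_self])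
    (by rw [PaB.idHom_comp_idHom, PaB.idHom_self])

theorem agreeOn_idHom_of_eq (hZ : IsDrinfeldFunctor Φ Z) (hZ' : IsDrinfeldFunctor Φ Z') {p q : PaB}
    (e : p = q) (h : p.length = q.length) :
    AgreeOn Z Z' hZ.obj_eq hZ'.obj_eq (PaB.idHom p q h) := by
  subst e
  exact AgreeOn.id p

/-- The path is the one used in `regroupTree`, now read as a composite of morphisms on which the
functors agree. -/
theorem agreeOn_idHom_leftNormed_mul (hZ : IsDrinfeldFunctor Φ Z) (hZ' : IsDrinfeldFunctor Φ Z')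
    (n : ℕ) (q : PaB) : AgreeOn Z Z' hZ.obj_eq hZ'.obj_eq
      (PaB.idHom (PaB.leftNormed n * q) (PaB.leftNormed (n + q.length)) (by simp)) := by
  induction q using PaB.induction generalizing n with
  | one => exact agreeOn_idHom_of_eq hZ hZ' (mul_one _) _
  | point => exact agreeOn_idHom_of_eq hZ hZ' rfl _
  | mul q r hq hr =>
    have h1 : AgreeOn Z Z' hZ.obj_eq hZ'.obj_eq
        (PaB.idHom (PaB.leftNormed n * q * r) (PaB.leftNormed n * (q * r)) (by simp [add_assoc])) :=
      agreeOn_assocHom hZ hZ' _ _ _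
    have h2 := (hq n).tensorHom hZ.strictMonoidal hZ'.strictMonoidal (AgreeOn.id r)
    rw [← PaB.idHom_self, PaB.tensorHom_idHom] at h2
    have h3 := ((agreeOn_idHom_symm hZ hZ' h1).comp h2).comp (hr (n + q.length))
    have h4 : AgreeOn Z Z' hZ.obj_eq hZ'.obj_eq
        (PaB.idHom (PaB.leftNormed (n + q.length + r.length))
          (PaB.leftNormed (n + (q * r).length)) (by simp [add_assoc])) :=
      agreeOn_idHom_of_eq hZ hZ' (by rw [PaB.length_mul, add_assoc]) _
    have h5 := h3.comp h4
    rwa [PaB.idHom_comp_idHom, PaB.idHom_comp_idHom, PaB.idHom_comp_idHom] at h5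

theorem agreeOn_idHom_leftNormed (hZ : IsDrinfeldFunctor Φ Z) (hZ' : IsDrinfeldFunctor Φ Z')
    (p : PaB) : AgreeOn Z Z' hZ.obj_eq hZ'.obj_eq
      (PaB.idHom p (PaB.leftNormed p.length) (by simp)) := by
  have h1 : AgreeOn Z Z' hZ.obj_eq hZ'.obj_eq
      (PaB.idHom p (PaB.leftNormed 0 * p) (by simp [PaB.leftNormed])) :=
    agreeOn_idHom_of_eq hZ hZ' (one_mul p).symm _
  have h2 : AgreeOn Z Z' hZ.obj_eq hZ'.obj_eq
      (PaB.idHom (PaB.leftNormed (0 + p.length)) (PaB.leftNormed p.length) (by simp)) :=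
    agreeOn_idHom_of_eq hZ hZ' (by rw [zero_add]) _
  have h3 := (h1.comp (agreeOn_idHom_leftNormed_mul hZ hZ' 0 p)).comp h2
  rwa [PaB.idHom_comp_idHom, PaB.idHom_comp_idHom] at h3

theorem agreeOn_braidHom (hZ : IsDrinfeldFunctor Φ Z) (hZ' : IsDrinfeldFunctor Φ Z') {n : ℕ}
    (b : Braid n) : AgreeOn Z Z' hZ.obj_eq hZ'.obj_eq (PaB.braidHom n b) := by
  induction b using Braid.induction with
  | one => rw [PaB.braidHom_one]; exact AgreeOn.id _
  | mul x y hx hy => rw [PaB.braidHom_mul]; exact hy.comp hx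
  | inv x hx =>
    refine hx.of_inverse ?_ ?_
    · rw [← PaB.braidHom_mul, inv_mul_cancel, PaB.braidHom_one]
    · rw [← PaB.braidHom_mul, mul_inv_cancel, PaB.braidHom_one]
  | gen i h =>
    -- The last strands are peeled off until the generator acts on the last two points.
    induction n with
    | zero => omega
    | succ n ih =>
      by_cases hi : i + 1 < n
      · rw [PaB.braidHom_gen_of_lt hi]
        exact (ih hi).tensorHom hZ.strictMonoidal hZ'.strictMonoidal (AgreeOn.id _)
      · obtain rfl : n = i + 1 := by omega
        rw [PaB.braidHom_gen_last]
        refine (agreeOn_assocHom hZ hZ' _ _ _).comp (((AgreeOn.id _).tensorHom hZ.strictMonoidal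
          hZ'.strictMonoidal (agreeOn_braidingHom hZ hZ' _ _)).comp ?_)
        have h1 : AgreeOn Z Z' hZ.obj_eq hZ'.obj_eq
            (PaB.idHom (PaB.leftNormed i * PaB.point * PaB.point)
              (PaB.leftNormed i * (PaB.point * PaB.point)) (by simp [add_assoc])) :=
          agreeOn_assocHom hZ hZ' _ _ _
        exact agreeOn_idHom_symm hZ hZ' h1

/-- Every morphism factors through the left-normed parenthesization, with trivial braids on both
sides of a braid with left-normed ends. -/
theorem agreeOn (hZ : IsDrinfeldFunctor Φ Z) (hZ' : IsDrinfeldFunctor Φ Z') {p q : PaB}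
    (f : p ⟶ q) : AgreeOn Z Z' hZ.obj_eq hZ'.obj_eq f := by
  have e : f = PaB.idHom p (PaB.leftNormed p.length) (by simp) ≫
      PaB.braidHom p.length f.braid ≫
        PaB.idHom (PaB.leftNormed p.length) q (by simp [f.length_eq]) := by
    refine PaB.hom_ext ?_
    rw [PaB.comp_braid, PaB.comp_braid, PaB.idHom_braid, PaB.idHom_braid, PaB.braidHom_braid]
    simp
  have hq := agreeOn_idHom_symm hZ hZ' (agreeOn_idHom_leftNormed hZ hZ' q)
  have h2 : AgreeOn Z Z' hZ.obj_eq hZ'.obj_eq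
      (PaB.idHom (PaB.leftNormed p.length) (PaB.leftNormed q.length) (by simp [f.length_eq])) :=
    agreeOn_idHom_of_eq hZ hZ' (by rw [f.length_eq]) _
  have h3 := h2.comp hq
  rw [PaB.idHom_comp_idHom] at h3
  rw [e]
  exact (agreeOn_idHom_leftNormed hZ hZ' p).comp ((agreeOn_braidHom hZ hZ' _).comp h3)

theorem unique (hZ : IsDrinfeldFunctor Φ Z) (hZ' : IsDrinfeldFunctor Φ Z') : Z = Z' :=
  CategoryTheory.Functor.ext (fun p => (hZ.obj_eq p).trans (hZ'.obj_eq p).symm)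
    fun _ _ f => (agreeOn hZ hZ' f).map_eq

end IsDrinfeldFunctor

end Uniqueness

theorem mainTheorem4 {k : Type*} [Field k] [CharZero k] (Φ : ChordHat k (Fin 3))
    (hΦ : IsAssociator Φ) :
    (∃! Z : PaB ⥤ ChordCat k, IsDrinfeldFunctor Φ Z) ∧
      ∀ (Z : PaB ⥤ ChordCat k) (hZ : IsDrinfeldFunctor Φ Z), CommutesWithCabling Z hZ.obj_eq := by
  have hD := StrandGroup.isDrinfeldFunctor_drinfeldFunctor hΦ
  refine ⟨⟨_, hD, fun Z hZ => hZ.unique hD⟩, fun Z hZ => ?_⟩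
  -- By uniqueness, compatibility with cabling has to be known only for the functor constructed
  -- above.
  obtain rfl := hZ.unique hD
  exact StrandGroup.commutesWithCabling_drinfeldFunctor hΦ _
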